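/- Let $B=\{B_t,\ t\ge 0\}$ be a standard Brownian motion on a probability space $(\Omega,\mathcal A,P)$, let $\mathcal F$ be the $P$-completion of the $\sigma$-field generated by $B$, and let $\mathcal F_t$ be the ($P$-completed) natural filtration of $B$. Let $u=\{u_{s,t},\ 0\le s\le t\le 1\}$ be a jointly measurable two-parameter process such that (i) $u_{s,t}$ is $\mathcal F_s$-measurable for all $0\le s\le t\le 1$; (ii) $\int_0^1\int_0^t E(u_{s,t}^2)\,ds\,dt<\infty$; (iii) $u$ is continuous at $(1,1)$ in $L^2(\Omega)$, i.e. $E\big[(u_{s,t}-u_{1,1})^2\big]\to 0$ as $(s,t)\to(1,1)$ with $0\le s\le t\le 1$. Let $\phi_n$ be bounded nonnegative measurable functions on $[0,1]$ satisfying: (h1) there is a sequence $\alpha_n\uparrow 1$ in $[0,1]$ such that $\lim_{n}\int_{\alpha_n}^1\phi_n^2(t)\,dt=\lim_n\int_0^1\phi_n^2(t)\,dt=L>0$; (h3) for every $\delta\in[0,1)$, $\big(\sup_{0\le t\le\delta}\phi_n(t)\big)\big(\sup_{0\le t\le 1}\phi_n(t)\big)\to 0$ as $n\to\infty$. Then the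 iterated Itô integrals $$F_n=\int_0^1\int_0^t\phi_n(s)\phi_n(t)\,u_{s,t}\,dB_s\,dB_t$$ are well defined, and $F_n$ converges stably, as $n\to\infty$, to $\tfrac12 L\,u_{1,1}H_2(Z)$, where $H_2(x)=x^2-1$ and $Z\sim N(0,1)$ is a random variable independent of the process $B$, defined on an extension $(\Omega',\mathcal F',P')$ of the probability space. Here stable convergence of $F_n$ to a random variable $G$ on $\Omega'$ means that $E[Ye^{i\lambda F_n}]\to E'[Ye^{i\lambda G}]$ for every $\lambda\in\mathbb R$ and every bounded $\mathcal F$-measurable random variable $Y$. -/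

import Mathlib

open MeasureTheory ProbabilityTheory Filter Topology
open scoped NNReal ENNReal

/-- The `P`-completion of the σ-algebra generated by the whole process `B`. -/
@[reducible]
def brownianSigma {Ω : Type*} [MeasurableSpace Ω] (B : ℝ≥0 → Ω → ℝ) (P : Measure Ω) :
    MeasurableSpace Ω :=
  eventuallyMeasurableSpace (⨆ r : ℝ≥0, MeasurableSpace.comap (B r) inferInstance) (ae P)

/-- The natural filtration of `B`, completed by the `P`-null sets: `𝓕_t` is generated by
`B_r`, `r ≤ t`, and the null sets. -/
@[reducible]
def brownianFiltration {Ω : Type*} [MeasurableSpace Ω] (B : ℝ≥0 → Ω → ℝ) (P : Measure Ω)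
    (t : ℝ≥0) : MeasurableSpace Ω :=
  eventuallyMeasurableSpace (⨆ r : ℝ≥0, ⨆ _ : r ≤ t, MeasurableSpace.comap (B r) inferInstance)
    (ae P)

/-- A simple process `∑ i, ξ_i 1_{(a_i, b_i]}`, where each `ξ_i` is bounded and
`𝓕_{a_i}`-measurable. -/
structure SimpleItoProcess {Ω : Type*} [MeasurableSpace Ω] (B : ℝ≥0 → Ω → ℝ)
    (P : Measure Ω) where
  /-- number of terms -/
  card : ℕ
  /-- left endpoints -/
  a : Fin card → ℝ≥0
  /-- right endpoints -/
  b : Fin card → ℝ≥0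
  a_le_b : ∀ i, a i ≤ b i
  /-- coefficients -/
  ξ : Fin card → Ω → ℝ
  measurable_coeff : ∀ i, Measurable[brownianFiltration B P (a i)] (ξ i)
  bounded_coeff : ∀ i, ∃ C : ℝ, ∀ ω, |ξ i ω| ≤ C

/-- The value at time `t` of a simple process. -/
noncomputable def SimpleItoProcess.value {Ω : Type*} [MeasurableSpace Ω] {B : ℝ≥0 → Ω → ℝ}
    {P : Measure Ω} (V : SimpleItoProcess B P) (t : ℝ) (ω : Ω) : ℝ :=
  ∑ i, (Set.Ioc (V.a i : ℝ) (V.b i : ℝ)).indicator (fun _ => V.ξ i ω) t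

/-- The stochastic integral `∫_0^T V dB = ∑ i, ξ_i (B_{b_i ∧ T} - B_{a_i ∧ T})` of a simple
process. -/
noncomputable def SimpleItoProcess.integral {Ω : Type*} [MeasurableSpace Ω] {B : ℝ≥0 → Ω → ℝ}
    {P : Measure Ω} (V : SimpleItoProcess B P) (T : ℝ≥0) (ω : Ω) : ℝ :=
  ∑ i, V.ξ i ω * (B (min (V.b i) T) ω - B (min (V.a i) T) ω)

/-- `IsItoIntegral B P T X I` says that the random variable `I` is (a version of) the Itô integral
`∫_0^T X_t dB_t` of the square-integrable process `X`: there are simple processes which converge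
to `X` in `L²([0,T] × Ω)` and whose integrals converge to `I` in `L²(Ω)`. -/
def IsItoIntegral {Ω : Type*} [MeasurableSpace Ω] (B : ℝ≥0 → Ω → ℝ) (P : Measure Ω)
    (T : ℝ≥0) (X : ℝ → Ω → ℝ) (I : Ω → ℝ) : Prop :=
  MemLp (fun p : ℝ × Ω => X p.1 p.2) 2 ((volume.restrict (Set.Icc (0 : ℝ) T)).prod P) ∧
  MemLp I 2 P ∧
  ∃ V : ℕ → SimpleItoProcess B P,
    Tendsto (fun k => eLpNorm (fun p : ℝ × Ω => X p.1 p.2 - (V k).value p.1 p.2) 2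
      ((volume.restrict (Set.Icc (0 : ℝ) T)).prod P)) atTop (𝓝 0) ∧
    Tendsto (fun k => eLpNorm (fun ω => I ω - (V k).integral T ω) 2 P) atTop (𝓝 0)

/-- `IsIteratedItoIntegral B P v J` says that `J` is (a version of) the iterated Itô integral
`∫_0^1 (∫_0^t v_{s,t} dB_s) dB_t`: there is a process `Y`, measurable in time and chance and
square-integrable, such that `Y_t = ∫_0^t v_{s,t} dB_s` for almost every `t ∈ [0,1]` and
`J = ∫_0^1 Y_t dB_t`. -/
def IsIteratedItoIntegral {Ω : Type*} [MeasurableSpace Ω] (B : ℝ≥0 → Ω → ℝ) (P : Measure Ω)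
    (v : ℝ → ℝ → Ω → ℝ) (J : Ω → ℝ) : Prop :=
  ∃ Y : ℝ → Ω → ℝ,
    (∀ᵐ t ∂(volume.restrict (Set.Icc (0 : ℝ) 1)),
      IsItoIntegral B P t.toNNReal (fun s => v s t) (Y t)) ∧
    IsItoIntegral B P 1 Y J

/-- The triangle `0 ≤ s ≤ t ≤ 1`. -/
def timeTriangle : Set (ℝ × ℝ) := {q | 0 ≤ q.1 ∧ q.1 ≤ q.2 ∧ q.2 ≤ 1}

/-- There is a sequence `α_n ↑ 1` with
`lim ∫_{α_n}^1 φ_n² = lim ∫_0^1 φ_n² = L > 0`. -/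
def KernelConcentrates (φ : ℕ → ℝ → ℝ) (L : ℝ) : Prop :=
  0 < L ∧ ∃ α : ℕ → ℝ, Monotone α ∧ (∀ n, α n ∈ Set.Icc (0 : ℝ) 1) ∧
    Tendsto α atTop (𝓝 1) ∧
    Tendsto (fun n => ∫ t in (α n)..1, φ n t ^ 2) atTop (𝓝 L) ∧
    Tendsto (fun n => ∫ t in (0 : ℝ)..1, φ n t ^ 2) atTop (𝓝 L)

/-- For every `δ ∈ [0,1)`, `(sup_{[0,δ]} φ_n) (sup_{[0,1]} φ_n) → 0`. -/
def KernelSupProductVanishes (φ : ℕ → ℝ → ℝ) : Prop :=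
  ∀ δ ∈ Set.Ico (0 : ℝ) 1,
    Tendsto (fun n => (⨆ t : Set.Icc (0 : ℝ) δ, φ n t) * (⨆ t : Set.Icc (0 : ℝ) 1, φ n t))
      atTop (𝓝 0)

/-- Stable convergence, with respect to the σ-algebra `𝓕`, of real random variables `F_n` on
`(Ω, P)` to a real random variable `G` on an extension `π : (Ω', P') → (Ω, P)` of that space:
`E[Y exp(iλF_n)] → E'[Y exp(iλG)]` for every real `λ` and every bounded `𝓕`-measurable `Y`. -/
def ConvergesStably {Ω Ω' : Type*} [MeasurableSpace Ω] [MeasurableSpace Ω']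
    (P : Measure Ω) (P' : Measure Ω') (π : Ω' → Ω) (𝓕 : MeasurableSpace Ω)
    (F : ℕ → Ω → ℝ) (G : Ω' → ℝ) : Prop :=
  ∀ Y : Ω → ℝ, Measurable[𝓕] Y → (∃ C : ℝ, ∀ ω, |Y ω| ≤ C) → ∀ l : ℝ,
    Tendsto (fun n => ∫ ω, (Y ω : ℂ) * Complex.exp (Complex.I * ((l * F n ω : ℝ) : ℂ)) ∂P)
      atTop
      (𝓝 (∫ ω', (Y (π ω') : ℂ) * Complex.exp (Complex.I * ((l * G ω' : ℝ) : ℂ)) ∂P'))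

/-!
The iterated integrals exist because every square-integrable adapted kernel on the triangle is an
`L²` limit of elementary kernels `ξ 1_{(a,b]}(s) 1_{(c,d]}(t)` with `b ≤ c` and `ξ` depending on the
past of `a`: the iterated integral is an isometry on these, and it extends to the closure
(`exists_isIteratedItoIntegral_of_approx`). For the density, an indicator of a measurable box is
replaced on a fine grid by its conditional expectations given the past at the grid points; these
projections converge because `s ↦ ‖E[1_A | 𝓕_s]‖²` is monotone, so that its increments over the grid
telescope. A π-λ argument and density of simple functions give all of `L²`, and an adapted kernel
equals its own pointwise projection (`exists_isIteratedItoIntegral`).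

For the limit, the mass of the kernels concentrates at the corner `(1,1)`: where `s ≤ δ < 1` the
product `φ_n(s) φ_n(t)` tends to `0` uniformly, and elsewhere `u_{s,t}` is close in `L²` to `u_{1,1}`
and hence to a simple random variable `ξ` that depends only on the past of some `δ < 1`
(`exists_simpleFunc_near_corner`). Replace `φ_n` by step functions `∑ c_k 1_{cell k}` on finer and
finer uniform grids. The iterated integral of the elementary kernel with coefficient `ξ` is
`½ ξ (G_n² - ∑ c_k² Δ_k²)`, where `G_n = ∑ c_k Δ_k` is a Wiener integral, centred Gaussian with
variance tending to `L`; and `∑ c_k² Δ_k² → L` in `L²` because `∑ c_k⁴ / N² → 0`. So up to a small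
`L²` error `F_n` is `½ ξ (G_n² - L)`
(`IsIteratedItoIntegral.eLpNorm_sub_gridKernel_le`, `eLpNorm_quadratic_sub_le`).

The Gaussian variables `G_n` are mixing: up to a vanishing error `G_n` uses only increments after `δ`,
hence it is asymptotically independent of the past of every `δ < 1`, and by martingale convergence
and path continuity at time `1` of every bounded random variable
(`tendsto_integral_mul_comp_gridSum`). Splitting along the values of `ξ` gives the stable limit
`½ ξ (L Z² - L)`, and letting `ξ` approach `u_{1,1}` gives the theorem. Everything is tested against
the bounded Lipschitz functions `cos (λ ·)` and `sin (λ ·)`.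
-/

set_option linter.unusedSectionVars false

/-! ### The filtration of Brownian motion and its independent increments -/

/-- The σ-algebra generated by `B_r`, `r ≤ t`, without completion. -/
@[reducible]
def natSigma {Ω : Type*} (B : ℝ≥0 → Ω → ℝ) (t : ℝ≥0) : MeasurableSpace Ω :=
  ⨆ r : ℝ≥0, ⨆ _ : r ≤ t, MeasurableSpace.comap (B r) inferInstance

/-- The σ-algebra generated by the increments `B_{c+r} - B_c`, `r ≥ 0`. -/
@[reducible]
def shiftSigma {Ω : Type*} (B : ℝ≥0 → Ω → ℝ) (c : ℝ≥0) : MeasurableSpace Ω :=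
  ⨆ r : ℝ≥0, MeasurableSpace.comap (fun ω => B (c + r) ω - B c ω) inferInstance

/-- A real function measurable for the completion of `m` agrees almost everywhere with an
`m`-measurable one. -/
lemma exists_measurable_ae_eq_of_eventuallyMeasurable {Ω : Type*} {m mΩ : MeasurableSpace Ω}
    {P : Measure Ω} {f : Ω → ℝ}
    (hf : Measurable[eventuallyMeasurableSpace m (ae P)] f) :
    ∃ g : Ω → ℝ, Measurable[m] g ∧ f =ᵐ[P] g := by
  have h (q : ℚ) : ∃ t, MeasurableSet[m] t ∧ f ⁻¹' Set.Iio (q : ℝ) =ᵐ[P] t :=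
    hf measurableSet_Iio
  choose t ht hft using h
  classical
  refine ⟨fun ω => (⨅ q : ℚ, if ω ∈ t q then ((q : ℝ) : EReal) else ⊤).toReal, ?_, ?_⟩
  · refine measurable_ereal_toReal.comp ?_
    refine Measurable.iInf fun q => ?_
    exact Measurable.ite (ht q) measurable_const measurable_const
  · have : ∀ᵐ ω ∂P, ∀ q : ℚ, (f ω < q ↔ ω ∈ t q) := by
      rw [ae_all_iff]
      intro q
      filter_upwards [hft q] with ω hω
      exact iff_of_eq hω
    filter_upwards [this] with ω hω
    have : (⨅ q : ℚ, if ω ∈ t q then ((q : ℝ) : EReal) else ⊤) = (f ω : EReal) := by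
      apply le_antisymm
      · apply le_of_forall_gt_imp_ge_of_dense
        intro a ha
        obtain ⟨q, hq1, hq2⟩ := EReal.lt_iff_exists_rat_btwn.1 ha
        refine (iInf_le _ q).trans ?_
        rw [if_pos]
        · exact hq2.le
        · rw [← hω]
          exact_mod_cast hq1
      · refine le_iInf fun q => ?_
        split_ifs with h
        · rw [← hω] at h
          exact_mod_cast h.le
        · exact le_top
    rw [this, EReal.toReal_coe]

section Basics

variable {Ω : Type*} [mΩ : MeasurableSpace Ω] {P : Measure Ω} {B : ℝ≥0 → Ω → ℝ}

lemma natSigma_le (hB_meas : ∀ t, Measurable (B t)) (t : ℝ≥0) : natSigma B t ≤ mΩ :=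
  iSup₂_le fun r _ => (hB_meas r).comap_le

lemma natSigma_mono {s t : ℝ≥0} (h : s ≤ t) : natSigma B s ≤ natSigma B t :=
  iSup_mono fun _ => iSup_mono' fun hr => ⟨hr.trans h, le_rfl⟩

lemma measurable_natSigma {r t : ℝ≥0} (h : r ≤ t) : Measurable[natSigma B t] (B r) :=
  measurable_iff_comap_le.2 (le_iSup₂_of_le r h le_rfl)

lemma shiftSigma_le (hB_meas : ∀ t, Measurable (B t)) (c : ℝ≥0) : shiftSigma B c ≤ mΩ :=
  iSup_le fun _ => ((hB_meas _).sub (hB_meas _)).comap_le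

lemma measurable_shiftSigma {c b d : ℝ≥0} (hb : c ≤ b) (hd : c ≤ d) :
    Measurable[shiftSigma B c] (fun ω => B d ω - B b ω) := by
  have h (r : ℝ≥0) (hr : c ≤ r) : Measurable[shiftSigma B c] (fun ω => B r ω - B c ω) := by
    have : Measurable[shiftSigma B c] (fun ω => B (c + (r - c)) ω - B c ω) :=
      measurable_iff_comap_le.2 (le_iSup_of_le (r - c) le_rfl)
    rwa [add_tsub_cancel_of_le hr] at this
  have := (h d hd).sub (h b hb)
  convert this using 2
  simp

lemma indep_natSigma_shiftSigma (hB : IsPreBrownianReal B P) (c : ℝ≥0) :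
    Indep (natSigma B c) (shiftSigma B c) P := by
  have h := (hB.indepFun_shift c).symm
  rw [IndepFun_iff_Indep] at h
  refine indep_of_indep_of_le_left (indep_of_indep_of_le_right h ?_) ?_
  · refine iSup_le fun r => ?_
    rw [← measurable_iff_comap_le]
    exact (measurable_pi_apply (X := fun _ : ℝ≥0 => ℝ) r).comp
      (comap_measurable (fun ω t => B (c + t) ω - B c ω))
  · refine iSup₂_le fun r hr => ?_
    rw [← measurable_iff_comap_le]
    exact (measurable_pi_apply (X := fun _ : Set.Iic c => ℝ) ⟨r, hr⟩).comp
      (comap_measurable (fun ω (t : Set.Iic c) => B t ω))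

lemma integral_mul_eq_of_natSigma_of_shiftSigma (hB_meas : ∀ t, Measurable (B t))
    (hB : IsPreBrownianReal B P)
    {c : ℝ≥0} {ξ W : Ω → ℝ} (hξ : AEStronglyMeasurable[natSigma B c] ξ P)
    (hW : Measurable[shiftSigma B c] W) :
    ∫ ω, ξ ω * W ω ∂P = (∫ ω, ξ ω ∂P) * ∫ ω, W ω ∂P := by
  obtain ⟨ξ', hξ', hξξ'⟩ := hξ
  have hind : IndepFun ξ' W P := by
    rw [IndepFun_iff_Indep]
    exact indep_of_indep_of_le_left (indep_of_indep_of_le_right (indep_natSigma_shiftSigma hB c)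
      hW.comap_le) hξ'.measurable.comap_le
  rw [integral_congr_ae hξξ', integral_congr_ae (g := fun ω => ξ' ω * W ω)]
  · exact hind.integral_fun_mul_eq_mul_integral
      (hξ'.measurable.mono (natSigma_le hB_meas c) le_rfl).aestronglyMeasurable
      (hW.mono (shiftSigma_le hB_meas c) le_rfl).aestronglyMeasurable
  · filter_upwards [hξξ'] with ω h
    rw [h]

lemma aestronglyMeasurable_of_brownianFiltration {ξ : Ω → ℝ} {t : ℝ≥0}
    (h : Measurable[brownianFiltration B P t] ξ) : AEStronglyMeasurable[natSigma B t] ξ P := by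
  obtain ⟨g, hg, hfg⟩ := exists_measurable_ae_eq_of_eventuallyMeasurable h
  exact ⟨g, hg.stronglyMeasurable, hfg⟩

lemma memLp_increment (hB : IsPreBrownianReal B P) (b d : ℝ≥0) {p : ℝ≥0∞} (hp : p ≠ ∞) :
    MemLp (fun ω => B d ω - B b ω) p P :=
  hB.isGaussianProcess.hasGaussianLaw_sub.memLp hp

lemma integral_increment (hB : IsPreBrownianReal B P) (b d : ℝ≥0) :
    ∫ ω, (B d ω - B b ω) ∂P = 0 := by
  rw [integral_sub (hB.integrable_eval d) (hB.integrable_eval b)]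
  simp [hB.integral_eval]

lemma integral_mul_eval [IsProbabilityMeasure P] (hB : IsPreBrownianReal B P) (s t : ℝ≥0) :
    ∫ ω, B s ω * B t ω ∂P = min s t := by
  have h := hB.covariance_eval s t
  have m (t) : MemLp (B t) 2 P := (hB.isGaussianProcess.hasGaussianLaw_eval t).memLp_two
  rw [covariance_eq_sub (m s) (m t)] at h
  simpa [hB.integral_eval] using h

lemma integral_increment_mul [IsProbabilityMeasure P] (hB : IsPreBrownianReal B P)
    {c b d : ℝ≥0} (hb : c ≤ b) (hd : c ≤ d) :
    ∫ ω, (B b ω - B c ω) * (B d ω - B c ω) ∂P = min (b : ℝ) d - c := by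
  have m (t) : MemLp (B t) 2 P := (hB.isGaussianProcess.hasGaussianLaw_eval t).memLp_two
  have i (s t) : Integrable (fun ω => B s ω * B t ω) P := (m s).integrable_mul (m t)
  have : ∀ ω, (B b ω - B c ω) * (B d ω - B c ω) =
      B b ω * B d ω - B b ω * B c ω - B c ω * B d ω + B c ω * B c ω := fun ω => by ring
  simp_rw [this]
  have i1 : Integrable (fun ω => B b ω * B d ω - B b ω * B c ω) P := (i _ _).sub (i _ _)
  have i2 : Integrable (fun ω => B b ω * B d ω - B b ω * B c ω - B c ω * B d ω) P :=
    i1.sub (i _ _)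
  rw [integral_add i2 (i _ _), integral_sub i1 (i _ _), integral_sub (i _ _) (i _ _)]
  simp only [integral_mul_eval hB, NNReal.coe_min]
  have h1 : (c : ℝ) ≤ b := hb
  have h2 : (c : ℝ) ≤ d := hd
  simp [h1, h2]

end Basics

/-! ### The isometry for simple processes -/

lemma eLpNorm_two_sq {α : Type*} {m : MeasurableSpace α} (μ : Measure α) (f : α → ℝ) :
    eLpNorm f 2 μ ^ 2 = ∫⁻ x, ‖f x‖ₑ ^ 2 ∂μ := by
  have := eLpNorm_nnreal_pow_eq_lintegral (μ := μ) (f := f) (p := 2) (by norm_num)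
  simpa using this

lemma eLpNorm_two_sq_eq_ofReal {α : Type*} {m : MeasurableSpace α} {μ : Measure α} {f : α → ℝ}
    (hf : MemLp f 2 μ) : eLpNorm f 2 μ ^ 2 = ENNReal.ofReal (∫ x, f x ^ 2 ∂μ) := by
  rw [eLpNorm_two_sq, ofReal_integral_eq_lintegral_ofReal hf.integrable_sq
    (ae_of_all _ fun x => sq_nonneg _)]
  refine lintegral_congr fun x => ?_
  rw [← enorm_pow, Real.enorm_of_nonneg (sq_nonneg _)]

section Terms

variable {Ω : Type*} [mΩ : MeasurableSpace Ω] {P : Measure Ω} [IsProbabilityMeasure P]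
  {B : ℝ≥0 → Ω → ℝ}

lemma integral_term_mul_term_of_le (hB_meas : ∀ t, Measurable (B t)) (hB : IsPreBrownianReal B P)
    {a b c d : ℝ≥0} (hcd : c ≤ d) (hac : a ≤ c) {ξ η : Ω → ℝ}
    (hξ : AEStronglyMeasurable[natSigma B a] ξ P) (hη : AEStronglyMeasurable[natSigma B c] η P)
    (hξb : ∃ C : ℝ, ∀ ω, |ξ ω| ≤ C) (hηb : ∃ C : ℝ, ∀ ω, |η ω| ≤ C) :
    ∫ ω, (ξ ω * (B b ω - B a ω)) * (η ω * (B d ω - B c ω)) ∂P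
      = (∫ ω, ξ ω * η ω ∂P) * max (min (b : ℝ) d - c) 0 := by
  have hξ' : AEStronglyMeasurable[natSigma B c] ξ P := hξ.mono (natSigma_mono hac)
  have hξη : AEStronglyMeasurable[natSigma B c] (fun ω => ξ ω * η ω) P := hξ'.mul hη
  have hm (r : ℝ≥0) (hr : r ≤ c) : AEStronglyMeasurable[natSigma B c] (B r) P :=
    ((measurable_natSigma hr).stronglyMeasurable).aestronglyMeasurable
  obtain ⟨C, hC⟩ := hξb
  obtain ⟨D, hD⟩ := hηb
  have hbd : ∀ᵐ ω ∂P, ‖ξ ω * η ω‖ ≤ C * D := ae_of_all _ fun ω => by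
    rw [norm_mul]
    exact mul_le_mul (hC ω) (hD ω) (norm_nonneg _) ((abs_nonneg _).trans (hC ω))
  have key (x : ℝ≥0) (hx : x ≤ c) :
      ∫ ω, (ξ ω * η ω * (B x ω - B a ω)) * (B d ω - B c ω) ∂P = 0 := by
    rw [integral_mul_eq_of_natSigma_of_shiftSigma hB_meas hB
      (ξ := fun ω => ξ ω * η ω * (B x ω - B a ω)) (hξη.mul ((hm x hx).sub (hm a hac))) (measurable_shiftSigma le_rfl hcd),
      integral_increment hB, mul_zero]
  rcases le_total b c with hbc | hcb
  · have : max (min (b : ℝ) d - c) 0 = 0 := by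
      apply max_eq_right
      have : (b : ℝ) ≤ c := hbc
      linarith [min_le_left (b : ℝ) d]
    rw [this, mul_zero, ← key b hbc]
    exact integral_congr_ae (ae_of_all _ fun ω => by ring)
  · have h0 : max (min (b : ℝ) d - c) 0 = min (b : ℝ) d - c := by
      apply max_eq_left
      have h1 : (c : ℝ) ≤ b := hcb
      have h2 : (c : ℝ) ≤ d := hcd
      linarith [le_min h1 h2]
    have e : ∀ ω, (ξ ω * (B b ω - B a ω)) * (η ω * (B d ω - B c ω)) =
        (ξ ω * η ω * (B c ω - B a ω)) * (B d ω - B c ω) +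
        (ξ ω * η ω) * ((B b ω - B c ω) * (B d ω - B c ω)) := fun ω => by ring
    have i0 (x y z w : ℝ≥0) : Integrable
        (fun ω => (ξ ω * η ω) * ((B x ω - B y ω) * (B z ω - B w ω))) P :=
      ((memLp_increment hB y x (p := 2) (by simp)).integrable_mul
        (memLp_increment hB w z (p := 2) (by simp))).bdd_mul
        (hξη.mono (natSigma_le hB_meas c)) hbd
    have i1 : Integrable (fun ω => (ξ ω * η ω * (B c ω - B a ω)) * (B d ω - B c ω)) P := by
      refine (i0 c a d c).congr (ae_of_all _ fun ω => ?_)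
      simp only
      ring
    simp_rw [e]
    rw [integral_add i1 (i0 _ _ _ _), key c le_rfl,
      integral_mul_eq_of_natSigma_of_shiftSigma hB_meas hB hξη
        (W := fun ω => (B b ω - B c ω) * (B d ω - B c ω))
        ((measurable_shiftSigma le_rfl hcb).mul (measurable_shiftSigma le_rfl hcd)),
      integral_increment_mul hB hcb hcd, h0, zero_add]

lemma integral_term_mul_term (hB_meas : ∀ t, Measurable (B t)) (hB : IsPreBrownianReal B P)
    {a b c d : ℝ≥0} (hab : a ≤ b) (hcd : c ≤ d) {ξ η : Ω → ℝ}
    (hξ : AEStronglyMeasurable[natSigma B a] ξ P) (hη : AEStronglyMeasurable[natSigma B c] η P)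
    (hξb : ∃ C : ℝ, ∀ ω, |ξ ω| ≤ C) (hηb : ∃ C : ℝ, ∀ ω, |η ω| ≤ C) :
    ∫ ω, (ξ ω * (B b ω - B a ω)) * (η ω * (B d ω - B c ω)) ∂P
      = (∫ ω, ξ ω * η ω ∂P) * max (min (b : ℝ) d - max (a : ℝ) c) 0 := by
  rcases le_total a c with h | h
  · rw [integral_term_mul_term_of_le hB_meas hB hcd h hξ hη hξb hηb, max_eq_right (a := (a : ℝ))]
    exact h
  · have := integral_term_mul_term_of_le (b := d) hB_meas hB hab h hη hξ hηb hξb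
    rw [max_eq_left (a := (a : ℝ)) (by exact h), min_comm]
    simp_rw [mul_comm (ξ _) (η _)]
    rw [← this]
    exact integral_congr_ae (ae_of_all _ fun ω => by ring)

/-- The same with increments stopped at `T`, on which side the overlap of the two intervals
is computed inside `[0, T]`. -/
lemma integral_stopped_term_mul_term (hB_meas : ∀ t, Measurable (B t))
    (hB : IsPreBrownianReal B P) (T : ℝ≥0)
    {a b c d : ℝ≥0} (hab : a ≤ b) (hcd : c ≤ d) {ξ η : Ω → ℝ}
    (hξ : AEStronglyMeasurable[natSigma B a] ξ P) (hη : AEStronglyMeasurable[natSigma B c] η P)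
    (hξb : ∃ C : ℝ, ∀ ω, |ξ ω| ≤ C) (hηb : ∃ C : ℝ, ∀ ω, |η ω| ≤ C) :
    ∫ ω, (ξ ω * (B (min b T) ω - B (min a T) ω)) * (η ω * (B (min d T) ω - B (min c T) ω)) ∂P
      = (∫ ω, ξ ω * η ω ∂P) * max (min (min (b : ℝ) d) T - max (a : ℝ) c) 0 := by
  have hz (x : ℝ≥0) (hx : T < x) (hx' : x ≤ a ∨ x ≤ c) :
      max (min (min (b : ℝ) d) T - max (a : ℝ) c) 0 = 0 := by
    apply max_eq_right
    have h1 : (T : ℝ) < x := hx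
    have h2 : (x : ℝ) ≤ max (a : ℝ) c := by
      rcases hx' with h | h
      · exact le_max_of_le_left h
      · exact le_max_of_le_right h
    linarith [min_le_right (min (b : ℝ) d) T]
  rcases lt_or_ge T a with ha | ha
  · rw [hz a ha (Or.inl le_rfl), min_eq_right ha.le, min_eq_right (ha.le.trans hab)]
    simp
  rcases lt_or_ge T c with hc | hc
  · rw [hz c hc (Or.inr le_rfl), min_eq_right hc.le, min_eq_right (hc.le.trans hcd)]
    simp
  rw [min_eq_left ha, min_eq_left hc, integral_term_mul_term hB_meas hB (le_min hab ha)
    (le_min hcd hc) hξ hη hξb hηb]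
  congr 3
  simp only [NNReal.coe_min]
  rw [min_min_min_comm, min_self]

lemma integral_indicator_mul_indicator (T a b c d : ℝ≥0) :
    ∫ t in Set.Icc (0 : ℝ) T, (Set.Ioc (a : ℝ) b).indicator (fun _ => (1 : ℝ)) t *
      (Set.Ioc (c : ℝ) d).indicator (fun _ => (1 : ℝ)) t
      = max (min (min (b : ℝ) d) T - max (a : ℝ) c) 0 := by
  have : ∀ t, (Set.Ioc (a : ℝ) b).indicator (fun _ => (1 : ℝ)) t *
      (Set.Ioc (c : ℝ) d).indicator (fun _ => (1 : ℝ)) t =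
      (Set.Ioc (a : ℝ) b ∩ Set.Ioc (c : ℝ) d).indicator (fun _ => (1 : ℝ)) t := by
    intro t
    by_cases h1 : t ∈ Set.Ioc (a : ℝ) b <;> by_cases h2 : t ∈ Set.Ioc (c : ℝ) d <;>
      simp only [Set.indicator, Set.mem_inter_iff, h1, h2, if_true, if_false, and_true, and_false,
        mul_one, mul_zero]
  simp_rw [this]
  rw [integral_indicator_const _ (measurableSet_Ioc.inter measurableSet_Ioc), smul_eq_mul, mul_one,
    measureReal_restrict_apply (measurableSet_Ioc.inter measurableSet_Ioc)]
  have : Set.Ioc (a : ℝ) b ∩ Set.Ioc (c : ℝ) d ∩ Set.Icc (0 : ℝ) T =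
      Set.Ioc (max (a : ℝ) c) (min (min (b : ℝ) d) T) := by
    ext t
    have h0 : (0 : ℝ) ≤ a := a.2
    simp only [Set.mem_inter_iff, Set.mem_Ioc, Set.mem_Icc, max_lt_iff, le_min_iff]
    constructor
    · rintro ⟨⟨h1, h2⟩, h3⟩
      exact ⟨⟨h1.1, h2.1⟩, ⟨h1.2, h2.2⟩, h3.2⟩
    · rintro ⟨h1, h2, h3⟩
      exact ⟨⟨⟨h1.1, h2.1⟩, h1.2, h2.2⟩, by linarith [h1.1], h3⟩
  rw [this, measureReal_def, Real.volume_Ioc, ENNReal.toReal_ofReal']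

end Terms

namespace SimpleItoProcess

variable {Ω : Type*} [mΩ : MeasurableSpace Ω] {P : Measure Ω} {B : ℝ≥0 → Ω → ℝ}

/-- The sum of two simple processes: the terms of both. -/
noncomputable def add (V W : SimpleItoProcess B P) : SimpleItoProcess B P where
  card := V.card + W.card
  a := Fin.addCases V.a W.a
  b := Fin.addCases V.b W.b
  a_le_b i := by
    refine Fin.addCases (fun i => ?_) (fun i => ?_) i
    · simpa using V.a_le_b i
    · simpa using W.a_le_b i
  ξ := Fin.addCases V.ξ W.ξ
  measurable_coeff i := by
    refine Fin.addCases (fun i => ?_) (fun i => ?_) i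
    · rw [Fin.addCases_left, Fin.addCases_left]
      exact V.measurable_coeff i
    · rw [Fin.addCases_right, Fin.addCases_right]
      exact W.measurable_coeff i
  bounded_coeff i := by
    refine Fin.addCases (fun i => ?_) (fun i => ?_) i
    · simpa using V.bounded_coeff i
    · simpa using W.bounded_coeff i

lemma add_value (V W : SimpleItoProcess B P) (t : ℝ) (ω : Ω) :
    (V.add W).value t ω = V.value t ω + W.value t ω := by
  refine (Fin.sum_univ_add _).trans ?_
  simp [value, add]

lemma add_integral (V W : SimpleItoProcess B P) (T : ℝ≥0) (ω : Ω) :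
    (V.add W).integral T ω = V.integral T ω + W.integral T ω := by
  refine (Fin.sum_univ_add _).trans ?_
  simp [integral, add]

/-- A multiple of a simple process. -/
noncomputable def smul (c : ℝ) (V : SimpleItoProcess B P) : SimpleItoProcess B P where
  card := V.card
  a := V.a
  b := V.b
  a_le_b := V.a_le_b
  ξ i ω := c * V.ξ i ω
  measurable_coeff i := (V.measurable_coeff i).const_mul c
  bounded_coeff i := by
    obtain ⟨C, hC⟩ := V.bounded_coeff i
    refine ⟨|c| * C, fun ω => ?_⟩
    rw [abs_mul]
    exact mul_le_mul_of_nonneg_left (hC ω) (abs_nonneg _)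

lemma smul_value (c : ℝ) (V : SimpleItoProcess B P) (t : ℝ) (ω : Ω) :
    (V.smul c).value t ω = c * V.value t ω := by
  simp only [value, smul, Finset.mul_sum]
  refine Finset.sum_congr rfl fun i _ => ?_
  by_cases h : t ∈ Set.Ioc (V.a i : ℝ) (V.b i) <;> simp [h]

lemma smul_integral (c : ℝ) (V : SimpleItoProcess B P) (T : ℝ≥0) (ω : Ω) :
    (V.smul c).integral T ω = c * V.integral T ω := by
  simp only [integral, smul, Finset.mul_sum]
  refine Finset.sum_congr rfl fun i _ => ?_
  ring

variable [IsProbabilityMeasure P]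

lemma aestronglyMeasurable_coeff (V : SimpleItoProcess B P) (i : Fin V.card) :
    AEStronglyMeasurable[natSigma B (V.a i)] (V.ξ i) P :=
  aestronglyMeasurable_of_brownianFiltration (V.measurable_coeff i)

lemma value_eq (V : SimpleItoProcess B P) (t : ℝ) (ω : Ω) :
    V.value t ω = ∑ i, (Set.Ioc (V.a i : ℝ) (V.b i)).indicator (fun _ => (1 : ℝ)) t * V.ξ i ω := by
  refine Finset.sum_congr rfl fun i _ => ?_
  by_cases h : t ∈ Set.Ioc (V.a i : ℝ) (V.b i) <;> simp [h]

lemma memLp_value_term (hB_meas : ∀ t, Measurable (B t)) (V : SimpleItoProcess B P)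
    (μ : Measure ℝ) [IsFiniteMeasure μ] (i : Fin V.card) {p : ℝ≥0∞} :
    MemLp (fun q : ℝ × Ω =>
      (Set.Ioc (V.a i : ℝ) (V.b i)).indicator (fun _ => (1 : ℝ)) q.1 * V.ξ i q.2) p
      (μ.prod P) := by
  obtain ⟨C, hC⟩ := V.bounded_coeff i
  refine MemLp.of_bound (C := C) ?_ (ae_of_all _ fun q => ?_)
  · refine AEStronglyMeasurable.mul ?_ ?_
    · exact ((measurable_const.indicator measurableSet_Ioc).comp measurable_fst).aestronglyMeasurable
    · exact ((V.aestronglyMeasurable_coeff i).mono (natSigma_le hB_meas _)).comp_snd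
  · rw [norm_mul]
    refine (mul_le_of_le_one_left (norm_nonneg _) ?_).trans (hC q.2)
    by_cases h : q.1 ∈ Set.Ioc (V.a i : ℝ) (V.b i) <;> simp [h]

lemma memLp_value (hB_meas : ∀ t, Measurable (B t)) (V : SimpleItoProcess B P)
    (μ : Measure ℝ) [IsFiniteMeasure μ] {p : ℝ≥0∞} :
    MemLp (fun q : ℝ × Ω => V.value q.1 q.2) p (μ.prod P) := by
  simp_rw [value_eq]
  exact memLp_finsetSum _ fun i _ => V.memLp_value_term hB_meas μ i

lemma memLp_integral_term (hB_meas : ∀ t, Measurable (B t)) (hB : IsPreBrownianReal B P)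
    (V : SimpleItoProcess B P) (T : ℝ≥0) (i : Fin V.card) :
    MemLp (fun ω => V.ξ i ω * (B (min (V.b i) T) ω - B (min (V.a i) T) ω)) 2 P := by
  obtain ⟨C, hC⟩ := V.bounded_coeff i
  refine MemLp.of_le_mul (c := C) (memLp_increment hB (min (V.a i) T) (min (V.b i) T) (by simp))
    ?_ (ae_of_all _ fun ω => ?_)
  · refine ((V.aestronglyMeasurable_coeff i).mono (natSigma_le hB_meas _)).mul ?_
    exact ((hB_meas _).sub (hB_meas _)).aestronglyMeasurable
  · rw [norm_mul]
    exact mul_le_mul_of_nonneg_right (hC ω) (norm_nonneg _)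

lemma memLp_integral (hB_meas : ∀ t, Measurable (B t)) (hB : IsPreBrownianReal B P)
    (V : SimpleItoProcess B P) (T : ℝ≥0) : MemLp (V.integral T) 2 P :=
  memLp_finsetSum _ fun i _ => V.memLp_integral_term hB_meas hB T i

/-- The Itô isometry for simple processes. -/
lemma eLpNorm_integral (hB_meas : ∀ t, Measurable (B t)) (hB : IsPreBrownianReal B P)
    (V : SimpleItoProcess B P) (T : ℝ≥0) :
    eLpNorm (V.integral T) 2 P = eLpNorm (fun q : ℝ × Ω => V.value q.1 q.2) 2
      ((volume.restrict (Set.Icc (0 : ℝ) T)).prod P) := by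
  have hsq : eLpNorm (V.integral T) 2 P ^ 2 = eLpNorm (fun q : ℝ × Ω => V.value q.1 q.2) 2
      ((volume.restrict (Set.Icc (0 : ℝ) T)).prod P) ^ 2 := by
    rw [eLpNorm_two_sq_eq_ofReal (V.memLp_integral hB_meas hB T),
      eLpNorm_two_sq_eq_ofReal (V.memLp_value hB_meas _)]
    congr 1
    simp_rw [value_eq, integral, sq, Finset.sum_mul_sum]
    have hI (i j : Fin V.card) : Integrable (fun ω =>
        (V.ξ i ω * (B (min (V.b i) T) ω - B (min (V.a i) T) ω)) *
        (V.ξ j ω * (B (min (V.b j) T) ω - B (min (V.a j) T) ω))) P :=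
      (V.memLp_integral_term hB_meas hB T i).integrable_mul (V.memLp_integral_term hB_meas hB T j)
    have hJ (i j : Fin V.card) : Integrable (fun q : ℝ × Ω =>
        ((Set.Ioc (V.a i : ℝ) (V.b i)).indicator (fun _ => (1 : ℝ)) q.1 * V.ξ i q.2) *
        ((Set.Ioc (V.a j : ℝ) (V.b j)).indicator (fun _ => (1 : ℝ)) q.1 * V.ξ j q.2))
        ((volume.restrict (Set.Icc (0 : ℝ) T)).prod P) :=
      (V.memLp_value_term (p := 2) hB_meas _ i).integrable_mul
        (V.memLp_value_term (p := 2) hB_meas _ j)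
    rw [integral_finsetSum _ fun i _ => integrable_finsetSum _ fun j _ => hI i j,
      integral_finsetSum _ fun i _ => integrable_finsetSum _ fun j _ => hJ i j]
    refine Finset.sum_congr rfl fun i _ => ?_
    rw [integral_finsetSum _ fun j _ => hI i j, integral_finsetSum _ fun j _ => hJ i j]
    refine Finset.sum_congr rfl fun j _ => ?_
    rw [integral_stopped_term_mul_term hB_meas hB T (V.a_le_b i) (V.a_le_b j)
      (V.aestronglyMeasurable_coeff i) (V.aestronglyMeasurable_coeff j)
      (V.bounded_coeff i) (V.bounded_coeff j), ← integral_indicator_mul_indicator, mul_comm,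
      ← integral_prod_mul]
    refine integral_congr_ae (ae_of_all _ fun q => ?_)
    simp only
    ring
  exact (ENNReal.pow_right_strictMono two_ne_zero).injective hsq

end SimpleItoProcess

/-! ### Linearity and closure of the Itô integral -/

section LpTools

variable {α : Type*} {m : MeasurableSpace α} {μ : Measure α}

lemma eLpNorm_fun_sub_comm (f g : α → ℝ) (p : ℝ≥0∞) :
    eLpNorm (fun x => f x - g x) p μ = eLpNorm (fun x => g x - f x) p μ :=
  eLpNorm_sub_comm f g p μ

/-- The triangle inequality in `L²`, through an intermediate function. -/
lemma eLpNorm_sub_le_add {f g h : α → ℝ} (hf : AEStronglyMeasurable f μ)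
    (hg : AEStronglyMeasurable g μ) (hh : AEStronglyMeasurable h μ) :
    eLpNorm (fun x => f x - h x) 2 μ ≤
      eLpNorm (fun x => f x - g x) 2 μ + eLpNorm (fun x => g x - h x) 2 μ := by
  have := eLpNorm_add_le (hf.sub hg) (hg.sub hh) (p := 2) (by norm_num)
  rw [sub_add_sub_cancel] at this
  exact this

lemma eLpNorm_two_sq_prod {β : Type*} {mβ : MeasurableSpace β} {ν : Measure β} [SFinite ν]
    {f : α × β → ℝ} (hf : AEStronglyMeasurable f (μ.prod ν)) :
    eLpNorm f 2 (μ.prod ν) ^ 2 = ∫⁻ a, eLpNorm (fun b => f (a, b)) 2 ν ^ 2 ∂μ := by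
  simp_rw [eLpNorm_two_sq]
  exact lintegral_prod _ (hf.enorm.pow_const 2)

lemma tendsto_eLpNorm_of_tendsto_eLpNorm_sub {f : α → ℝ} {g : ℕ → α → ℝ}
    (hf : AEStronglyMeasurable f μ) (hg : ∀ k, AEStronglyMeasurable (g k) μ)
    (h : Tendsto (fun k => eLpNorm (fun x => f x - g k x) 2 μ) atTop (𝓝 0)) :
    Tendsto (fun k => eLpNorm (g k) 2 μ) atTop (𝓝 (eLpNorm f 2 μ)) := by
  have hlow : Tendsto (fun k => eLpNorm f 2 μ - eLpNorm (fun x => f x - g k x) 2 μ) atTop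
      (𝓝 (eLpNorm f 2 μ)) := by
    have := ENNReal.Tendsto.sub (tendsto_const_nhds (x := eLpNorm f 2 μ)) h (by simp)
    simpa using this
  have hup : Tendsto (fun k => eLpNorm f 2 μ + eLpNorm (fun x => f x - g k x) 2 μ) atTop
      (𝓝 (eLpNorm f 2 μ)) := by
    simpa using tendsto_const_nhds (x := eLpNorm f 2 μ).add h
  refine tendsto_of_tendsto_of_tendsto_of_le_of_le hlow hup (fun k => ?_) (fun k => ?_)
  · simp only [tsub_le_iff_right]
    have := eLpNorm_add_le (hg k) (hf.sub (hg k)) (p := 2) (by norm_num)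
    rw [add_sub_cancel] at this
    exact this
  · have := eLpNorm_sub_le hf (hf.sub (hg k)) (p := 2) (by norm_num)
    rw [sub_sub_cancel] at this
    exact this

lemma exists_memLp_tendsto_of_cauchy {f : ℕ → α → ℝ} (hf : ∀ k, MemLp (f k) 2 μ)
    (h : ∀ k l, eLpNorm (fun x => f k x - f l x) 2 μ ≤ 2⁻¹ ^ k + 2⁻¹ ^ l) :
    ∃ g : α → ℝ, MemLp g 2 μ ∧
      Tendsto (fun k => eLpNorm (fun x => g x - f k x) 2 μ) atTop (𝓝 0) := by
  have hhalf : ∑' i : ℕ, (4 : ℝ≥0∞) * 2⁻¹ ^ i ≠ ∞ := by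
    rw [ENNReal.tsum_mul_left, ENNReal.tsum_geometric]
    have : (1 - 2⁻¹ : ℝ≥0∞) = 2⁻¹ := ENNReal.one_sub_inv_two
    rw [this]
    simp
    exact ENNReal.mul_ne_top (by simp) (by simp)
  obtain ⟨g, hg, hlim⟩ := Lp.cauchy_complete_eLpNorm (p := 2) (by norm_num) hf hhalf
    (fun N n l hn hl => by
      refine (h n l).trans_lt ?_
      have h1 : (2⁻¹ : ℝ≥0∞) ^ n ≤ 2⁻¹ ^ N := pow_le_pow_right_of_le_one' (by simp) hn
      have h2 : (2⁻¹ : ℝ≥0∞) ^ l ≤ 2⁻¹ ^ N := pow_le_pow_right_of_le_one' (by simp) hl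
      refine (add_le_add h1 h2).trans_lt ?_
      rw [← two_mul]
      refine ENNReal.mul_lt_mul_left (by simp) (by simp) ?_
      norm_num)
  refine ⟨g, hg, hlim.congr fun k => ?_⟩
  exact eLpNorm_sub_comm _ _ _ _

/-- An `m`-measurable square-integrable function is a limit of `m`-measurable simple functions. -/
lemma exists_simpleFunc_eLpNorm_sub_le {α : Type*} {m m₀ : MeasurableSpace α} (μ : Measure[m₀] α)
    (hm : m ≤ m₀) {η : α → ℝ} (hη : AEStronglyMeasurable[m] η μ)
    (h2 : MemLp η 2 μ) {ε : ℝ≥0∞} (hε : ε ≠ 0) :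
    ∃ g : @SimpleFunc α m ℝ, eLpNorm (fun x => η x - g x) 2 μ ≤ ε := by
  obtain ⟨η', hη', hηη'⟩ := hη
  have h' : MemLp η' 2 (μ.trim hm) := by
    refine ⟨hη'.aestronglyMeasurable, ?_⟩
    rw [eLpNorm_trim hm hη', ← eLpNorm_congr_ae hηη']
    exact h2.2
  obtain ⟨g, hg, -⟩ := @MemLp.exists_simpleFunc_eLpNorm_sub_lt α m _ _ _ _ _ h' (by simp) _ hε
  refine ⟨g, ?_⟩
  have h3 : StronglyMeasurable[m] (η' - ⇑g) := hη'.sub (@SimpleFunc.stronglyMeasurable _ _ m _ g)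
  rw [eLpNorm_trim hm h3] at hg
  refine le_trans (le_of_eq (eLpNorm_congr_ae ?_)) hg.le
  filter_upwards [hηη'] with x hx
  simp [hx]

end LpTools

section Ito

variable {Ω : Type*} [mΩ : MeasurableSpace Ω] {P : Measure Ω} [IsProbabilityMeasure P]
  {B : ℝ≥0 → Ω → ℝ} {T : ℝ≥0}

/-- The Itô isometry. -/
lemma IsItoIntegral.eLpNorm_eq (hB_meas : ∀ t, Measurable (B t)) (hB : IsPreBrownianReal B P)
    {X : ℝ → Ω → ℝ} {I : Ω → ℝ} (h : IsItoIntegral B P T X I) :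
    eLpNorm I 2 P = eLpNorm (fun q : ℝ × Ω => X q.1 q.2) 2
      ((volume.restrict (Set.Icc (0 : ℝ) T)).prod P) := by
  obtain ⟨hX, hI, V, hV1, hV2⟩ := h
  have h1 := tendsto_eLpNorm_of_tendsto_eLpNorm_sub hX.1
    (fun k => ((V k).memLp_value hB_meas _ (p := 2)).1) hV1
  have h2 := tendsto_eLpNorm_of_tendsto_eLpNorm_sub hI.1
    (fun k => ((V k).memLp_integral hB_meas hB T).1) hV2
  simp_rw [(V _).eLpNorm_integral hB_meas hB T] at h2
  exact tendsto_nhds_unique h2 h1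

lemma IsItoIntegral.add (hB_meas : ∀ t, Measurable (B t)) (hB : IsPreBrownianReal B P)
    {X X' : ℝ → Ω → ℝ} {I I' : Ω → ℝ}
    (h : IsItoIntegral B P T X I) (h' : IsItoIntegral B P T X' I') :
    IsItoIntegral B P T (fun t ω => X t ω + X' t ω) (fun ω => I ω + I' ω) := by
  obtain ⟨hX, hI, V, hV1, hV2⟩ := h
  obtain ⟨hX', hI', V', hV1', hV2'⟩ := h'
  refine ⟨hX.add hX', hI.add hI', fun k => (V k).add (V' k), ?_, ?_⟩
  · refine tendsto_of_tendsto_of_tendsto_of_le_of_le tendsto_const_nhds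
      (by simpa using hV1.add hV1') (fun k => zero_le) (fun k => ?_)
    refine le_trans (le_of_eq ?_) (eLpNorm_add_le (hX.sub ((V k).memLp_value hB_meas _)).1
      (hX'.sub ((V' k).memLp_value hB_meas _)).1 (by norm_num))
    congr 1
    ext q
    simp only [SimpleItoProcess.add_value, Pi.add_apply]
    ring
  · refine tendsto_of_tendsto_of_tendsto_of_le_of_le tendsto_const_nhds
      (by simpa using hV2.add hV2') (fun k => zero_le) (fun k => ?_)
    refine le_trans (le_of_eq ?_) (eLpNorm_add_le (hI.sub ((V k).memLp_integral hB_meas hB T)).1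
      (hI'.sub ((V' k).memLp_integral hB_meas hB T)).1 (by norm_num))
    congr 1
    ext q
    simp only [SimpleItoProcess.add_integral, Pi.add_apply]
    ring

lemma IsItoIntegral.const_mul (c : ℝ) {X : ℝ → Ω → ℝ} {I : Ω → ℝ}
    (h : IsItoIntegral B P T X I) :
    IsItoIntegral B P T (fun t ω => c * X t ω) (fun ω => c * I ω) := by
  obtain ⟨hX, hI, V, hV1, hV2⟩ := h
  refine ⟨hX.const_mul c, hI.const_mul c, fun k => (V k).smul c, ?_, ?_⟩
  · have := ENNReal.Tendsto.const_mul (a := ‖c‖ₑ) hV1 (Or.inr (by simp))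
    rw [mul_zero] at this
    refine this.congr fun k => ?_
    rw [← eLpNorm_const_smul]
    congr 1
    ext q
    simp only [SimpleItoProcess.smul_value, Pi.smul_apply, smul_eq_mul]
    ring
  · have := ENNReal.Tendsto.const_mul (a := ‖c‖ₑ) hV2 (Or.inr (by simp))
    rw [mul_zero] at this
    refine this.congr fun k => ?_
    rw [← eLpNorm_const_smul]
    congr 1
    ext q
    simp only [SimpleItoProcess.smul_integral, Pi.smul_apply, smul_eq_mul]
    ring

lemma IsItoIntegral.sub (hB_meas : ∀ t, Measurable (B t)) (hB : IsPreBrownianReal B P)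
    {X X' : ℝ → Ω → ℝ} {I I' : Ω → ℝ}
    (h : IsItoIntegral B P T X I) (h' : IsItoIntegral B P T X' I') :
    IsItoIntegral B P T (fun t ω => X t ω - X' t ω) (fun ω => I ω - I' ω) := by
  convert h.add hB_meas hB (h'.const_mul (-1)) using 3
  all_goals ring

lemma IsItoIntegral.congr {X X' : ℝ → Ω → ℝ} {I : Ω → ℝ} (h : IsItoIntegral B P T X I)
    (hX : (fun q : ℝ × Ω => X q.1 q.2) =ᵐ[(volume.restrict (Set.Icc (0 : ℝ) T)).prod P]
      fun q => X' q.1 q.2) : IsItoIntegral B P T X' I := by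
  obtain ⟨h1, hI, V, hV1, hV2⟩ := h
  refine ⟨h1.ae_eq hX, hI, V, hV1.congr fun k => eLpNorm_congr_ae ?_, hV2⟩
  filter_upwards [hX] with q hq
  rw [hq]

/-- The Itô integral is a closed operator. -/
lemma IsItoIntegral.of_approx (hB_meas : ∀ t, Measurable (B t)) (hB : IsPreBrownianReal B P)
    {X : ℝ → Ω → ℝ} {I : Ω → ℝ}
    (hX : MemLp (fun q : ℝ × Ω => X q.1 q.2) 2 ((volume.restrict (Set.Icc (0 : ℝ) T)).prod P))
    (hI : MemLp I 2 P)
    (h : ∀ ε : ℝ≥0∞, ε ≠ 0 → ∃ X' I', IsItoIntegral B P T X' I' ∧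
      eLpNorm (fun q : ℝ × Ω => X q.1 q.2 - X' q.1 q.2) 2
        ((volume.restrict (Set.Icc (0 : ℝ) T)).prod P) ≤ ε ∧
      eLpNorm (fun ω => I ω - I' ω) 2 P ≤ ε) :
    IsItoIntegral B P T X I := by
  have key (k : ℕ) : ∃ V : SimpleItoProcess B P,
      eLpNorm (fun q : ℝ × Ω => X q.1 q.2 - V.value q.1 q.2) 2
        ((volume.restrict (Set.Icc (0 : ℝ) T)).prod P) ≤ 2 * (k : ℝ≥0∞)⁻¹ ∧
      eLpNorm (fun ω => I ω - V.integral T ω) 2 P ≤ 2 * (k : ℝ≥0∞)⁻¹ := by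
    have hk : (k : ℝ≥0∞)⁻¹ ≠ 0 := by simp
    obtain ⟨X', I', ⟨hX', hI', V, hV1, hV2⟩, h1, h2⟩ := h _ hk
    obtain ⟨n, hn1, hn2⟩ := ((hV1.eventually_le_const (pos_iff_ne_zero.2 hk)).and
      (hV2.eventually_le_const (pos_iff_ne_zero.2 hk))).exists
    refine ⟨V n, ?_, ?_⟩
    · rw [two_mul]
      exact (eLpNorm_sub_le_add hX.1 hX'.1 ((V n).memLp_value hB_meas _ (p := 2)).1).trans
        (add_le_add h1 hn1)
    · rw [two_mul]
      exact (eLpNorm_sub_le_add hI.1 hI'.1 ((V n).memLp_integral hB_meas hB T).1).trans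
        (add_le_add h2 hn2)
  choose V hV1 hV2 using key
  have hlim : Tendsto (fun k : ℕ => 2 * (k : ℝ≥0∞)⁻¹) atTop (𝓝 0) := by
    simpa using ENNReal.Tendsto.const_mul (a := 2) ENNReal.tendsto_inv_nat_nhds_zero
      (Or.inr (by simp))
  exact ⟨hX, hI, V, tendsto_of_tendsto_of_tendsto_of_le_of_le tendsto_const_nhds hlim
      (fun _ => zero_le) hV1,
    tendsto_of_tendsto_of_tendsto_of_le_of_le tendsto_const_nhds hlim (fun _ => zero_le) hV2⟩

lemma exists_isItoIntegral_of_approx (hB_meas : ∀ t, Measurable (B t))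
    (hB : IsPreBrownianReal B P) {X : ℝ → Ω → ℝ}
    (hX : MemLp (fun q : ℝ × Ω => X q.1 q.2) 2 ((volume.restrict (Set.Icc (0 : ℝ) T)).prod P))
    (h : ∀ ε : ℝ≥0∞, ε ≠ 0 → ∃ X' I', IsItoIntegral B P T X' I' ∧
      eLpNorm (fun q : ℝ × Ω => X q.1 q.2 - X' q.1 q.2) 2
        ((volume.restrict (Set.Icc (0 : ℝ) T)).prod P) ≤ ε) :
    ∃ I, IsItoIntegral B P T X I := by
  have h' (k : ℕ) := h (2⁻¹ ^ k) (by simp)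
  choose X' I' hI' hX' using h'
  obtain ⟨I, hI, hlim⟩ := exists_memLp_tendsto_of_cauchy (fun k => (hI' k).2.1) (fun k l => by
    rw [((hI' k).sub hB_meas hB (hI' l)).eLpNorm_eq hB_meas hB]
    refine (eLpNorm_sub_le_add (hI' k).1.1 hX.1 (hI' l).1.1).trans (add_le_add ?_ (hX' l))
    rw [eLpNorm_fun_sub_comm]
    exact hX' k)
  refine ⟨I, IsItoIntegral.of_approx hB_meas hB hX hI fun ε hε => ?_⟩
  have h2 : Tendsto (fun k : ℕ => (2⁻¹ : ℝ≥0∞) ^ k) atTop (𝓝 0) :=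
    ENNReal.tendsto_pow_atTop_nhds_zero_of_lt_one (by simp)
  obtain ⟨k, hk1, hk2⟩ := ((hlim.eventually_le_const (pos_iff_ne_zero.2 hε)).and
    (h2.eventually_le_const (pos_iff_ne_zero.2 hε))).exists
  exact ⟨X' k, I' k, hI' k, (hX' k).trans hk2, hk1⟩

lemma eLpNorm_mul_shift (hB_meas : ∀ t, Measurable (B t)) (hB : IsPreBrownianReal B P)
    {c : ℝ≥0} {η W : Ω → ℝ} (hη : AEStronglyMeasurable[natSigma B c] η P)
    (hW : Measurable[shiftSigma B c] W) :
    eLpNorm (fun ω => η ω * W ω) 2 P = eLpNorm η 2 P * eLpNorm W 2 P := by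
  obtain ⟨η', hη', hηη'⟩ := hη
  have hind : IndepFun η' W P := by
    rw [IndepFun_iff_Indep]
    exact indep_of_indep_of_le_left (indep_of_indep_of_le_right (indep_natSigma_shiftSigma hB c)
      hW.comap_le) hη'.measurable.comap_le
  have e : (fun ω => η ω * W ω) =ᵐ[P] fun ω => η' ω * W ω := by
    filter_upwards [hηη'] with ω h
    rw [h]
  refine (ENNReal.pow_right_strictMono two_ne_zero).injective ?_
  simp only [mul_pow]
  rw [eLpNorm_congr_ae e, eLpNorm_congr_ae hηη', eLpNorm_two_sq, eLpNorm_two_sq, eLpNorm_two_sq]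
  have hm : Measurable (fun x : ℝ => ‖x‖ₑ ^ 2) := by fun_prop
  have := lintegral_mul_eq_lintegral_mul_lintegral_of_indepFun (μ := P)
    (f := (fun x : ℝ => ‖x‖ₑ ^ 2) ∘ η') (g := (fun x : ℝ => ‖x‖ₑ ^ 2) ∘ W)
    (hm.comp (hη'.measurable.mono (natSigma_le hB_meas c) le_rfl))
    (hm.comp (hW.mono (shiftSigma_le hB_meas c) le_rfl)) (hind.comp hm hm)
  refine Eq.trans (lintegral_congr fun ω => ?_) this
  simp [enorm_mul, mul_pow]

/-- The Itô integral of a process `η 1_{(c, d]}` with a single jump up and down. -/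
lemma isItoIntegral_indicator (hB_meas : ∀ t, Measurable (B t)) (hB : IsPreBrownianReal B P)
    {c d : ℝ≥0} (hcd : c ≤ d) (hdT : d ≤ T) {η : Ω → ℝ}
    (hη : AEStronglyMeasurable[natSigma B c] η P) (h2 : MemLp η 2 P) :
    IsItoIntegral B P T (fun t ω => (Set.Ioc (c : ℝ) d).indicator (fun _ => η ω) t)
      (fun ω => η ω * (B d ω - B c ω)) := by
  have hmem (ζ : Ω → ℝ) (hζ : MemLp ζ 2 P) :
      MemLp (fun q : ℝ × Ω => (Set.Ioc (c : ℝ) d).indicator (fun _ => ζ q.2) q.1) 2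
        ((volume.restrict (Set.Icc (0 : ℝ) T)).prod P) := by
    have := (hζ.comp_snd (volume.restrict (Set.Icc (0 : ℝ) T))).indicator
      (measurableSet_Ioc.prod MeasurableSet.univ : MeasurableSet (Set.Ioc (c : ℝ) d ×ˢ Set.univ))
    refine this.ae_eq (ae_of_all _ fun q => ?_)
    by_cases h : q.1 ∈ Set.Ioc (c : ℝ) d <;> simp [Set.indicator, h]
  have hmemI : ∀ ζ : Ω → ℝ, AEStronglyMeasurable[natSigma B c] ζ P → MemLp ζ 2 P →
      MemLp (fun ω => ζ ω * (B d ω - B c ω)) 2 P := fun ζ h1 h2 => by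
    refine ⟨(h1.mono (natSigma_le hB_meas c)).mul
      ((hB_meas d).sub (hB_meas c)).aestronglyMeasurable, ?_⟩
    rw [eLpNorm_mul_shift hB_meas hB h1 (measurable_shiftSigma le_rfl hcd)]
    exact ENNReal.mul_lt_top h2.2 (memLp_increment hB c d (by simp)).2
  refine IsItoIntegral.of_approx hB_meas hB (hmem η h2) (hmemI η hη h2) fun ε hε => ?_
  set K : ℝ≥0∞ := eLpNorm (fun ω => B d ω - B c ω) 2 P with hK
  have hKt : K ≠ ∞ := (memLp_increment hB c d (by simp)).2.ne
  set μ : Measure ℝ := volume.restrict (Set.Icc (0 : ℝ) T) with hμ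
  -- `M²` dominates the total mass of `[0, T]`
  set M : ℝ≥0∞ := μ Set.univ + 1 with hM
  have hMt : M ≠ ∞ := by simp [hM]
  obtain ⟨δ, hδ, hδK, hδM⟩ : ∃ δ : ℝ≥0∞, δ ≠ 0 ∧ δ * K ≤ ε ∧ M * δ ≤ ε := by
    have h0 : K + M ≠ 0 := by simp [hM]
    have h1 : min ε 1 / (K + M) * (K + M) = min ε 1 :=
      ENNReal.div_mul_cancel h0 (ENNReal.add_ne_top.2 ⟨hKt, hMt⟩)
    refine ⟨min ε 1 / (K + M), ?_, ?_, ?_⟩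
    · simp [ENNReal.div_eq_zero_iff, hε, hKt, hMt]
    · exact ((mul_le_mul_right le_self_add _).trans h1.le).trans (min_le_left _ _)
    · rw [mul_comm]
      exact ((mul_le_mul_right le_add_self _).trans h1.le).trans (min_le_left _ _)
  obtain ⟨g, hg⟩ := exists_simpleFunc_eLpNorm_sub_le P (natSigma_le hB_meas c) hη h2 hδ
  have hgm : StronglyMeasurable[natSigma B c] g := @SimpleFunc.stronglyMeasurable _ _ (_) _ g
  have hgb : ∃ C : ℝ, ∀ ω, |g ω| ≤ C := (@SimpleFunc.exists_forall_norm_le _ _ (_) _ g)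
  have hg2 : MemLp g 2 P := by
    obtain ⟨C, hC⟩ := hgb
    exact MemLp.of_bound (hgm.mono (natSigma_le hB_meas c)).aestronglyMeasurable C
      (ae_of_all _ hC)
  let V : SimpleItoProcess B P :=
    { card := 1
      a := fun _ => c
      b := fun _ => d
      a_le_b := fun _ => hcd
      ξ := fun _ => g
      measurable_coeff := fun _ => hgm.measurable.mono le_eventuallyMeasurableSpace le_rfl
      bounded_coeff := fun _ => hgb }
  refine ⟨fun t ω => (Set.Ioc (c : ℝ) d).indicator (fun _ => g ω) t,
    fun ω => g ω * (B d ω - B c ω),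
    ⟨hmem g hg2, hmemI g hgm.aestronglyMeasurable hg2, fun _ => V, ?_, ?_⟩, ?_, ?_⟩
  · simp [V, SimpleItoProcess.value]
  · simp [V, SimpleItoProcess.integral, min_eq_left hdT, min_eq_left (hcd.trans hdT)]
  · refine le_trans ?_ ((mul_le_mul_right hg M).trans hδM)
    rw [← ENNReal.pow_le_pow_left_iff two_ne_zero, mul_pow]
    refine (eLpNorm_two_sq_prod ((hmem η h2).sub (hmem g hg2)).1).trans_le ?_
    calc ∫⁻ t, eLpNorm (fun ω => (Set.Ioc (c : ℝ) d).indicator (fun _ => η ω) t -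
          (Set.Ioc (c : ℝ) d).indicator (fun _ => g ω) t) 2 P ^ 2 ∂μ
        ≤ ∫⁻ _, eLpNorm (fun ω => η ω - g ω) 2 P ^ 2 ∂μ := by
          refine lintegral_mono fun t => ?_
          by_cases h : t ∈ Set.Ioc (c : ℝ) d <;> simp [h]
      _ ≤ M ^ 2 * eLpNorm (fun ω => η ω - g ω) 2 P ^ 2 := by
          rw [lintegral_const, mul_comm]
          refine mul_le_mul_left ?_ _
          calc μ Set.univ ≤ M := le_self_add
            _ = M * 1 := (mul_one M).symm
            _ ≤ M * M := mul_le_mul_right le_add_self M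
            _ = M ^ 2 := (sq M).symm
  · have : (fun ω => η ω * (B d ω - B c ω) - g ω * (B d ω - B c ω)) =
        fun ω => (η ω - g ω) * (B d ω - B c ω) := by
      ext ω
      ring
    rw [this, eLpNorm_mul_shift hB_meas hB (η := fun ω => η ω - g ω)
      (hη.sub hgm.aestronglyMeasurable) (measurable_shiftSigma le_rfl hcd)]
    exact (mul_le_mul_left hg K).trans hδK

end Ito

/-! ### Linearity, isometry and closure of the iterated integral -/

/-- Lebesgue measure on the time interval `[0, 1]`. -/
noncomputable abbrev unitTime : Measure ℝ := volume.restrict (Set.Icc (0 : ℝ) 1)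

instance : IsProbabilityMeasure unitTime := ⟨by simp [unitTime]⟩

/-- The product of Lebesgue measure in the two times with `P`. A point is `(t, (s, ω))`, the outer
time first. -/
noncomputable abbrev timesMeasure {Ω : Type*} [MeasurableSpace Ω] (P : Measure Ω) :
    Measure (ℝ × ℝ × Ω) :=
  unitTime.prod (unitTime.prod P)

/-- The process `v` cut off above the diagonal, as a function of `(t, (s, ω))`:
it is `v_{s,t}` for `s ≤ t` and zero otherwise. -/
noncomputable def lowerTri {Ω : Type*} (v : ℝ → ℝ → Ω → ℝ) (p : ℝ × ℝ × Ω) : ℝ :=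
  if p.2.1 ≤ p.1 then v p.2.1 p.1 p.2.2 else 0

section Iterated

variable {Ω : Type*} [mΩ : MeasurableSpace Ω] {P : Measure Ω} [IsProbabilityMeasure P]
  {B : ℝ≥0 → Ω → ℝ}

lemma lowerTri_section (v : ℝ → ℝ → Ω → ℝ) (t : ℝ) :
    (fun q : ℝ × Ω => lowerTri v (t, q)) =
      (Set.Iic t ×ˢ Set.univ).indicator (fun q : ℝ × Ω => v q.1 t q.2) := by
  ext q
  by_cases h : q.1 ≤ t <;> simp [lowerTri, Set.indicator, h]

lemma unitTime_prod_restrict {t : ℝ} (ht : t ∈ Set.Icc (0 : ℝ) 1) :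
    (unitTime.prod P).restrict (Set.Iic t ×ˢ Set.univ) =
      (volume.restrict (Set.Icc (0 : ℝ) t)).prod P := by
  have : Set.Iic t ∩ Set.Icc (0 : ℝ) 1 = Set.Icc 0 t := by
    ext s
    simp only [Set.mem_inter_iff, Set.mem_Iic, Set.mem_Icc]
    exact ⟨fun h => ⟨h.2.1, h.1⟩, fun h => ⟨h.2, h.1, h.2.trans ht.2⟩⟩
  rw [← Measure.prod_restrict, Measure.restrict_univ, Measure.restrict_restrict measurableSet_Iic,
    this]

lemma eLpNorm_lowerTri_section (v : ℝ → ℝ → Ω → ℝ) {t : ℝ} (ht : t ∈ Set.Icc (0 : ℝ) 1) :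
    eLpNorm (fun q : ℝ × Ω => lowerTri v (t, q)) 2 (unitTime.prod P) =
      eLpNorm (fun q : ℝ × Ω => v q.1 t q.2) 2 ((volume.restrict (Set.Icc (0 : ℝ) t)).prod P) := by
  rw [lowerTri_section, eLpNorm_indicator_eq_eLpNorm_restrict
    (measurableSet_Iic.prod MeasurableSet.univ), unitTime_prod_restrict ht]

lemma memLp_lowerTri_section (v : ℝ → ℝ → Ω → ℝ) {t : ℝ} (ht : t ∈ Set.Icc (0 : ℝ) 1) :
    MemLp (fun q : ℝ × Ω => lowerTri v (t, q)) 2 (unitTime.prod P) ↔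
      MemLp (fun q : ℝ × Ω => v q.1 t q.2) 2 ((volume.restrict (Set.Icc (0 : ℝ) t)).prod P) := by
  rw [lowerTri_section, memLp_indicator_iff_restrict
    (measurableSet_Iic.prod MeasurableSet.univ), unitTime_prod_restrict ht]

lemma lowerTri_sub (v w : ℝ → ℝ → Ω → ℝ) (p : ℝ × ℝ × Ω) :
    lowerTri (fun s t ω => v s t ω - w s t ω) p = lowerTri v p - lowerTri w p := by
  simp only [lowerTri]
  split_ifs <;> simp

lemma isItoIntegral_zero (T : ℝ≥0) : IsItoIntegral B P T (fun _ _ => 0) (fun _ => 0) := by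
  let V : SimpleItoProcess B P :=
    { card := 0
      a := fun _ => 0
      b := fun _ => 0
      a_le_b := fun _ => le_rfl
      ξ := fun _ _ => 0
      measurable_coeff := fun _ => measurable_const
      bounded_coeff := fun _ => ⟨0, by simp⟩ }
  refine ⟨MemLp.zero, MemLp.zero, fun _ => V, ?_, ?_⟩
  · simp [V, SimpleItoProcess.value]
  · simp [V, SimpleItoProcess.integral]

lemma IsIteratedItoIntegral.add (hB_meas : ∀ t, Measurable (B t)) (hB : IsPreBrownianReal B P)
    {v v' : ℝ → ℝ → Ω → ℝ} {J J' : Ω → ℝ}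
    (h : IsIteratedItoIntegral B P v J) (h' : IsIteratedItoIntegral B P v' J') :
    IsIteratedItoIntegral B P (fun s t ω => v s t ω + v' s t ω) (fun ω => J ω + J' ω) := by
  obtain ⟨Y, hY, hJ⟩ := h
  obtain ⟨Y', hY', hJ'⟩ := h'
  refine ⟨fun t ω => Y t ω + Y' t ω, ?_, hJ.add hB_meas hB hJ'⟩
  filter_upwards [hY, hY'] with t ht ht'
  exact ht.add hB_meas hB ht'

lemma IsIteratedItoIntegral.sub (hB_meas : ∀ t, Measurable (B t)) (hB : IsPreBrownianReal B P)
    {v v' : ℝ → ℝ → Ω → ℝ} {J J' : Ω → ℝ}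
    (h : IsIteratedItoIntegral B P v J) (h' : IsIteratedItoIntegral B P v' J') :
    IsIteratedItoIntegral B P (fun s t ω => v s t ω - v' s t ω) (fun ω => J ω - J' ω) := by
  obtain ⟨Y, hY, hJ⟩ := h
  obtain ⟨Y', hY', hJ'⟩ := h'
  refine ⟨fun t ω => Y t ω - Y' t ω, ?_, hJ.sub hB_meas hB hJ'⟩
  filter_upwards [hY, hY'] with t ht ht'
  exact ht.sub hB_meas hB ht'

lemma isIteratedItoIntegral_zero :
    IsIteratedItoIntegral B P (fun _ _ _ => 0) (fun _ => 0) :=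
  ⟨fun _ _ => 0, ae_of_all _ fun _ => isItoIntegral_zero _, isItoIntegral_zero _⟩

lemma isIteratedItoIntegral_sum (hB_meas : ∀ t, Measurable (B t)) (hB : IsPreBrownianReal B P)
    {ι : Type*} (S : Finset ι) {v : ι → ℝ → ℝ → Ω → ℝ} {J : ι → Ω → ℝ}
    (h : ∀ i ∈ S, IsIteratedItoIntegral B P (v i) (J i)) :
    IsIteratedItoIntegral B P (fun s t ω => ∑ i ∈ S, v i s t ω) (fun ω => ∑ i ∈ S, J i ω) := by
  classical
  induction S using Finset.induction_on with
  | empty => simpa using isIteratedItoIntegral_zero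
  | insert i S hi ih =>
    simp only [Finset.sum_insert hi]
    exact (h i (by simp)).add hB_meas hB (ih fun j hj => h j (by simp [hj]))

lemma IsIteratedItoIntegral.congr {v v' : ℝ → ℝ → Ω → ℝ} {J : Ω → ℝ}
    (h : IsIteratedItoIntegral B P v J)
    (hv : ∀ s t, (s, t) ∈ timeTriangle → ∀ ω, v s t ω = v' s t ω) :
    IsIteratedItoIntegral B P v' J := by
  obtain ⟨Y, hY, hJ⟩ := h
  refine ⟨Y, ?_, hJ⟩
  filter_upwards [hY, ae_restrict_mem measurableSet_Icc] with t ht ht'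
  refine ht.congr ?_
  have h1 : ∀ᵐ s ∂(volume.restrict (Set.Icc (0 : ℝ) t.toNNReal)), ∀ ω, v s t ω = v' s t ω := by
    filter_upwards [ae_restrict_mem measurableSet_Icc] with s hs ω
    rw [Real.coe_toNNReal _ ht'.1] at hs
    exact hv s t ⟨hs.1, hs.2, ht'.2⟩ ω
  exact (Measure.quasiMeasurePreserving_fst.ae h1).mono fun q hq => hq q.2

/-- The Itô isometry for iterated integrals. -/
lemma IsIteratedItoIntegral.eLpNorm_eq (hB_meas : ∀ t, Measurable (B t))
    (hB : IsPreBrownianReal B P) {v : ℝ → ℝ → Ω → ℝ} {J : Ω → ℝ}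
    (h : IsIteratedItoIntegral B P v J)
    (hv : AEStronglyMeasurable (lowerTri v) (timesMeasure P)) :
    eLpNorm J 2 P = eLpNorm (lowerTri v) 2 (timesMeasure P) := by
  obtain ⟨Y, hY, hJ⟩ := h
  have h1 := hJ.1.1
  rw [hJ.eLpNorm_eq hB_meas hB]
  simp only [NNReal.coe_one] at h1 ⊢
  refine (ENNReal.pow_right_strictMono two_ne_zero).injective ?_
  rw [eLpNorm_two_sq_prod h1, eLpNorm_two_sq_prod hv]
  refine lintegral_congr_ae ?_
  filter_upwards [hY, ae_restrict_mem measurableSet_Icc] with t ht ht'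
  rw [ht.eLpNorm_eq hB_meas hB, eLpNorm_lowerTri_section v ht', Real.coe_toNNReal _ ht'.1]

/-- Square-integrable processes which admit an iterated integral form a closed set. -/
lemma exists_isIteratedItoIntegral_of_approx (hB_meas : ∀ t, Measurable (B t))
    (hB : IsPreBrownianReal B P) {v : ℝ → ℝ → Ω → ℝ}
    (hv : MemLp (lowerTri v) 2 (timesMeasure P))
    (h : ∀ ε : ℝ≥0∞, ε ≠ 0 → ∃ v' J', IsIteratedItoIntegral B P v' J' ∧
      AEStronglyMeasurable (lowerTri v') (timesMeasure P) ∧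
      eLpNorm (fun p => lowerTri v p - lowerTri v' p) 2 (timesMeasure P) ≤ ε) :
    ∃ J, IsIteratedItoIntegral B P v J := by
  have h' (k : ℕ) := h (2⁻¹ ^ k) (by simp)
  choose v' J' hJ' hm hv' using h'
  choose Y' hY' hYJ using hJ'
  have hYm (k : ℕ) : MemLp (fun q : ℝ × Ω => Y' k q.1 q.2) 2 (unitTime.prod P) := by
    simpa using (hYJ k).1
  obtain ⟨Z, hZ, hlim⟩ := exists_memLp_tendsto_of_cauchy hYm (fun k l => by
    have h1 := ((hYJ k).sub hB_meas hB (hYJ l)).eLpNorm_eq hB_meas hB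
    simp only [NNReal.coe_one] at h1
    have h2 : IsIteratedItoIntegral B P (fun s t ω => v' k s t ω - v' l s t ω)
        (fun ω => J' k ω - J' l ω) :=
      IsIteratedItoIntegral.sub hB_meas hB ⟨Y' k, hY' k, hYJ k⟩ ⟨Y' l, hY' l, hYJ l⟩
    have e : lowerTri (fun s t ω => v' k s t ω - v' l s t ω) =
        fun p => lowerTri (v' k) p - lowerTri (v' l) p := funext fun p => lowerTri_sub _ _ p
    have h3 := h2.eLpNorm_eq hB_meas hB (by rw [e]; exact (hm k).sub (hm l))
    rw [e] at h3
    rw [← h1, h3]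
    refine (eLpNorm_sub_le_add (hm k) hv.1 (hm l)).trans (add_le_add ?_ (hv' l))
    rw [eLpNorm_fun_sub_comm]
    exact hv' k)
  -- along a fast subsequence the sections converge for almost every `t`
  have h2 : Tendsto (fun k : ℕ => (2⁻¹ : ℝ≥0∞) ^ k) atTop (𝓝 0) :=
    ENNReal.tendsto_pow_atTop_nhds_zero_of_lt_one (by simp)
  have hsub (j : ℕ) : ∃ k : ℕ, eLpNorm (fun q => Z q - Y' k q.1 q.2) 2 (unitTime.prod P)
      ≤ 2⁻¹ ^ j ∧ (2⁻¹ : ℝ≥0∞) ^ k ≤ 2⁻¹ ^ j :=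
    ((hlim.eventually_le_const (pos_iff_ne_zero.2 (by simp))).and
      (h2.eventually_le_const (pos_iff_ne_zero.2 (by simp)))).exists
  choose n hn1 hn2 using hsub
  have hfast {g : ℕ → ℝ → ℝ≥0∞} (hg : ∀ j, AEMeasurable (g j) unitTime)
      (hg' : ∀ j, ∫⁻ t, g j t ∂unitTime ≤ (2⁻¹ ^ j) ^ 2) :
      ∀ᵐ t ∂unitTime, Tendsto (fun j => g j t) atTop (𝓝 0) := by
    have hfin : ∫⁻ t, ∑' j, g j t ∂unitTime ≠ ∞ := by
      rw [lintegral_tsum hg]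
      refine ne_top_of_le_ne_top ?_ (ENNReal.tsum_le_tsum hg')
      have : ∀ j : ℕ, ((2⁻¹ : ℝ≥0∞) ^ j) ^ 2 ≤ 2⁻¹ ^ j := fun j => by
        rw [sq]
        exact mul_le_of_le_one_left' (pow_le_one' (by simp) j)
      refine ne_top_of_le_ne_top ?_ (ENNReal.tsum_le_tsum this)
      rw [ENNReal.tsum_geometric, ENNReal.one_sub_inv_two]
      simp
    filter_upwards [ae_lt_top' (AEMeasurable.tsum hg) hfin] with t ht
    exact ENNReal.tendsto_atTop_zero_of_tsum_ne_top ht.ne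
  have hmeas2 {β : Type _} [MeasurableSpace β] {ν : Measure β} [SFinite ν] {f : ℝ × β → ℝ}
      (hf : AEStronglyMeasurable f (unitTime.prod ν)) :
      AEMeasurable (fun t => eLpNorm (fun b => f (t, b)) 2 ν ^ 2) unitTime := by
    simp_rw [eLpNorm_two_sq]
    exact (hf.enorm.pow_const 2).lintegral_prod_right'
  have hsq0 {g : ℕ → ℝ≥0∞} (hg : Tendsto (fun j => g j ^ 2) atTop (𝓝 0)) :
      Tendsto g atTop (𝓝 0) := by
    have h3 := (ENNReal.continuous_rpow_const (y := (1 / 2 : ℝ))).tendsto 0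
    have h4 := h3.comp hg
    simp only [one_div, inv_pos, Nat.ofNat_pos, ENNReal.zero_rpow_of_pos] at h4
    refine h4.congr fun j => ?_
    simp only [Function.comp_apply]
    rw [← ENNReal.rpow_natCast, ← ENNReal.rpow_mul]
    norm_num
  have hmv (j : ℕ) : AEStronglyMeasurable (fun p => lowerTri v p - lowerTri (v' (n j)) p)
      (timesMeasure P) := hv.1.sub (hm _)
  have hmZ (j : ℕ) : AEStronglyMeasurable (fun q : ℝ × Ω => Z q - Y' (n j) q.1 q.2)
      (unitTime.prod P) := hZ.1.sub (hYm _).1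
  have hA := hfast (fun j => hmeas2 (hmv j)) (fun j => by
    rw [← eLpNorm_two_sq_prod (hmv j)]
    exact pow_le_pow_left' ((hv' _).trans (hn2 j)) 2)
  have hC := hfast (fun j => hmeas2 (hmZ j)) (fun j => by
    rw [← eLpNorm_two_sq_prod (hmZ j)]
    exact pow_le_pow_left' (hn1 j) 2)
  have hvsec : ∀ᵐ t ∂unitTime, MemLp (fun q : ℝ × Ω => lowerTri v (t, q)) 2 (unitTime.prod P) := by
    have hfin : ∫⁻ t, eLpNorm (fun q : ℝ × Ω => lowerTri v (t, q)) 2 (unitTime.prod P) ^ 2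
        ∂unitTime ≠ ∞ := by
      rw [← eLpNorm_two_sq_prod hv.1]
      exact ENNReal.pow_ne_top hv.2.ne
    filter_upwards [ae_lt_top' (hmeas2 hv.1) hfin, hv.1.prodMk_left] with t ht ht'
    exact ⟨ht', by simpa using ht⟩
  have hZsec : ∀ᵐ t ∂unitTime, MemLp (fun ω : Ω => Z (t, ω)) 2 P := by
    have hfin : ∫⁻ t, eLpNorm (fun ω : Ω => Z (t, ω)) 2 P ^ 2 ∂unitTime ≠ ∞ := by
      rw [← eLpNorm_two_sq_prod hZ.1]
      exact ENNReal.pow_ne_top hZ.2.ne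
    filter_upwards [ae_lt_top' (hmeas2 hZ.1) hfin, hZ.1.prodMk_left] with t ht ht'
    exact ⟨ht', by simpa using ht⟩
  have hYito : ∀ᵐ t ∂unitTime,
      IsItoIntegral B P t.toNNReal (fun s => v s t) (fun ω => Z (t, ω)) := by
    filter_upwards [hA, hC, hvsec, hZsec, ae_restrict_mem measurableSet_Icc, ae_all_iff.2 hY']
      with t h1 h2 h3 h4 ht h5
    refine IsItoIntegral.of_approx hB_meas hB ?_ h4 fun ε hε => ?_
    · rw [Real.coe_toNNReal _ ht.1]
      exact (memLp_lowerTri_section v ht).1 h3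
    · obtain ⟨j, hj1, hj2⟩ := (((hsq0 h1).eventually_le_const (pos_iff_ne_zero.2 hε)).and
        ((hsq0 h2).eventually_le_const (pos_iff_ne_zero.2 hε))).exists
      refine ⟨fun s => v' (n j) s t, Y' (n j) t, h5 _, ?_, hj2⟩
      rw [Real.coe_toNNReal _ ht.1]
      have := eLpNorm_lowerTri_section (P := P) (fun s t ω => v s t ω - v' (n j) s t ω) ht
      simp only [lowerTri_sub] at this
      rw [← this]
      exact hj1
  obtain ⟨J, hJ⟩ := exists_isItoIntegral_of_approx (T := 1) (X := fun t ω => Z (t, ω)) hB_meas hB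
    (by simpa using hZ) fun ε hε => by
      obtain ⟨k, hk⟩ := (hlim.eventually_le_const (pos_iff_ne_zero.2 hε)).exists
      exact ⟨Y' k, J' k, hYJ k, by simpa using hk⟩
  exact ⟨J, fun t ω => Z (t, ω), hYito, hJ⟩

/-- The iterated Itô integral of the indicator of a rectangle below the diagonal, with a random
coefficient. -/
lemma isIteratedItoIntegral_rect (hB_meas : ∀ t, Measurable (B t)) (hB : IsPreBrownianReal B P)
    {a b c d : ℝ≥0} (hab : a ≤ b) (hbc : b ≤ c) (hcd : c ≤ d) (hd : d ≤ 1) {ξ : Ω → ℝ}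
    (hξ : AEStronglyMeasurable[natSigma B a] ξ P) (h2 : MemLp ξ 2 P) :
    IsIteratedItoIntegral B P (fun s t ω => (Set.Ioc (a : ℝ) b).indicator (fun _ => (1 : ℝ)) s *
        (Set.Ioc (c : ℝ) d).indicator (fun _ => (1 : ℝ)) t * ξ ω)
      (fun ω => ξ ω * (B b ω - B a ω) * (B d ω - B c ω)) := by
  have hη : AEStronglyMeasurable[natSigma B c] (fun ω => ξ ω * (B b ω - B a ω)) P := by
    have hm (r : ℝ≥0) (hr : r ≤ c) : AEStronglyMeasurable[natSigma B c] (B r) P :=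
      ((measurable_natSigma hr).stronglyMeasurable).aestronglyMeasurable
    exact (hξ.mono (natSigma_mono (hab.trans hbc))).mul ((hm b hbc).sub (hm a (hab.trans hbc)))
  have hη2 : MemLp (fun ω => ξ ω * (B b ω - B a ω)) 2 P := by
    refine ⟨hη.mono (natSigma_le hB_meas c), ?_⟩
    rw [eLpNorm_mul_shift hB_meas hB hξ (measurable_shiftSigma le_rfl hab)]
    exact ENNReal.mul_lt_top h2.2 (memLp_increment hB a b (by simp)).2
  refine ⟨_, ?_, isItoIntegral_indicator hB_meas hB hcd hd hη hη2⟩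
  filter_upwards [ae_restrict_mem measurableSet_Icc] with t ht
  by_cases h : t ∈ Set.Ioc (c : ℝ) d
  · simp only [h, Set.indicator_of_mem, mul_one]
    have hbt : b ≤ t.toNNReal := by
      rw [Real.le_toNNReal_iff_coe_le ht.1]
      exact le_trans (by exact_mod_cast hbc) h.1.le
    refine (isItoIntegral_indicator hB_meas hB hab hbt hξ h2).congr (ae_of_all _ fun q => ?_)
    by_cases h' : q.1 ∈ Set.Ioc (a : ℝ) b <;> simp [h']
  · simp only [h, Set.indicator_of_notMem, mul_zero, zero_mul, not_false_eq_true]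
    exact isItoIntegral_zero _

end Iterated

/-! ### Uniform grids and conditional expectations along a filtration -/

section Grid

/-- The `k`-th cell `(k/N, (k+1)/N]` of the uniform grid of mesh `1/N`. -/
def gridCell (N k : ℕ) : Set ℝ := Set.Ioc ((k : ℝ) / N) (((k + 1 : ℕ) : ℝ) / N)

/-- The pairs of cells lying strictly below the diagonal. -/
def gridPairs (N : ℕ) : Finset (ℕ × ℕ) :=
  (Finset.range N ×ˢ Finset.range N).filter fun p => p.1 < p.2

lemma measurableSet_gridCell (N k : ℕ) : MeasurableSet (gridCell N k) := measurableSet_Ioc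

lemma exists_mem_gridCell {N : ℕ} (hN : 0 < N) {s : ℝ} (hs : s ∈ Set.Ioc (0 : ℝ) 1) :
    ∃ k < N, s ∈ gridCell N k := by
  have hN' : (0 : ℝ) < N := by exact_mod_cast hN
  have hpos : 0 < ⌈s * N⌉₊ := Nat.ceil_pos.2 (mul_pos hs.1 hN')
  refine ⟨⌈s * N⌉₊ - 1, ?_, ?_, ?_⟩
  · have : ⌈s * N⌉₊ ≤ N := Nat.ceil_le.2 (by nlinarith [hs.2])
    omega
  · rw [div_lt_iff₀ hN']
    exact Nat.lt_ceil.1 (by omega)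
  · rw [le_div_iff₀ hN', Nat.sub_add_cancel hpos]
    exact Nat.le_ceil _

lemma gridCell_unique {N k l : ℕ} {s : ℝ} (hN : 0 < N) (hk : s ∈ gridCell N k)
    (hl : s ∈ gridCell N l) : k = l := by
  have hN' : (0 : ℝ) < N := by exact_mod_cast hN
  have h1 := hk.1.trans_le hl.2
  have h2 := hl.1.trans_le hk.2
  rw [div_lt_div_iff_of_pos_right hN'] at h1 h2
  norm_cast at h1 h2
  omega

lemma gridCell_le_of_le {N k l : ℕ} {s t : ℝ} (hN : 0 < N) (hk : s ∈ gridCell N k)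
    (hl : t ∈ gridCell N l) (hst : s ≤ t) : k ≤ l := by
  have hN' : (0 : ℝ) < N := by exact_mod_cast hN
  have h1 := (hk.1.trans_le hst).trans_le hl.2
  rw [div_lt_div_iff_of_pos_right hN'] at h1
  norm_cast at h1
  omega

lemma gridCell_indicator_mul {N k : ℕ} (hN : 0 < N) {s : ℝ} (f : ℕ → ℝ) {k₀ : ℕ}
    (hs : s ∈ gridCell N k₀) :
    (gridCell N k).indicator (fun _ => (1 : ℝ)) s * f k = if k = k₀ then f k₀ else 0 := by
  by_cases h : k = k₀
  · subst h
    simp [hs]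
  · have : s ∉ gridCell N k := fun h' => h (gridCell_unique hN h' hs)
    simp [this, h]

lemma sum_gridPairs {N : ℕ} (hN : 0 < N) {s t : ℝ} {k l : ℕ} (hk : s ∈ gridCell N k)
    (hl : t ∈ gridCell N l) (hlN : l < N) (f : ℕ × ℕ → ℝ) :
    ∑ p ∈ gridPairs N, (gridCell N p.1).indicator (fun _ => (1 : ℝ)) s *
      (gridCell N p.2).indicator (fun _ => (1 : ℝ)) t * f p = if k < l then f (k, l) else 0 := by
  have hterm : ∀ p : ℕ × ℕ, (gridCell N p.1).indicator (fun _ => (1 : ℝ)) s *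
      (gridCell N p.2).indicator (fun _ => (1 : ℝ)) t * f p = if p = (k, l) then f (k, l) else 0 := by
    rintro ⟨i, j⟩
    by_cases h : (i, j) = (k, l)
    · obtain ⟨rfl, rfl⟩ := Prod.mk.inj h
      simp [hk, hl]
    · rw [if_neg h]
      by_cases hi : i = k
      · have hj : j ≠ l := fun hj => h (by rw [hi, hj])
        have : t ∉ gridCell N j := fun h' => hj (gridCell_unique hN h' hl)
        simp [this]
      · have : s ∉ gridCell N i := fun h' => hi (gridCell_unique hN h' hk)
        simp [this]
  simp_rw [hterm]
  rw [Finset.sum_ite_eq']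
  by_cases hkl : k < l
  · rw [if_pos hkl, if_pos]
    simp [gridPairs, hkl, hlN, hkl.trans hlN]
  · rw [if_neg hkl, if_neg]
    simp [gridPairs, hkl]

lemma unitTime_gridCell {N k : ℕ} (hk : k < N) :
    unitTime (gridCell N k) = (N : ℝ≥0∞)⁻¹ := by
  have hN' : (0 : ℝ) < N := by
    have : 0 < N := by omega
    exact_mod_cast this
  have hsub : gridCell N k ⊆ Set.Icc 0 1 := by
    intro s hs
    refine ⟨le_trans (by positivity) hs.1.le, hs.2.trans ?_⟩
    rw [div_le_one hN']
    exact_mod_cast hk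
  rw [unitTime, Measure.restrict_apply (measurableSet_gridCell N k),
    Set.inter_eq_left.2 hsub, gridCell, Real.volume_Ioc, ← sub_div]
  simp [ENNReal.ofReal_inv_of_pos hN']

lemma ae_unitTime_mem_Ioc : ∀ᵐ t ∂unitTime, t ∈ Set.Ioc (0 : ℝ) 1 := by
  rw [unitTime, ← restrict_Ioc_eq_restrict_Icc]
  exact ae_restrict_mem measurableSet_Ioc

end Grid

section CondExp

variable {Ω : Type*} {mΩ : MeasurableSpace Ω} {P : Measure Ω} [IsProbabilityMeasure P]

/-- Martingale increments grow with the σ-algebra: the smaller one is a conditional expectation of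
the larger one. -/
lemma eLpNorm_condExp_sub_le {f : Ω → ℝ} (hf : MemLp f 2 P) {m₁ m m₂ : MeasurableSpace Ω}
    (h1 : m₁ ≤ m) (h2 : m ≤ m₂) (h : m₂ ≤ mΩ) :
    eLpNorm (fun ω => (P[f | m]) ω - (P[f | m₁]) ω) 2 P ≤
      eLpNorm (fun ω => (P[f | m₂]) ω - (P[f | m₁]) ω) 2 P := by
  have hi : Integrable f P := hf.integrable (by norm_num)
  have e : P[P[f | m₂] - P[f | m₁] | m] =ᵐ[P] fun ω => (P[f | m]) ω - (P[f | m₁]) ω := by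
    have e1 := condExp_sub (integrable_condExp (m := m₂) (f := f) (μ := P))
      (integrable_condExp (m := m₁) (f := f) (μ := P)) m
    have e2 := condExp_condExp_of_le (f := f) (μ := P) h2 h
    have e3 : P[P[f | m₁] | m] = P[f | m₁] := condExp_of_stronglyMeasurable (h2.trans h)
      (stronglyMeasurable_condExp.mono h1) integrable_condExp
    filter_upwards [e1, e2] with ω a b
    rw [a, Pi.sub_apply, b, e3]
  rw [← eLpNorm_congr_ae e]
  exact eLpNorm_condExp_le_eLpNorm _ (by norm_num)

/-- Orthogonality of martingale increments, as Pythagoras' identity. -/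
lemma eLpNorm_condExp_sub_sq {f : Ω → ℝ} (hf : MemLp f 2 P) {m₁ m₂ : MeasurableSpace Ω}
    (h12 : m₁ ≤ m₂) (h : m₂ ≤ mΩ) :
    eLpNorm (fun ω => (P[f | m₂]) ω - (P[f | m₁]) ω) 2 P ^ 2 =
      ENNReal.ofReal (∫ ω, (P[f | m₂]) ω ^ 2 ∂P - ∫ ω, (P[f | m₁]) ω ^ 2 ∂P) := by
  have hc (m : MeasurableSpace Ω) : MemLp (P[f | m]) 2 P := hf.condExp (by norm_num)
  refine (eLpNorm_two_sq_eq_ofReal ((hc m₂).sub (hc m₁))).trans ?_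
  congr 1
  simp only [Pi.sub_apply]
  have hcross : ∫ ω, (P[f | m₁]) ω * (P[f | m₂]) ω ∂P = ∫ ω, (P[f | m₁]) ω ^ 2 ∂P := by
    rw [← integral_condExp (m := m₁) (h12.trans h)]
    refine integral_congr_ae ?_
    have e1 := condExp_mul_of_aestronglyMeasurable_left (μ := P) (m := m₁) (f := P[f | m₁])
      (g := P[f | m₂]) stronglyMeasurable_condExp.aestronglyMeasurable
      ((hc m₁).integrable_mul (hc m₂)) integrable_condExp
    have e2 := condExp_condExp_of_le (f := f) (μ := P) h12 h
    filter_upwards [e1, e2] with ω a b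
    rw [show (fun ω => (P[f | m₁]) ω * (P[f | m₂]) ω) = P[f | m₁] * P[f | m₂] from rfl, a,
      Pi.mul_apply, b, sq]
  have i1 := (hc m₁).integrable_sq
  have i2 := (hc m₂).integrable_sq
  have i3 : Integrable (fun ω => (P[f | m₁]) ω * (P[f | m₂]) ω) P :=
    (hc m₁).integrable_mul (hc m₂)
  have e : ∀ ω, ((P[f | m₂]) ω - (P[f | m₁]) ω) ^ 2 = (P[f | m₂]) ω ^ 2 -
      2 * ((P[f | m₁]) ω * (P[f | m₂]) ω) + (P[f | m₁]) ω ^ 2 := fun ω => by ring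
  simp_rw [e]
  have i4 : Integrable (fun ω => (P[f | m₂]) ω ^ 2 -
      2 * ((P[f | m₁]) ω * (P[f | m₂]) ω)) P := i2.sub (i3.const_mul 2)
  rw [integral_add i4 i1, integral_sub i2 (i3.const_mul 2), integral_const_mul, hcross]
  ring

/-- The increments of a square-integrable martingale are square summable. -/
lemma sum_eLpNorm_condExp_sub_sq_le {f : Ω → ℝ} (hf : MemLp f 2 P) (m : ℕ → MeasurableSpace Ω)
    (hmono : Monotone m) (h : ∀ k, m k ≤ mΩ) (N : ℕ) :
    ∑ k ∈ Finset.range N, eLpNorm (fun ω => (P[f | m (k + 1)]) ω - (P[f | m k]) ω) 2 P ^ 2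
      ≤ eLpNorm f 2 P ^ 2 := by
  have hmono' : Monotone fun k => ∫ ω, (P[f | m k]) ω ^ 2 ∂P := by
    refine monotone_nat_of_le_succ fun k => ?_
    have h1 := eLpNorm_condExp_sub_sq hf (hmono (Nat.le_succ k)) (h _)
    by_contra hlt
    push Not at hlt
    rw [ENNReal.ofReal_of_nonpos (by simpa using hlt.le)] at h1
    have h2 := (eLpNorm_eq_zero_iff ((hf.condExp (m := m (k + 1)) (by norm_num)).sub
      (hf.condExp (m := m k) (by norm_num))).1 (by norm_num)).1 (pow_eq_zero_iff two_ne_zero |>.1 h1)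
    refine hlt.ne (integral_congr_ae ?_)
    filter_upwards [h2] with ω hω
    simp only [Pi.sub_apply, Pi.zero_apply, sub_eq_zero] at hω
    simp only [hω]
  simp_rw [eLpNorm_condExp_sub_sq hf (hmono (Nat.le_succ _)) (h _)]
  rw [← ENNReal.ofReal_sum_of_nonneg fun k _ => sub_nonneg.2 (hmono' (Nat.le_succ k)),
    Finset.sum_range_sub (fun k => ∫ ω, (P[f | m k]) ω ^ 2 ∂P)]
  calc ENNReal.ofReal (∫ ω, (P[f | m N]) ω ^ 2 ∂P - ∫ ω, (P[f | m 0]) ω ^ 2 ∂P)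
      ≤ ENNReal.ofReal (∫ ω, (P[f | m N]) ω ^ 2 ∂P) := ENNReal.ofReal_le_ofReal
        (sub_le_self _ (integral_nonneg fun ω => sq_nonneg _))
    _ = eLpNorm (P[f | m N]) 2 P ^ 2 :=
        (eLpNorm_two_sq_eq_ofReal (hf.condExp (by norm_num))).symm
    _ ≤ eLpNorm f 2 P ^ 2 := pow_le_pow_left' (eLpNorm_condExp_le_eLpNorm _ (by norm_num)) 2

end CondExp

/-! ### Approximation of adapted projections by elementary kernels -/

lemma ENNReal.add_sq_le_four_mul (a b : ℝ≥0∞) : (a + b) ^ 2 ≤ 4 * (a ^ 2 + b ^ 2) := by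
  wlog h : a ≤ b generalizing a b
  · rw [add_comm a, add_comm (a ^ 2)]
    exact this b a (le_of_not_ge h)
  calc (a + b) ^ 2 ≤ (b + b) ^ 2 := pow_le_pow_left' (add_le_add_left h b) 2
    _ = 4 * b ^ 2 := by ring
    _ ≤ 4 * (a ^ 2 + b ^ 2) := mul_le_mul_right le_add_self 4

lemma lintegral_four_mul_add {α : Type*} {m : MeasurableSpace α} {μ : Measure α}
    (f : α → ℝ≥0∞) {g : α → ℝ≥0∞} (hg : Measurable g) :
    ∫⁻ x, 4 * (f x + g x) ∂μ = 4 * (∫⁻ x, f x ∂μ + ∫⁻ x, g x ∂μ) := by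
  rw [lintegral_const_mul' _ _ (by simp), lintegral_add_right _ hg]

lemma MeasureTheory.MemLp.ae_memLp_section {α β : Type*} {mα : MeasurableSpace α}
    {mβ : MeasurableSpace β} {μ : Measure α} {ν : Measure β} [SFinite ν] {f : α × β → ℝ}
    (hf : MemLp f 2 (μ.prod ν)) : ∀ᵐ a ∂μ, MemLp (fun b => f (a, b)) 2 ν := by
  have hfin : ∫⁻ a, eLpNorm (fun b => f (a, b)) 2 ν ^ 2 ∂μ ≠ ∞ := by
    rw [← eLpNorm_two_sq_prod hf.1]
    exact ENNReal.pow_ne_top hf.2.ne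
  have hm : AEMeasurable (fun a => eLpNorm (fun b => f (a, b)) 2 ν ^ 2) μ := by
    simp_rw [eLpNorm_two_sq]
    exact (hf.1.enorm.pow_const 2).lintegral_prod_right'
  filter_upwards [ae_lt_top' hm hfin, hf.1.prodMk_left] with a h h'
  exact ⟨h', by simpa using h⟩

section Density

variable {Ω : Type*} [mΩ : MeasurableSpace Ω] {P : Measure Ω} [IsProbabilityMeasure P]
  {B : ℝ≥0 → Ω → ℝ}

lemma ae_memLp_section₂ {w : ℝ × ℝ × Ω → ℝ} (hw : MemLp w 2 (timesMeasure P)) :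
    ∀ᵐ t ∂unitTime, ∀ᵐ s ∂unitTime, MemLp (fun ω => w (t, s, ω)) 2 P := by
  filter_upwards [hw.ae_memLp_section] with t ht
  exact ht.ae_memLp_section

lemma ae_aestronglyMeasurable_section₂ {w : ℝ × ℝ × Ω → ℝ}
    (hw : AEStronglyMeasurable w (timesMeasure P)) :
    ∀ᵐ t ∂unitTime, ∀ᵐ s ∂unitTime, AEStronglyMeasurable (fun ω => w (t, s, ω)) P := by
  filter_upwards [hw.prodMk_left] with t ht
  exact ht.prodMk_left

lemma eLpNorm_timesMeasure_sq {w : ℝ × ℝ × Ω → ℝ} (hw : AEStronglyMeasurable w (timesMeasure P)) :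
    eLpNorm w 2 (timesMeasure P) ^ 2 =
      ∫⁻ t, ∫⁻ s, eLpNorm (fun ω => w (t, s, ω)) 2 P ^ 2 ∂unitTime ∂unitTime := by
  rw [eLpNorm_two_sq_prod hw]
  refine lintegral_congr_ae ?_
  filter_upwards [hw.prodMk_left] with t ht
  exact eLpNorm_two_sq_prod ht

lemma IsIteratedItoIntegral.const_mul (c : ℝ)
    {v : ℝ → ℝ → Ω → ℝ} {J : Ω → ℝ} (h : IsIteratedItoIntegral B P v J) :
    IsIteratedItoIntegral B P (fun s t ω => c * v s t ω) (fun ω => c * J ω) := by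
  obtain ⟨Y, hY, hJ⟩ := h
  refine ⟨fun t ω => c * Y t ω, ?_, hJ.const_mul c⟩
  filter_upwards [hY] with t ht
  exact ht.const_mul c

lemma lowerTri_add (v w : ℝ → ℝ → Ω → ℝ) (p : ℝ × ℝ × Ω) :
    lowerTri (fun s t ω => v s t ω + w s t ω) p = lowerTri v p + lowerTri w p := by
  simp only [lowerTri]
  split_ifs <;> simp

lemma lowerTri_const_mul (c : ℝ) (v : ℝ → ℝ → Ω → ℝ) (p : ℝ × ℝ × Ω) :
    lowerTri (fun s t ω => c * v s t ω) p = c * lowerTri v p := by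
  simp only [lowerTri]
  split_ifs <;> simp

/-- Iterated integrands come arbitrarily close to the adapted projection
`(s, t) ↦ E[w_{s,t} | 𝓕_s]` of `w`. That the projection need not be jointly measurable is dealt
with by bounding the squared distance by a measurable function `e` of the two times. -/
def AdaptedProjectionApprox (B : ℝ≥0 → Ω → ℝ) (P : Measure Ω) (w : ℝ × ℝ × Ω → ℝ) : Prop :=
  ∀ ε : ℝ≥0∞, ε ≠ 0 → ∃ (v : ℝ → ℝ → Ω → ℝ) (J : Ω → ℝ) (e : ℝ × ℝ → ℝ≥0∞),
    IsIteratedItoIntegral B P v J ∧ AEStronglyMeasurable (lowerTri v) (timesMeasure P) ∧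
    Measurable e ∧ ∫⁻ z, e z ∂(unitTime.prod unitTime) ≤ ε ∧
    ∀ᵐ t ∂unitTime, ∀ᵐ s ∂unitTime, s ≤ t →
      eLpNorm (fun ω => (P[fun ω => w (t, s, ω) | natSigma B s.toNNReal]) ω -
        lowerTri v (t, s, ω)) 2 P ^ 2 ≤ e (t, s)

lemma AdaptedProjectionApprox.add (hB_meas : ∀ t, Measurable (B t)) (hB : IsPreBrownianReal B P)
    {w₁ w₂ : ℝ × ℝ × Ω → ℝ}
    (hm₁ : MemLp w₁ 2 (timesMeasure P)) (hm₂ : MemLp w₂ 2 (timesMeasure P))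
    (h₁ : AdaptedProjectionApprox B P w₁) (h₂ : AdaptedProjectionApprox B P w₂) :
    AdaptedProjectionApprox B P (w₁ + w₂) := by
  intro ε hε
  obtain ⟨v₁, J₁, e₁, hJ₁, hv₁, he₁, hi₁, hb₁⟩ := h₁ (ε / 8) (by simp [ENNReal.div_eq_zero_iff, hε])
  obtain ⟨v₂, J₂, e₂, hJ₂, hv₂, he₂, hi₂, hb₂⟩ := h₂ (ε / 8) (by simp [ENNReal.div_eq_zero_iff, hε])
  have e : lowerTri (fun s t ω => v₁ s t ω + v₂ s t ω) = fun p => lowerTri v₁ p + lowerTri v₂ p :=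
    funext fun p => lowerTri_add _ _ p
  refine ⟨_, _, fun z => 4 * (e₁ z + e₂ z), hJ₁.add hB_meas hB hJ₂, ?_,
    (he₁.add he₂).const_mul 4, ?_, ?_⟩
  · rw [e]
    exact hv₁.add hv₂
  · rw [lintegral_four_mul_add _ he₂]
    calc 4 * (∫⁻ z, e₁ z ∂(unitTime.prod unitTime) + ∫⁻ z, e₂ z ∂(unitTime.prod unitTime))
        ≤ 4 * (ε / 8 + ε / 8) := by gcongr
      _ = 8 * (ε / 8) := by ring
      _ ≤ ε := ENNReal.mul_div_le
  · filter_upwards [hb₁, hb₂, ae_memLp_section₂ hm₁, ae_memLp_section₂ hm₂,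
      ae_aestronglyMeasurable_section₂ hv₁, ae_aestronglyMeasurable_section₂ hv₂]
      with t a₁ a₂ b₁ b₂ c₁ c₂
    filter_upwards [a₁, a₂, b₁, b₂, c₁, c₂] with s a₁ a₂ b₁ b₂ c₁ c₂ hst
    have hadd := condExp_add (b₁.integrable (by norm_num)) (b₂.integrable (by norm_num))
      (natSigma B s.toNNReal)
    have hle : eLpNorm (fun ω => (P[fun ω => (w₁ + w₂) (t, s, ω) | natSigma B s.toNNReal]) ω -
        lowerTri (fun s t ω => v₁ s t ω + v₂ s t ω) (t, s, ω)) 2 P ≤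
        eLpNorm (fun ω => (P[fun ω => w₁ (t, s, ω) | natSigma B s.toNNReal]) ω -
          lowerTri v₁ (t, s, ω)) 2 P +
        eLpNorm (fun ω => (P[fun ω => w₂ (t, s, ω) | natSigma B s.toNNReal]) ω -
          lowerTri v₂ (t, s, ω)) 2 P := by
      refine le_trans (le_of_eq (eLpNorm_congr_ae ?_)) (eLpNorm_add_le
        (integrable_condExp.1.sub c₁) (integrable_condExp.1.sub c₂) (by norm_num))
      filter_upwards [hadd] with ω hω
      have hω' : (P[fun ω => (w₁ + w₂) (t, s, ω) | natSigma B s.toNNReal]) ω =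
        (P[fun ω => w₁ (t, s, ω) | natSigma B s.toNNReal]) ω +
        (P[fun ω => w₂ (t, s, ω) | natSigma B s.toNNReal]) ω := hω
      rw [lowerTri_add, hω']
      simp only [Pi.add_apply]
      ring
    calc _ ≤ _ := pow_le_pow_left' hle 2
      _ ≤ _ := ENNReal.add_sq_le_four_mul _ _
      _ ≤ _ := by
        gcongr
        · exact a₁ hst
        · exact a₂ hst

lemma AdaptedProjectionApprox.const_mul (c : ℝ) {w : ℝ × ℝ × Ω → ℝ}
    (h : AdaptedProjectionApprox B P w) :
    AdaptedProjectionApprox B P (fun p => c * w p) := by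
  intro ε hε
  obtain ⟨v, J, e, hJ, hv, he, hi, hb⟩ := h (ε / ‖c‖ₑ ^ 2)
    (by simp [ENNReal.div_eq_zero_iff, hε])
  have e' : lowerTri (fun s t ω => c * v s t ω) = fun p => c * lowerTri v p :=
    funext fun p => lowerTri_const_mul _ _ p
  refine ⟨_, _, fun z => ‖c‖ₑ ^ 2 * e z, hJ.const_mul c, ?_, he.const_mul _, ?_, ?_⟩
  · rw [e']
    exact hv.const_mul c
  · rw [lintegral_const_mul _ he]
    exact (mul_le_mul_right hi _).trans ENNReal.mul_div_le
  · filter_upwards [hb] with t a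
    filter_upwards [a] with s a hst
    refine le_trans (le_of_eq ?_) (mul_le_mul_right (a hst) _)
    rw [← mul_pow, ← eLpNorm_const_smul]
    congr 1
    refine eLpNorm_congr_ae ?_
    filter_upwards [condExp_smul c (fun ω => w (t, s, ω)) (natSigma B s.toNNReal)] with ω hω
    have hω' : (P[fun ω => c * w (t, s, ω) | natSigma B s.toNNReal]) ω =
      c * (P[fun ω => w (t, s, ω) | natSigma B s.toNNReal]) ω := hω
    rw [lowerTri_const_mul, hω']
    simp only [Pi.smul_apply, smul_eq_mul]
    ring

lemma measurable_eLpNorm_section₂ {w : ℝ × ℝ × Ω → ℝ} (hw : Measurable w) :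
    Measurable fun z : ℝ × ℝ => eLpNorm (fun ω => w (z.1, z.2, ω)) 2 P ^ 2 := by
  simp_rw [eLpNorm_two_sq]
  have : Measurable fun q : (ℝ × ℝ) × Ω => ‖w (q.1.1, q.1.2, q.2)‖ₑ ^ 2 := by fun_prop
  exact this.lintegral_prod_right'

/-- Approximability is closed under `L²` limits, since conditioning is a contraction. -/
lemma AdaptedProjectionApprox.of_approx {w : ℝ × ℝ × Ω → ℝ}
    (hw : Measurable w) (hm : MemLp w 2 (timesMeasure P))
    (h : ∀ ε : ℝ≥0∞, ε ≠ 0 → ∃ w', AdaptedProjectionApprox B P w' ∧ Measurable w' ∧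
      MemLp w' 2 (timesMeasure P) ∧ eLpNorm (fun p => w p - w' p) 2 (timesMeasure P) ^ 2 ≤ ε) :
    AdaptedProjectionApprox B P w := by
  intro ε hε
  have hε8 : ε / 8 ≠ 0 := by simp [ENNReal.div_eq_zero_iff, hε]
  obtain ⟨w', hw', hmw', hm', hd⟩ := h _ hε8
  obtain ⟨v, J, e, hJ, hv, he, hi, hb⟩ := hw' _ hε8
  have hdm := measurable_eLpNorm_section₂ (P := P) (hw.sub hmw')
  refine ⟨v, J, fun z => 4 * (eLpNorm (fun ω => (w - w') (z.1, z.2, ω)) 2 P ^ 2 + e z), hJ, hv,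
    (hdm.add he).const_mul _, ?_, ?_⟩
  · rw [lintegral_four_mul_add _ he, lintegral_prod _ hdm.aemeasurable]
    have := eLpNorm_timesMeasure_sq (hm.sub hm').1
    rw [← this]
    calc 4 * (eLpNorm (w - w') 2 (timesMeasure P) ^ 2 + ∫⁻ z, e z ∂(unitTime.prod unitTime))
        ≤ 4 * (ε / 8 + ε / 8) := mul_le_mul_right (add_le_add hd hi) _
      _ = 8 * (ε / 8) := by ring
      _ ≤ ε := ENNReal.mul_div_le
  · filter_upwards [hb, ae_memLp_section₂ hm, ae_memLp_section₂ hm',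
      ae_aestronglyMeasurable_section₂ hv] with t a b c d
    filter_upwards [a, b, c, d] with s a b c d hst
    have hsub := condExp_sub (b.integrable (by norm_num)) (c.integrable (by norm_num))
      (natSigma B s.toNNReal)
    have hle : eLpNorm (fun ω => (P[fun ω => w (t, s, ω) | natSigma B s.toNNReal]) ω -
        lowerTri v (t, s, ω)) 2 P ≤
        eLpNorm (fun ω => (w - w') (t, s, ω)) 2 P +
        eLpNorm (fun ω => (P[fun ω => w' (t, s, ω) | natSigma B s.toNNReal]) ω -
          lowerTri v (t, s, ω)) 2 P := by
      refine (eLpNorm_sub_le_add integrable_condExp.1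
        (integrable_condExp (m := natSigma B s.toNNReal) (f := fun ω => w' (t, s, ω))).1
        d).trans (add_le_add_left ?_ _)
      refine le_trans (le_of_eq (eLpNorm_congr_ae ?_)) (eLpNorm_condExp_le_eLpNorm
        (m := natSigma B s.toNNReal) _ (by norm_num))
      exact hsub.symm
    calc _ ≤ _ := pow_le_pow_left' hle 2
      _ ≤ _ := ENNReal.add_sq_le_four_mul _ _
      _ ≤ _ := by
        gcongr
        exact a hst

/-- An adapted square-integrable process has an iterated integral once it is a limit of functions
whose adapted projections are approximable: conditioning on `𝓕_s` is a contraction which fixes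
the process. -/
lemma exists_isIteratedItoIntegral_of_projectionApprox (hB_meas : ∀ t, Measurable (B t))
    (hB : IsPreBrownianReal B P) {v : ℝ → ℝ → Ω → ℝ}
    (hv : MemLp (lowerTri v) 2 (timesMeasure P))
    (hadap : ∀ s t : ℝ, 0 ≤ s → s ≤ t → t ≤ 1 →
      AEStronglyMeasurable[natSigma B s.toNNReal] (v s t) P)
    (h : ∀ ε : ℝ≥0∞, ε ≠ 0 → ∃ w', AdaptedProjectionApprox B P w' ∧
      MemLp w' 2 (timesMeasure P) ∧
      eLpNorm (fun p => lowerTri v p - w' p) 2 (timesMeasure P) ^ 2 ≤ ε) :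
    ∃ J, IsIteratedItoIntegral B P v J := by
  refine exists_isIteratedItoIntegral_of_approx hB_meas hB hv fun ε hε => ?_
  have hε8 : ε ^ 2 / 8 ≠ 0 := by simp [ENNReal.div_eq_zero_iff, hε]
  obtain ⟨w', hw', hm', hd⟩ := h _ hε8
  obtain ⟨v', J, e, hJ, hv', he, hi, hb⟩ := hw' _ hε8
  refine ⟨v', J, hJ, hv', ?_⟩
  rw [← ENNReal.pow_le_pow_left_iff two_ne_zero]
  have hcal : ∫⁻ t, ∫⁻ s, eLpNorm (fun ω => lowerTri v (t, s, ω) - lowerTri v' (t, s, ω)) 2 P ^ 2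
      ∂unitTime ∂unitTime ≤ ∫⁻ t, ∫⁻ s, 4 * (eLpNorm (fun ω => lowerTri v (t, s, ω) -
        w' (t, s, ω)) 2 P ^ 2 + e (t, s)) ∂unitTime ∂unitTime := by
    refine lintegral_mono_ae ?_
    filter_upwards [hb, ae_memLp_section₂ hv, ae_memLp_section₂ hm',
      ae_aestronglyMeasurable_section₂ hv', ae_restrict_mem measurableSet_Icc] with t a b c d ht
    refine lintegral_mono_ae ?_
    filter_upwards [a, b, c, d, ae_restrict_mem measurableSet_Icc] with s a b c d hs
    by_cases hst : s ≤ t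
    · have hsub := condExp_sub (b.integrable (by norm_num)) (c.integrable (by norm_num))
        (natSigma B s.toNNReal)
      have hfix := condExp_of_aestronglyMeasurable' (natSigma_le hB_meas s.toNNReal)
        (f := fun ω => lowerTri v (t, s, ω)) (μ := P) (by
          simp only [lowerTri, hst, if_true]
          exact hadap s t hs.1 hst ht.2) (b.integrable (by norm_num))
      have hle : eLpNorm (fun ω => lowerTri v (t, s, ω) - lowerTri v' (t, s, ω)) 2 P ≤
          eLpNorm (fun ω => lowerTri v (t, s, ω) - w' (t, s, ω)) 2 P +
          eLpNorm (fun ω => (P[fun ω => w' (t, s, ω) | natSigma B s.toNNReal]) ω -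
            lowerTri v' (t, s, ω)) 2 P := by
        refine (eLpNorm_sub_le_add b.1
          (integrable_condExp (m := natSigma B s.toNNReal) (f := fun ω => w' (t, s, ω))).1
          d).trans (add_le_add_left ?_ _)
        refine le_trans (le_of_eq (eLpNorm_congr_ae ?_)) (eLpNorm_condExp_le_eLpNorm
          (m := natSigma B s.toNNReal) _ (by norm_num))
        filter_upwards [hsub, hfix] with ω h1 h2
        refine Eq.trans ?_ h1.symm
        rw [Pi.sub_apply, h2]
      calc _ ≤ _ := pow_le_pow_left' hle 2
        _ ≤ _ := ENNReal.add_sq_le_four_mul _ _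
        _ ≤ _ := by
          gcongr
          exact a hst
    · simp [lowerTri, hst]
  refine (eLpNorm_timesMeasure_sq (hv.1.sub hv')).trans_le (hcal.trans ?_)
  have hin (t : ℝ) : ∫⁻ s, 4 * (eLpNorm (fun ω => lowerTri v (t, s, ω) - w' (t, s, ω)) 2 P ^ 2 +
      e (t, s)) ∂unitTime = 4 * (∫⁻ s, eLpNorm (fun ω => lowerTri v (t, s, ω) -
        w' (t, s, ω)) 2 P ^ 2 ∂unitTime + ∫⁻ s, e (t, s) ∂unitTime) :=
    lintegral_four_mul_add _ (he.comp measurable_prodMk_left)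
  simp_rw [hin]
  rw [lintegral_four_mul_add _ (by exact he.lintegral_prod_right')]
  have h1 := eLpNorm_timesMeasure_sq (hv.1.sub hm'.1)
  have h2 := lintegral_prod (μ := unitTime) (ν := unitTime) _ he.aemeasurable
  calc _ = 4 * (eLpNorm (fun p => lowerTri v p - w' p) 2 (timesMeasure P) ^ 2 +
        ∫⁻ z, e z ∂(unitTime.prod unitTime)) := by
        rw [h2]
        exact congrArg (fun x => 4 * (x + _)) h1.symm
    _ ≤ 4 * (ε ^ 2 / 8 + ε ^ 2 / 8) := mul_le_mul_right (add_le_add hd hi) _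
    _ = 8 * (ε ^ 2 / 8) := by ring
    _ ≤ ε ^ 2 := ENNReal.mul_div_le

end Density

/-! ### Density of elementary kernels and existence of the iterated integral -/

section Existence

variable {Ω : Type*} [mΩ : MeasurableSpace Ω] {P : Measure Ω} [IsProbabilityMeasure P]
  {B : ℝ≥0 → Ω → ℝ}

lemma measurable_lowerTri {v : ℝ → ℝ → Ω → ℝ}
    (hv : Measurable fun p : ℝ × ℝ × Ω => v p.2.1 p.1 p.2.2) : Measurable (lowerTri v) :=
  Measurable.ite (measurableSet_le (measurable_fst.comp measurable_snd) measurable_fst) hv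
    measurable_const

/-- A grid cell cut off at `x` is again an interval `(k/N, b]`, possibly empty. -/
lemma exists_truncated_gridCell {N : ℕ} (hN : 0 < N) (k : ℕ) (x : ℝ) :
    ∃ b : ℝ≥0, (k : ℝ≥0) / N ≤ b ∧ b ≤ ((k + 1 : ℕ) : ℝ≥0) / N ∧ ∀ s : ℝ,
      (Set.Ioc (((k : ℝ≥0) / N : ℝ≥0) : ℝ) b).indicator (fun _ => (1 : ℝ)) s =
      (gridCell N k).indicator (fun _ => (1 : ℝ)) s *
        (Set.Iic x).indicator (fun _ => (1 : ℝ)) s := by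
  have hN' : (0 : ℝ≥0) < N := by exact_mod_cast hN
  refine ⟨max ((k : ℝ≥0) / N) (min (((k + 1 : ℕ) : ℝ≥0) / N) x.toNNReal), le_max_left _ _,
    max_le ?_ (min_le_left _ _), fun s => ?_⟩
  · gcongr
    simp
  have hiff : s ∈ Set.Ioc (((k : ℝ≥0) / N : ℝ≥0) : ℝ)
      (max ((k : ℝ≥0) / N) (min (((k + 1 : ℕ) : ℝ≥0) / N) x.toNNReal) : ℝ≥0) ↔
      s ∈ gridCell N k ∧ s ∈ Set.Iic x := by
    have h0 : (0 : ℝ) ≤ (k : ℝ) / N := by positivity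
    simp only [gridCell, Set.mem_Ioc, Set.mem_Iic, NNReal.coe_max, NNReal.coe_min, NNReal.coe_div,
      NNReal.coe_natCast, le_max_iff, le_min_iff, Real.coe_toNNReal']
    constructor
    · rintro ⟨h1, h2 | ⟨h2, h3 | h3⟩⟩
      · linarith
      · exact ⟨⟨h1, h2⟩, h3⟩
      · linarith
    · rintro ⟨⟨h1, h2⟩, h3⟩
      exact ⟨h1, Or.inr ⟨h2, Or.inl h3⟩⟩
  by_cases h1 : s ∈ gridCell N k <;> by_cases h2 : s ∈ Set.Iic x <;>
    simp only [Set.indicator, hiff, h1, h2, and_true, and_false, if_true, if_false,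
      mul_one, mul_zero]

/-- The adapted projection of `1_{t ≤ y} 1_{s ≤ x} 1_A` is `E[1_A | 𝓕_s]` on the box. Freezing the
conditional expectation at the grid point left of `s` costs at most the squared martingale increment
`δ_k` over the cell of `s` off the diagonal cells; on the diagonal cells the approximation is `0` and
the cost is at most `1`. After integration both amount to at most `1/N`. -/
lemma adaptedProjectionApprox_box (hB_meas : ∀ t, Measurable (B t)) (hB : IsPreBrownianReal B P)
    (x y : ℝ) {A : Set Ω} (hA : MeasurableSet A) :
    AdaptedProjectionApprox B P
      ((Set.Iic y ×ˢ (Set.Iic x ×ˢ A)).indicator (fun _ : ℝ × ℝ × Ω => (1 : ℝ))) := by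
  intro ε hε
  obtain ⟨N, hN0, hN⟩ : ∃ N : ℕ, 0 < N ∧ 2 * (N : ℝ≥0∞)⁻¹ ≤ ε := by
    have hlim : Tendsto (fun k : ℕ => 2 * (k : ℝ≥0∞)⁻¹) atTop (𝓝 0) := by
      simpa using ENNReal.Tendsto.const_mul (a := 2) ENNReal.tendsto_inv_nat_nhds_zero
        (Or.inr (by simp))
    obtain ⟨N, h1, h2⟩ := ((hlim.eventually_le_const (pos_iff_ne_zero.2 hε)).and
      (eventually_gt_atTop 0)).exists
    exact ⟨N, h2, h1⟩
  set f : Ω → ℝ := A.indicator (fun _ => (1 : ℝ)) with hf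
  have hf2 : MemLp f 2 P := memLp_indicator_const 2 hA 1 (Or.inr (by simp))
  have hf1 : eLpNorm f 2 P ^ 2 ≤ 1 := by
    refine pow_le_one' ?_ 2
    refine (eLpNorm_indicator_const_le (1 : ℝ) 2).trans ?_
    simp only [enorm_one, one_mul]
    exact ENNReal.rpow_le_one prob_le_one (by positivity)
  let m : ℕ → MeasurableSpace Ω := fun k => natSigma B ((k : ℝ≥0) / N)
  have hmono : Monotone m := fun i j hij => natSigma_mono (by gcongr)
  have hmle (k : ℕ) : m k ≤ mΩ := natSigma_le hB_meas _
  let M : ℕ → Ω → ℝ := fun k => P[f | m k]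
  have hM2 (k : ℕ) : MemLp (M k) 2 P := hf2.condExp (by norm_num)
  let δ : ℕ → ℝ≥0∞ := fun k => eLpNorm (fun ω => M (k + 1) ω - M k ω) 2 P ^ 2
  have hδ : ∑ k ∈ Finset.range N, δ k ≤ 1 :=
    (sum_eLpNorm_condExp_sub_sq_le hf2 m hmono hmle N).trans hf1
  choose b hb1 hb2 hb3 using fun k => exists_truncated_gridCell hN0 k x
  choose d hd1 hd2 hd3 using fun k => exists_truncated_gridCell hN0 k y
  have hJ := isIteratedItoIntegral_sum hB_meas hB (gridPairs N)
    (v := fun p s t ω => (Set.Ioc (((p.1 : ℝ≥0) / N : ℝ≥0) : ℝ) (b p.1)).indicator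
      (fun _ => (1 : ℝ)) s * (Set.Ioc (((p.2 : ℝ≥0) / N : ℝ≥0) : ℝ) (d p.2)).indicator
      (fun _ => (1 : ℝ)) t * M p.1 ω)
    (J := fun p ω => M p.1 ω * (B (b p.1) ω - B ((p.1 : ℝ≥0) / N) ω) *
      (B (d p.2) ω - B ((p.2 : ℝ≥0) / N) ω)) (fun p hp => by
    simp only [gridPairs, Finset.mem_filter, Finset.mem_product, Finset.mem_range] at hp
    have hN' : (0 : ℝ≥0) < N := by exact_mod_cast hN0
    refine isIteratedItoIntegral_rect hB_meas hB (hb1 _) ((hb2 _).trans ?_) (hd1 _)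
      ((hd2 _).trans ?_) stronglyMeasurable_condExp.aestronglyMeasurable (hM2 _)
    · gcongr
      exact hp.2
    · rw [div_le_one hN']
      exact_mod_cast hp.1.2)
  set v : ℝ → ℝ → Ω → ℝ := fun s t ω => (Set.Iic x).indicator (fun _ => (1 : ℝ)) s *
    (Set.Iic y).indicator (fun _ => (1 : ℝ)) t * ∑ p ∈ gridPairs N,
      (gridCell N p.1).indicator (fun _ => (1 : ℝ)) s *
      (gridCell N p.2).indicator (fun _ => (1 : ℝ)) t * M p.1 ω with hv
  have hJv := hJ.congr (v' := v) (fun s t _ ω => by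
    simp only [hv, Finset.mul_sum, hb3, hd3]
    refine Finset.sum_congr rfl fun p _ => ?_
    ring)
  have hind {S : Set ℝ} (hS : MeasurableSet S) :
      Measurable (S.indicator fun _ => (1 : ℝ)) := measurable_const.indicator hS
  have hMm (k : ℕ) : Measurable (M k) :=
    (stronglyMeasurable_condExp.mono (hmle k)).measurable
  have hvm : Measurable (lowerTri v) := by
    refine measurable_lowerTri ?_
    refine Measurable.mul (Measurable.mul ?_ ?_) (Finset.measurable_sum _ fun p _ =>
      Measurable.mul (Measurable.mul ?_ ?_) ?_)
    · exact (hind measurableSet_Iic).comp (measurable_fst.comp measurable_snd)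
    · exact (hind measurableSet_Iic).comp measurable_fst
    · exact (hind (measurableSet_gridCell _ _)).comp (measurable_fst.comp measurable_snd)
    · exact (hind (measurableSet_gridCell _ _)).comp measurable_fst
    · exact (hMm _).comp (measurable_snd.comp measurable_snd)
  have hind' (k : ℕ) : Measurable ((gridCell N k).indicator fun _ => (1 : ℝ≥0∞)) :=
    measurable_const.indicator (measurableSet_gridCell _ _)
  have hem (k : ℕ) : Measurable fun z : ℝ × ℝ => (δ k + (gridCell N k).indicator
      (fun _ => (1 : ℝ≥0∞)) z.1) * (gridCell N k).indicator (fun _ => (1 : ℝ≥0∞)) z.2 :=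
    (((hind' k).comp measurable_fst).const_add _).mul ((hind' k).comp measurable_snd)
  -- the first factor carries the increments `δ_k`; the indicator in `t` charges the diagonal cells
  refine ⟨v, _, fun z => ∑ k ∈ Finset.range N, (δ k + (gridCell N k).indicator
    (fun _ => (1 : ℝ≥0∞)) z.1) * (gridCell N k).indicator (fun _ => (1 : ℝ≥0∞)) z.2, hJv,
    hvm.aestronglyMeasurable, Finset.measurable_sum _ fun k _ => hem k, ?_, ?_⟩
  · rw [lintegral_finsetSum _ fun k _ => hem k]
    have hterm : ∀ k ∈ Finset.range N, ∫⁻ z : ℝ × ℝ, (δ k + (gridCell N k).indicator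
        (fun _ => (1 : ℝ≥0∞)) z.1) * (gridCell N k).indicator (fun _ => (1 : ℝ≥0∞)) z.2
        ∂(unitTime.prod unitTime) = (δ k + (N : ℝ≥0∞)⁻¹) * (N : ℝ≥0∞)⁻¹ := by
      intro k hk
      have hu : ∫⁻ s, (gridCell N k).indicator (fun _ => (1 : ℝ≥0∞)) s ∂unitTime =
          (N : ℝ≥0∞)⁻¹ := by
        rw [lintegral_indicator_const (measurableSet_gridCell N k),
          unitTime_gridCell (Finset.mem_range.1 hk), one_mul]
      rw [lintegral_prod_mul (f := fun t => δ k + (gridCell N k).indicator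
        (fun _ => (1 : ℝ≥0∞)) t) ((hind' k).const_add _).aemeasurable (hind' k).aemeasurable, hu,
        lintegral_add_left measurable_const, hu]
      simp
    rw [Finset.sum_congr rfl hterm, ← Finset.sum_mul, Finset.sum_add_distrib]
    refine le_trans ?_ hN
    refine mul_le_mul_left ?_ _
    rw [Finset.sum_const, Finset.card_range, nsmul_eq_mul, ENNReal.mul_inv_cancel
      (by exact_mod_cast hN0.ne') (by simp), ← one_add_one_eq_two]
    exact add_le_add_left hδ 1
  · filter_upwards [ae_unitTime_mem_Ioc] with t ht
    filter_upwards [ae_unitTime_mem_Ioc] with s hs hst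
    obtain ⟨k, hkN, hk⟩ := exists_mem_gridCell hN0 hs
    obtain ⟨l, hlN, hl⟩ := exists_mem_gridCell hN0 ht
    have hkl := gridCell_le_of_le hN0 hk hl hst
    refine le_trans ?_ (Finset.single_le_sum (fun i _ => zero_le) (Finset.mem_range.2 hkN))
    simp only [hk, Set.indicator_of_mem, mul_one]
    have hlow (ω : Ω) : lowerTri v (t, s, ω) = (Set.Iic x).indicator (fun _ => (1 : ℝ)) s *
        (Set.Iic y).indicator (fun _ => (1 : ℝ)) t * if k < l then M k ω else 0 := by
      simp only [lowerTri, hst, if_true, hv]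
      rw [sum_gridPairs hN0 hk hl hlN (fun p => M p.1 ω)]
    by_cases hxy : s ≤ x ∧ t ≤ y
    · have hw : (fun ω => (Set.Iic y ×ˢ (Set.Iic x ×ˢ A)).indicator
          (fun _ : ℝ × ℝ × Ω => (1 : ℝ)) (t, s, ω)) = f := by
        ext ω
        by_cases hω : ω ∈ A
        · have : (t, s, ω) ∈ Set.Iic y ×ˢ Set.Iic x ×ˢ A := ⟨hxy.2, hxy.1, hω⟩
          rw [Set.indicator_of_mem this, hf, Set.indicator_of_mem hω]
        · have : (t, s, ω) ∉ Set.Iic y ×ˢ Set.Iic x ×ˢ A := fun h => hω h.2.2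
          rw [Set.indicator_of_notMem this, hf, Set.indicator_of_notMem hω]
      rw [hw]
      simp only [hlow, Set.indicator, Set.mem_Iic, hxy.1, hxy.2, if_true, one_mul]
      rcases hkl.lt_or_eq with h | h
      · simp only [h, if_true]
        refine le_trans (pow_le_pow_left' ?_ 2) le_self_add
        refine eLpNorm_condExp_sub_le hf2 (natSigma_mono ?_) (natSigma_mono ?_) (hmle _)
        · rw [Real.le_toNNReal_iff_coe_le hs.1.le]
          simpa using hk.1.le
        · rw [Real.toNNReal_le_iff_le_coe]
          simpa using hk.2
      · subst h
        simp only [lt_irrefl, if_false, sub_zero, hl, if_true]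
        exact ((pow_le_pow_left' (eLpNorm_condExp_le_eLpNorm _ (by norm_num)) 2).trans hf1).trans
          le_add_self
    · have hw : (fun ω => (Set.Iic y ×ˢ (Set.Iic x ×ˢ A)).indicator
          (fun _ : ℝ × ℝ × Ω => (1 : ℝ)) (t, s, ω)) = 0 := by
        ext ω
        have : ¬ (t ≤ y ∧ s ≤ x ∧ ω ∈ A) := fun h => hxy ⟨h.2.1, h.1⟩
        simp [Set.indicator, this]
      have hz : (Set.Iic x).indicator (fun _ => (1 : ℝ)) s *
        (Set.Iic y).indicator (fun _ => (1 : ℝ)) t = 0 := by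
        by_cases h1 : s ≤ x
        · have h2 : ¬ t ≤ y := fun h => hxy ⟨h1, h⟩
          simp [Set.indicator, h2]
        · simp [Set.indicator, h1]
      rw [hw]
      simp [hlow, hz]

lemma isCountablySpanning_range_Iic : IsCountablySpanning (Set.range (Set.Iic : ℝ → Set ℝ)) :=
  ⟨fun n => Set.Iic (n : ℝ), fun n => ⟨n, rfl⟩, by
    ext x
    simpa using exists_nat_ge x⟩

lemma memLp_indicator_one {α : Type*} {m : MeasurableSpace α} {μ : Measure α} [IsFiniteMeasure μ]
    {S : Set α} (hS : MeasurableSet S) : MemLp (S.indicator fun _ => (1 : ℝ)) 2 μ :=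
  memLp_indicator_const 2 hS 1 (Or.inr (measure_ne_top _ _))

/-- The approximable sets contain the boxes and are stable under complements and countable disjoint
unions. -/
lemma adaptedProjectionApprox_indicator (hB_meas : ∀ t, Measurable (B t))
    (hB : IsPreBrownianReal B P) {S : Set (ℝ × ℝ × Ω)} (hS : MeasurableSet S) :
    AdaptedProjectionApprox B P (S.indicator fun _ => (1 : ℝ)) := by
  have hzero : AdaptedProjectionApprox B P (fun _ => 0) := by
    intro ε hε
    refine ⟨fun _ _ _ => 0, fun _ => 0, fun _ => 0, isIteratedItoIntegral_zero, ?_,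
      measurable_const, by simp, ?_⟩
    · exact (measurable_lowerTri measurable_const).aestronglyMeasurable
    · refine ae_of_all _ fun t => ae_of_all _ fun s _ => ?_
      have : (fun _ : Ω => (0 : ℝ)) = 0 := rfl
      simp [lowerTri, this]
  have hreal : MeasurableSpace.generateFrom (Set.range (Set.Iic : ℝ → Set ℝ)) =
      (inferInstance : MeasurableSpace ℝ) := by
    rw [← borel_eq_generateFrom_Iic]
    exact (BorelSpace.measurable_eq (α := ℝ)).symm
  have hone : AdaptedProjectionApprox B P (fun _ => 1) := by
    refine AdaptedProjectionApprox.of_approx measurable_const (memLp_const 1) fun ε hε => ?_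
    refine ⟨_, adaptedProjectionApprox_box hB_meas hB 1 1 MeasurableSet.univ, ?_, ?_, ?_⟩
    · exact measurable_const.indicator
        (measurableSet_Iic.prod (measurableSet_Iic.prod MeasurableSet.univ))
    · exact memLp_indicator_one
        (measurableSet_Iic.prod (measurableSet_Iic.prod MeasurableSet.univ))
    · have h1 : ∀ᵐ p ∂(timesMeasure P), p.1 ∈ Set.Icc (0 : ℝ) 1 :=
        Measure.quasiMeasurePreserving_fst.ae (ae_restrict_mem measurableSet_Icc)
      have h2 : ∀ᵐ p ∂(timesMeasure P), p.2.1 ∈ Set.Icc (0 : ℝ) 1 :=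
        Measure.quasiMeasurePreserving_snd.ae (Measure.quasiMeasurePreserving_fst.ae
          (ae_restrict_mem measurableSet_Icc))
      have h3 : (fun p : ℝ × ℝ × Ω => (1 : ℝ) - (Set.Iic (1 : ℝ) ×ˢ (Set.Iic (1 : ℝ) ×ˢ
          (Set.univ : Set Ω))).indicator (fun _ => (1 : ℝ)) p) =ᵐ[timesMeasure P] 0 := by
        filter_upwards [h1, h2] with p h1 h2
        simp [Set.indicator, h1.2, h2.2]
      rw [eLpNorm_congr_ae h3]
      simp
  induction S, hS using MeasurableSpace.induction_on_inter
    (generateFrom_eq_prod hreal (generateFrom_eq_prod hreal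
      (MeasurableSpace.generateFrom_measurableSet (α := Ω)) isCountablySpanning_range_Iic
      isCountablySpanning_measurableSet) isCountablySpanning_range_Iic
      (isCountablySpanning_range_Iic.prod isCountablySpanning_measurableSet)).symm
    (isPiSystem_Iic.prod (isPiSystem_Iic.prod MeasurableSpace.isPiSystem_measurableSet)) with
  | empty => simpa using hzero
  | basic S hS =>
    obtain ⟨_, ⟨y, rfl⟩, _, ⟨_, ⟨x, rfl⟩, A, hA, rfl⟩, rfl⟩ := hS
    exact adaptedProjectionApprox_box hB_meas hB x y hA
  | compl S hS ih =>
    have := hone.add hB_meas hB (memLp_const 1) ((memLp_indicator_one hS).const_mul (-1))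
      (ih.const_mul (-1))
    convert this using 1
    ext p
    by_cases h : p ∈ S <;> simp [h]
  | iUnion f hd hf ih =>
    refine AdaptedProjectionApprox.of_approx (measurable_const.indicator (MeasurableSet.iUnion hf))
      (memLp_indicator_one (MeasurableSet.iUnion hf)) fun ε hε => ?_
    have hacc (n : ℕ) : MeasurableSet (Set.accumulate f n) :=
      MeasurableSet.biUnion (Set.to_countable _) fun i _ => hf i
    have hQ (n : ℕ) : AdaptedProjectionApprox B P
        ((Set.accumulate f n).indicator fun _ => (1 : ℝ)) := by
      induction n with
      | zero => simpa using ih 0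
      | succ n hn =>
        have := hn.add hB_meas hB (memLp_indicator_one (hacc n)) (memLp_indicator_one (hf (n + 1)))
          (ih (n + 1))
        convert this using 1
        rw [Set.accumulate_succ]
        refine Set.indicator_union_of_disjoint ?_ _
        rw [Set.accumulate, Set.disjoint_iUnion₂_left]
        intro i hi
        exact hd (by simp only [le_iff_lt_or_eq] at hi; omega)
    have hlim : Tendsto (fun n => timesMeasure P ((⋃ i, f i) \ Set.accumulate f n)) atTop
        (𝓝 0) := by
      have h1 := tendsto_measure_iUnion_accumulate (μ := timesMeasure P) (f := f)
      have h2 := ENNReal.Tendsto.sub (tendsto_const_nhds (x := timesMeasure P (⋃ i, f i))) h1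
        (by simp)
      rw [tsub_self] at h2
      refine h2.congr fun n => ?_
      rw [measure_sdiff (Set.accumulate_subset_iUnion n) (hacc n).nullMeasurableSet
        (measure_ne_top _ _)]
    obtain ⟨n, hn⟩ := (hlim.eventually_le_const (pos_iff_ne_zero.2 hε)).exists
    refine ⟨_, hQ n, measurable_const.indicator (hacc n), memLp_indicator_one (hacc n), ?_⟩
    refine le_trans (le_of_eq ?_) hn
    rw [eLpNorm_two_sq, ← lintegral_indicator_one ((MeasurableSet.iUnion hf).diff (hacc n))]
    refine lintegral_congr fun p => ?_
    have hsub := Set.accumulate_subset_iUnion (s := f) n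
    by_cases h1 : p ∈ Set.accumulate f n
    · simp [Set.indicator, h1, hsub h1]
    · by_cases h2 : p ∈ ⋃ i, f i <;> simp [Set.indicator, h1, h2]

/-- Every square-integrable adapted two-parameter process has an iterated Itô integral. -/
theorem exists_isIteratedItoIntegral (hB_meas : ∀ t, Measurable (B t))
    (hB : IsPreBrownianReal B P) {v : ℝ → ℝ → Ω → ℝ}
    (hv : MemLp (lowerTri v) 2 (timesMeasure P))
    (hadap : ∀ s t : ℝ, 0 ≤ s → s ≤ t → t ≤ 1 →
      AEStronglyMeasurable[natSigma B s.toNNReal] (v s t) P) :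
    ∃ J, IsIteratedItoIntegral B P v J := by
  refine exists_isIteratedItoIntegral_of_projectionApprox hB_meas hB hv hadap fun ε hε => ?_
  obtain ⟨δ, hδ, hδε⟩ : ∃ δ : ℝ≥0∞, δ ≠ 0 ∧ δ ^ 2 ≤ ε := by
    refine ⟨min ε 1, by simp [hε], ?_⟩
    rw [sq]
    exact (mul_le_of_le_one_right' (min_le_right _ _)).trans (min_le_left _ _)
  obtain ⟨g, hg, hQ, hm⟩ := MemLp.induction_dense (p := 2) (μ := timesMeasure P) (by simp)
    (fun w => AdaptedProjectionApprox B P w ∧ MemLp w 2 (timesMeasure P))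
    (fun c S hS _ ε hε => ⟨S.indicator fun _ => c, by simp, by
        have h1 := (adaptedProjectionApprox_indicator hB_meas hB hS).const_mul c
        convert h1 using 1
        ext p
        by_cases h : p ∈ S <;> simp [h], memLp_indicator_const 2 hS c (Or.inr (by simp))⟩)
    (fun f g hf hg => ⟨hf.1.add hB_meas hB hf.2 hg.2 hg.1, hf.2.add hg.2⟩)
    (fun f hf => hf.2.1) hv hδ
  exact ⟨g, hQ, hm, (pow_le_pow_left' hg 2).trans hδε⟩

end Existence

/-! ### Wiener integrals of step functions -/

/-- A sum of products over the strict lower triangle in terms of the square of the sum. -/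
lemma sum_gridPairs_mul (N : ℕ) (x : ℕ → ℝ) :
    ∑ p ∈ gridPairs N, x p.1 * x p.2 =
      1 / 2 * ((∑ k ∈ Finset.range N, x k) ^ 2 - ∑ k ∈ Finset.range N, x k ^ 2) := by
  have key : (∑ k ∈ Finset.range N, x k) ^ 2 =
      2 * ∑ p ∈ gridPairs N, x p.1 * x p.2 + ∑ k ∈ Finset.range N, x k ^ 2 := by
    have hsucc (n : ℕ) : gridPairs (n + 1) = gridPairs n ∪ (Finset.range n).image (fun k => (k, n)) := by
      ext ⟨i, j⟩
      simp only [gridPairs, Finset.mem_filter, Finset.mem_product, Finset.mem_range,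
        Finset.mem_union, Finset.mem_image, Prod.mk.injEq]
      constructor
      · rintro ⟨⟨h1, h2⟩, h3⟩
        by_cases hj : j < n
        · exact Or.inl ⟨⟨by omega, hj⟩, h3⟩
        · exact Or.inr ⟨i, by omega, rfl, by omega⟩
      · rintro (⟨⟨h1, h2⟩, h3⟩ | ⟨a, h1, rfl, rfl⟩)
        · exact ⟨⟨by omega, by omega⟩, h3⟩
        · exact ⟨⟨by omega, by omega⟩, h1⟩
    induction N with
    | zero => simp [gridPairs]
    | succ n ih =>
      have hdisj : Disjoint (gridPairs n) ((Finset.range n).image (fun k => (k, n))) := by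
        rw [Finset.disjoint_left]
        rintro ⟨i, j⟩ h1 h2
        simp only [gridPairs, Finset.mem_filter, Finset.mem_product, Finset.mem_range] at h1
        simp only [Finset.mem_image, Prod.mk.injEq] at h2
        obtain ⟨a, -, -, rfl⟩ := h2
        omega
      rw [hsucc, Finset.sum_union hdisj, Finset.sum_image (by simp), Finset.sum_range_succ,
        Finset.sum_range_succ, add_sq, ih]
      have : ∑ k ∈ Finset.range n, x (k, n).1 * x (k, n).2 =
        (∑ k ∈ Finset.range n, x k) * x n := by
        simp only [Finset.sum_mul]
      rw [this]
      ring
  rw [key]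
  ring

lemma memLp_two_sq_of_memLp_four {α : Type*} {m : MeasurableSpace α} {μ : Measure α} {f : α → ℝ}
    (hf : MemLp f 4 μ) : MemLp (fun x => f x ^ 2) 2 μ := by
  have h := hf.norm_rpow_div (2 : ℝ≥0∞)
  have h42 : (4 : ℝ≥0∞) / 2 = 2 := by
    rw [show (4 : ℝ≥0∞) = 2 * 2 by norm_num, ENNReal.mul_div_cancel_right (by simp) (by simp)]
  rw [h42] at h
  exact h.ae_eq (ae_of_all _ fun x => by simp)

section GridSums

variable {Ω : Type*} [mΩ : MeasurableSpace Ω] {P : Measure Ω} [IsProbabilityMeasure P]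
  {B : ℝ≥0 → Ω → ℝ}

/-- The Brownian increment over the `k`-th grid cell. -/
noncomputable def gridInc (B : ℝ≥0 → Ω → ℝ) (N k : ℕ) (ω : Ω) : ℝ :=
  B (((k + 1 : ℕ) : ℝ≥0) / N) ω - B ((k : ℝ≥0) / N) ω

/-- The Wiener integral `∑ c_k (B_{(k+1)/N} - B_{k/N})` of a step function on the grid. -/
noncomputable def gridSum (B : ℝ≥0 → Ω → ℝ) (N : ℕ) (c : ℕ → ℝ) (ω : Ω) : ℝ :=
  ∑ k ∈ Finset.range N, c k * gridInc B N k ω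

lemma grid_le (N : ℕ) {k l : ℕ} (h : k ≤ l) : (k : ℝ≥0) / N ≤ (l : ℝ≥0) / N := by
  gcongr

lemma grid_le_one {N k : ℕ} (h : k ≤ N) : (k : ℝ≥0) / N ≤ 1 := by
  rcases Nat.eq_zero_or_pos N with rfl | hN
  · simp
  · rw [div_le_one (by exact_mod_cast hN)]
    exact_mod_cast h

lemma gridInc_measurable_shiftSigma {N k : ℕ} {c : ℝ≥0} (h : c ≤ (k : ℝ≥0) / N) :
    Measurable[shiftSigma B c] (gridInc B N k) :=
  measurable_shiftSigma h (h.trans (grid_le N (Nat.le_succ k)))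

lemma gridInc_measurable_natSigma {N k : ℕ} {c : ℝ≥0} (h : ((k + 1 : ℕ) : ℝ≥0) / N ≤ c) :
    Measurable[natSigma B c] (gridInc B N k) :=
  (measurable_natSigma h).sub (measurable_natSigma ((grid_le N (Nat.le_succ k)).trans h))

lemma memLp_gridInc (hB : IsPreBrownianReal B P) (N k : ℕ) {p : ℝ≥0∞} (hp : p ≠ ∞) :
    MemLp (gridInc B N k) p P :=
  memLp_increment hB _ _ hp

lemma gridInc_hasLaw (hB : IsPreBrownianReal B P) {N : ℕ} (k : ℕ) :
    HasLaw (gridInc B N k) (gaussianReal 0 (N : ℝ≥0)⁻¹) P := by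
  have h := hB.hasLaw_sub (((k + 1 : ℕ) : ℝ≥0) / N) ((k : ℝ≥0) / N)
  have e : nndist ((((k + 1 : ℕ) : ℝ≥0) / N : ℝ≥0) : ℝ) (((k : ℝ≥0) / N : ℝ≥0) : ℝ) =
      (N : ℝ≥0)⁻¹ := by
    ext
    rw [coe_nndist, Real.dist_eq]
    push_cast
    rw [← sub_div, add_sub_cancel_left, abs_of_nonneg (by positivity), one_div]
  exact e ▸ h

lemma integral_gridInc_mul (hB_meas : ∀ t, Measurable (B t)) (hB : IsPreBrownianReal B P)
    {N : ℕ} (k l : ℕ) :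
    ∫ ω, gridInc B N k ω * gridInc B N l ω ∂P = if k = l then (N : ℝ)⁻¹ else 0 := by
  have h0 (i : ℕ) : ∫ ω, gridInc B N i ω ∂P = 0 := integral_increment hB _ _
  have hlt (i j : ℕ) (h : i < j) : ∫ ω, gridInc B N i ω * gridInc B N j ω ∂P = 0 := by
    rw [integral_mul_eq_of_natSigma_of_shiftSigma hB_meas hB (c := (j : ℝ≥0) / N)
      (gridInc_measurable_natSigma (grid_le N h)).stronglyMeasurable.aestronglyMeasurable
      (gridInc_measurable_shiftSigma le_rfl), h0, h0, mul_zero]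
  rcases lt_trichotomy k l with h | h | h
  · rw [hlt k l h, if_neg h.ne]
  · subst h
    rw [if_pos rfl]
    have := integral_increment_mul hB (grid_le N (Nat.le_succ k)) (grid_le N (Nat.le_succ k))
    refine Eq.trans this ?_
    rw [min_self]
    push_cast
    rw [← sub_div, add_sub_cancel_left, one_div]
  · simp_rw [mul_comm (gridInc B N k _)]
    rw [hlt l k h, if_neg h.ne']

lemma memLp_gridSum (hB : IsPreBrownianReal B P) (N : ℕ) (c : ℕ → ℝ) {p : ℝ≥0∞} (hp : p ≠ ∞) :
    MemLp (gridSum B N c) p P :=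
  memLp_finsetSum _ fun k _ => (memLp_gridInc hB N k hp).const_mul (c k)

lemma integral_gridSum_sq (hB_meas : ∀ t, Measurable (B t)) (hB : IsPreBrownianReal B P)
    (N : ℕ) (c : ℕ → ℝ) :
    ∫ ω, gridSum B N c ω ^ 2 ∂P = ∑ k ∈ Finset.range N, c k ^ 2 * (N : ℝ)⁻¹ := by
  have hi (k l : ℕ) : Integrable (fun ω => c k * gridInc B N k ω * (c l * gridInc B N l ω)) P :=
    ((memLp_gridInc hB N k (p := 2) (by simp)).const_mul (c k)).integrable_mul
      ((memLp_gridInc hB N l (p := 2) (by simp)).const_mul (c l))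
  simp_rw [gridSum, sq, Finset.sum_mul_sum]
  rw [integral_finsetSum _ fun i _ => integrable_finsetSum _ fun j _ => hi i j]
  refine Finset.sum_congr rfl fun k hk => ?_
  rw [integral_finsetSum _ fun j _ => hi k j]
  have : ∀ l, ∫ ω, c k * gridInc B N k ω * (c l * gridInc B N l ω) ∂P =
      if k = l then c k * c k * (N : ℝ)⁻¹ else 0 := fun l => by
    have e : ∀ ω, c k * gridInc B N k ω * (c l * gridInc B N l ω) =
      c k * c l * (gridInc B N k ω * gridInc B N l ω) := fun ω => by ring
    simp_rw [e]
    rw [integral_const_mul, integral_gridInc_mul hB_meas hB]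
    split_ifs with h
    · rw [h]
    · simp
  simp_rw [this]
  rw [Finset.sum_ite_eq, if_pos hk]

lemma gridSum_measurable_shiftSigma {N : ℕ} {c : ℕ → ℝ} {δ : ℝ≥0}
    (h : ∀ k : ℕ, (k : ℝ≥0) / N < δ → c k = 0) :
    Measurable[shiftSigma B δ] (gridSum B N c) := by
  refine Finset.measurable_sum _ fun k _ => ?_
  rcases lt_or_ge ((k : ℝ≥0) / N) δ with hk | hk
  · simp only [h k hk, zero_mul]
    exact measurable_const
  · exact (gridInc_measurable_shiftSigma hk).const_mul _

lemma gridSum_measurable_natSigma (N : ℕ) (c : ℕ → ℝ) :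
    Measurable[natSigma B 1] (gridSum B N c) := by
  refine Finset.measurable_sum _ fun k hk => ?_
  exact (gridInc_measurable_natSigma (grid_le_one (by
    have := Finset.mem_range.1 hk
    omega))).const_mul _

lemma gridSum_map_eq (hB_meas : ∀ t, Measurable (B t)) (hB : IsPreBrownianReal B P)
    (N : ℕ) (c : ℕ → ℝ) :
    P.map (gridSum B N c) =
      gaussianReal 0 (∑ k ∈ Finset.range N, c k ^ 2 * (N : ℝ)⁻¹).toNNReal := by
  have h1 := hB.isGaussianProcess.hasGaussianLaw_increments (n := N)
    (t := fun i : Fin (N + 1) => ((i : ℕ) : ℝ≥0) / N)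
  let Λ : (Fin N → ℝ) →L[ℝ] ℝ := ∑ i : Fin N, c (i : ℕ) • ContinuousLinearMap.proj i
  have h2 := h1.map_fun Λ
  have e : (fun ω => Λ fun i : Fin N => B (((i.succ : ℕ) : ℝ≥0) / N) ω - B (((i.castSucc : ℕ) : ℝ≥0) / N) ω)
      = gridSum B N c := by
    ext ω
    simp only [Λ, gridSum, Finset.sum_range, gridInc]
    simp
  have h3 : HasGaussianLaw (gridSum B N c) P := by
    rw [← e]
    exact h2
  have hmean : ∫ ω, gridSum B N c ω ∂P = 0 := by
    simp_rw [gridSum]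
    rw [integral_finsetSum _ fun (k : ℕ) _ => ((memLp_gridInc hB N k (p := 1)
      (by simp)).const_mul (c k)).integrable le_rfl]
    refine Finset.sum_eq_zero fun k _ => ?_
    rw [integral_const_mul]
    refine mul_eq_zero_of_right _ (integral_increment hB _ _)
  rw [h3.map_eq_gaussianReal, hmean, variance_of_integral_eq_zero h3.aemeasurable hmean,
    integral_gridSum_sq hB_meas hB]

lemma gridSum_sub (N : ℕ) (c d : ℕ → ℝ) (ω : Ω) :
    gridSum B N (fun k => c k - d k) ω = gridSum B N c ω - gridSum B N d ω := by
  simp [gridSum, sub_mul, Finset.sum_sub_distrib]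

lemma integral_sq_sub_one_sq_gaussianReal_scale (v : ℝ≥0) :
    ∫ x, (x ^ 2 - v) ^ 2 ∂(gaussianReal 0 v) =
      (v : ℝ) ^ 2 * ∫ z, (z ^ 2 - 1) ^ 2 ∂(gaussianReal 0 1) := by
  have h := gaussianReal_map_const_mul (μ := 0) (v := 1) (√(v : ℝ))
  have e : NNReal.mk (√(v : ℝ) ^ 2) (sq_nonneg _) * 1 = v := by
    ext
    simp
  rw [e, mul_zero] at h
  rw [← h, integral_map (by fun_prop) (Measurable.aestronglyMeasurable (by fun_prop)),
    ← integral_const_mul]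
  refine integral_congr_ae (ae_of_all _ fun z => ?_)
  simp only
  rw [mul_pow, Real.sq_sqrt (NNReal.coe_nonneg v)]
  ring

lemma integral_diag_sq (hB_meas : ∀ t, Measurable (B t)) (hB : IsPreBrownianReal B P)
    (N : ℕ) (d : ℕ → ℝ) :
    ∫ ω, (∑ k ∈ Finset.range N, d k * (gridInc B N k ω ^ 2 - (N : ℝ)⁻¹)) ^ 2 ∂P =
      (∑ k ∈ Finset.range N, d k ^ 2 * ((N : ℝ)⁻¹) ^ 2) *
        ∫ z, (z ^ 2 - 1) ^ 2 ∂(gaussianReal 0 1) := by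
  set W : ℕ → Ω → ℝ := fun k ω => gridInc B N k ω ^ 2 - (N : ℝ)⁻¹ with hW
  have hW2 (k : ℕ) : MemLp (W k) 2 P :=
    (memLp_two_sq_of_memLp_four (memLp_gridInc hB N k (by simp))).sub (memLp_const _)
  have hi (k l : ℕ) : Integrable (fun ω => d k * W k ω * (d l * W l ω)) P :=
    ((hW2 k).const_mul (d k)).integrable_mul ((hW2 l).const_mul (d l))
  have h0 (k : ℕ) : ∫ ω, W k ω ∂P = 0 := by
    have h1 := integral_gridInc_mul hB_meas hB (N := N) k k
    simp only [if_true, ← sq] at h1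
    rw [hW]
    simp only
    rw [integral_sub (memLp_gridInc hB N k (p := 2) (by simp)).integrable_sq (integrable_const _),
      h1]
    simp
  have hsq (k : ℕ) : ∫ ω, W k ω * W k ω ∂P =
      ((N : ℝ)⁻¹) ^ 2 * ∫ z, (z ^ 2 - 1) ^ 2 ∂(gaussianReal 0 1) := by
    have h1 := (gridInc_hasLaw hB (N := N) k).integral_comp
      (f := fun x : ℝ => (x ^ 2 - (N : ℝ)⁻¹) ^ 2) (Measurable.aestronglyMeasurable (by fun_prop))
    have h2 := integral_sq_sub_one_sq_gaussianReal_scale (N : ℝ≥0)⁻¹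
    push_cast at h2
    rw [← h2, ← h1]
    refine integral_congr_ae (ae_of_all _ fun ω => ?_)
    simp [hW, sq]
  have hlt (i j : ℕ) (h : i < j) : ∫ ω, W i ω * W j ω ∂P = 0 := by
    have m1 : Measurable[natSigma B ((j : ℝ≥0) / N)] (W i) :=
      ((gridInc_measurable_natSigma (grid_le N h)).pow_const 2).sub measurable_const
    have m2 : Measurable[shiftSigma B ((j : ℝ≥0) / N)] (W j) :=
      ((gridInc_measurable_shiftSigma le_rfl).pow_const 2).sub measurable_const
    rw [integral_mul_eq_of_natSigma_of_shiftSigma hB_meas hB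
      m1.stronglyMeasurable.aestronglyMeasurable m2, h0, h0, mul_zero]
  have hkl (k l : ℕ) : ∫ ω, d k * W k ω * (d l * W l ω) ∂P = if k = l then
      d k ^ 2 * ((N : ℝ)⁻¹) ^ 2 * ∫ z, (z ^ 2 - 1) ^ 2 ∂(gaussianReal 0 1) else 0 := by
    have e : ∀ ω, d k * W k ω * (d l * W l ω) = d k * d l * (W k ω * W l ω) := fun ω => by ring
    simp_rw [e]
    rw [integral_const_mul]
    rcases lt_trichotomy k l with h | h | h
    · rw [hlt k l h, if_neg h.ne, mul_zero]
    · subst h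
      rw [if_pos rfl, hsq]
      ring
    · simp_rw [mul_comm (W k _)]
      rw [hlt l k h, if_neg h.ne', mul_zero]
  simp_rw [sq (∑ k ∈ Finset.range N, _), Finset.sum_mul_sum]
  rw [integral_finsetSum _ fun i _ => integrable_finsetSum _ fun j _ => hi i j, Finset.sum_mul]
  refine Finset.sum_congr rfl fun k hk => ?_
  rw [integral_finsetSum _ fun j _ => hi k j]
  refine Eq.trans (Finset.sum_congr rfl fun l _ => hkl k l) ?_
  rw [Finset.sum_ite_eq, if_pos hk]

end GridSums

/-! ### Mixing of the Wiener integrals -/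

/-- An `L¹` bound, by Cauchy–Schwarz, for the increments of a function whose local Lipschitz
constant grows linearly. -/
lemma integral_abs_comp_sub_le {Ω : Type*} [MeasurableSpace Ω] {P : Measure Ω}
    [IsProbabilityMeasure P] {f : ℝ → ℝ} {K : ℝ}
    (hf : ∀ a b, |f a - f b| ≤ K * (|a - b| * (|a| + |b|))) (hK : 0 ≤ K)
    {X X' : Ω → ℝ} (hX : MemLp X 2 P) (hX' : MemLp X' 2 P) :
    ∫ ω, |f (X ω) - f (X' ω)| ∂P ≤
      K * (√(∫ ω, (X ω - X' ω) ^ 2 ∂P) * √(∫ ω, (|X ω| + |X' ω|) ^ 2 ∂P)) := by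
  have hs : MemLp (fun ω => |X ω| + |X' ω|) 2 P := hX.norm.add hX'.norm
  have hd : MemLp (fun ω => |X ω - X' ω|) 2 P := (hX.sub hX').norm
  have h1 : ∫ ω, |f (X ω) - f (X' ω)| ∂P ≤ ∫ ω, K * (|X ω - X' ω| * (|X ω| + |X' ω|)) ∂P :=
    integral_mono_of_nonneg (ae_of_all _ fun _ => abs_nonneg _) ((hd.integrable_mul hs).const_mul K)
      (ae_of_all _ fun ω => hf _ _)
  refine h1.trans ?_
  rw [integral_const_mul]
  refine mul_le_mul_of_nonneg_left ?_ hK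
  have h2 := integral_mul_le_Lp_mul_Lq_of_nonneg (μ := P) (p := 2) (q := 2)
    (f := fun ω => |X ω - X' ω|) (g := fun ω => |X ω| + |X' ω|) Real.HolderConjugate.two_two
    (ae_of_all _ fun _ => abs_nonneg _) (ae_of_all _ fun _ => by positivity)
    (by simpa using hd) (by simpa using hs)
  simpa [Real.sqrt_eq_rpow, sq_abs] using h2

/-- For functions whose local Lipschitz constant grows linearly, Gaussian means are Lipschitz in the
variance. -/
lemma abs_integral_gaussianReal_sub_le {f : ℝ → ℝ} {K : ℝ} (hfm : Measurable f)
    (hf1 : ∀ x, |f x| ≤ 1) (hf : ∀ a b, |f a - f b| ≤ K * (|a - b| * (|a| + |b|))) (v w : ℝ≥0) :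
    |∫ x, f x ∂(gaussianReal 0 v) - ∫ x, f x ∂(gaussianReal 0 w)| ≤ K * |(v : ℝ) - w| := by
  have hscale (v : ℝ≥0) : ∫ x, f x ∂(gaussianReal 0 v) =
      ∫ z, f (√(v : ℝ) * z) ∂(gaussianReal 0 1) := by
    have h := gaussianReal_map_const_mul (μ := 0) (v := 1) (√(v : ℝ))
    have e : NNReal.mk (√(v : ℝ) ^ 2) (sq_nonneg _) * 1 = v := by
      ext
      simp
    rw [e, mul_zero] at h
    rw [← h, integral_map (by fun_prop) hfm.aestronglyMeasurable]
  have hint (v : ℝ≥0) : Integrable (fun z => f (√(v : ℝ) * z)) (gaussianReal 0 1) :=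
    Integrable.of_bound (hfm.comp (measurable_const.mul measurable_id)).aestronglyMeasurable 1
      (ae_of_all _ fun z => hf1 _)
  have hz2 : ∫ z : ℝ, z ^ 2 ∂(gaussianReal 0 1) = 1 := by
    have h1 := variance_id_gaussianReal (μ := 0) (v := 1)
    rw [variance_of_integral_eq_zero aemeasurable_id (by simp)] at h1
    simpa using h1
  have hzi : Integrable (fun z : ℝ => z ^ 2) (gaussianReal 0 1) :=
    (memLp_id_gaussianReal 2).integrable_sq
  rw [hscale, hscale, ← integral_sub (hint v) (hint w)]
  calc |∫ z, (f (√(v : ℝ) * z) - f (√(w : ℝ) * z)) ∂(gaussianReal 0 1)|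
      ≤ ∫ z, K * |(v : ℝ) - w| * z ^ 2 ∂(gaussianReal 0 1) := by
        refine norm_integral_le_of_norm_le (f := fun z => f (√(v : ℝ) * z) - f (√(w : ℝ) * z))
          (hzi.const_mul _) (ae_of_all _ fun z => ?_)
        refine (hf _ _).trans (le_of_eq ?_)
        have e : |√(v : ℝ) * z - √(w : ℝ) * z| * (|√(v : ℝ) * z| + |√(w : ℝ) * z|) =
            |(v : ℝ) - w| * z ^ 2 := by
          rw [abs_mul, abs_mul, abs_of_nonneg (Real.sqrt_nonneg _),
            abs_of_nonneg (Real.sqrt_nonneg _), ← sub_mul, ← add_mul, abs_mul]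
          have : |(v : ℝ) - w| = |√(v : ℝ) - √(w : ℝ)| * (√(v : ℝ) + √(w : ℝ)) := by
            nth_rw 1 [← abs_of_nonneg
              (add_nonneg (Real.sqrt_nonneg (v : ℝ)) (Real.sqrt_nonneg (w : ℝ)))]
            rw [← abs_mul]
            congr 1
            have h1 := Real.sq_sqrt (NNReal.coe_nonneg v)
            have h2 := Real.sq_sqrt (NNReal.coe_nonneg w)
            linear_combination h2 - h1
          rw [this, ← sq_abs z]
          ring
        rw [e, mul_assoc]
    _ = K * |(v : ℝ) - w| := by rw [integral_const_mul, hz2, mul_one]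

section Mixing

variable {Ω : Type*} [mΩ : MeasurableSpace Ω] {P : Measure Ω} [IsProbabilityMeasure P]
  {B : ℝ≥0 → Ω → ℝ}

/-- The coefficients on the grid cells that start before time `δ`, the others replaced by `0`. -/
noncomputable def headCoeff (N : ℕ) (δ : ℝ≥0) (c : ℕ → ℝ) (k : ℕ) : ℝ :=
  if (k : ℝ≥0) / N < δ then c k else 0

/-- The coefficients on the grid cells that start at or after time `δ`, the others replaced
by `0`. -/
noncomputable def tailCoeff (N : ℕ) (δ : ℝ≥0) (c : ℕ → ℝ) (k : ℕ) : ℝ :=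
  if (k : ℝ≥0) / N < δ then 0 else c k

lemma sub_tailCoeff (N : ℕ) (δ : ℝ≥0) (c : ℕ → ℝ) (k : ℕ) :
    c k - tailCoeff N δ c k = headCoeff N δ c k := by
  unfold tailCoeff headCoeff
  split_ifs <;> simp

lemma sum_tailCoeff_sq (N : ℕ) (δ : ℝ≥0) (c : ℕ → ℝ) :
    ∑ k ∈ Finset.range N, tailCoeff N δ c k ^ 2 * (N : ℝ)⁻¹ =
      ∑ k ∈ Finset.range N, c k ^ 2 * (N : ℝ)⁻¹ -
        ∑ k ∈ Finset.range N, headCoeff N δ c k ^ 2 * (N : ℝ)⁻¹ := by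
  rw [← Finset.sum_sub_distrib]
  refine Finset.sum_congr rfl fun k _ => ?_
  unfold tailCoeff headCoeff
  split_ifs <;> simp

/-- By path continuity `B_1` is a limit of values strictly before time `1`, hence measurable, up to
a null set, with respect to the σ-algebra these generate. -/
lemma aestronglyMeasurable_iSup_natSigma (hB : IsBrownianReal B P)
    {N k : ℕ} (hk : k ≤ N) {δ : ℕ → ℝ≥0} (hδ : ∀ j, δ j < 1) (hlim : Tendsto δ atTop (𝓝 1)) :
    AEStronglyMeasurable[⨆ j, natSigma B (δ j)] (B ((k : ℝ≥0) / N)) P := by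
  have hsub (t : ℝ≥0) (ht : t < 1) : StronglyMeasurable[⨆ j, natSigma B (δ j)] (B t) := by
    obtain ⟨j, hj⟩ := (hlim.eventually (lt_mem_nhds ht)).exists
    have h1 : Measurable[natSigma B (δ j)] (B t) := measurable_natSigma hj.le
    exact (h1.mono (le_iSup (fun j => natSigma B (δ j)) j) le_rfl).stronglyMeasurable
  rcases (grid_le_one hk).lt_or_eq with h | h
  · exact (hsub _ h).aestronglyMeasurable
  rw [h]
  refine ⟨fun ω => limUnder atTop fun j => B (δ j) ω,
    @StronglyMeasurable.limUnder _ _ _ (⨆ j, natSigma B (δ j)) _ _ _ _ _ _ _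
      fun j => hsub _ (hδ j), ?_⟩
  filter_upwards [hB.cont] with ω hω
  exact (((hω.tendsto 1).comp hlim).limUnder_eq).symm

/-- The independence step: a function of grid sums asymptotically decouples from the past of any
time `δ < 1`, because only the increments after `δ` contribute in the limit. -/
lemma tendsto_integral_mul_comp_gridSum_of_natSigma (hB_meas : ∀ t, Measurable (B t))
    (hB : IsPreBrownianReal B P) {N : ℕ → ℕ} {c : ℕ → ℕ → ℝ} {L : ℝ≥0}
    (hL : Tendsto (fun n => ∑ k ∈ Finset.range (N n), c n k ^ 2 * (N n : ℝ)⁻¹) atTop (𝓝 L))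
    {δ : ℝ≥0} (hδ : Tendsto (fun n => ∑ k ∈ Finset.range (N n),
      headCoeff (N n) δ (c n) k ^ 2 * (N n : ℝ)⁻¹) atTop (𝓝 0))
    {f : ℝ → ℝ} {K : ℝ} (hK : 0 ≤ K) (hfm : Measurable f)
    (hf1 : ∀ x, |f x| ≤ 1) (hf : ∀ a b, |f a - f b| ≤ K * (|a - b| * (|a| + |b|)))
    {Y : Ω → ℝ} (hY : AEStronglyMeasurable[natSigma B δ] Y P) {C : ℝ} (hYC : ∀ᵐ ω ∂P, |Y ω| ≤ C) :
    Tendsto (fun n => ∫ ω, Y ω * f (gridSum B (N n) (c n) ω) ∂P) atTop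
      (𝓝 ((∫ ω, Y ω ∂P) * ∫ x, f x ∂(gaussianReal 0 L))) := by
  set G : ℕ → Ω → ℝ := fun n => gridSum B (N n) (c n) with hG
  set T : ℕ → Ω → ℝ := fun n => gridSum B (N n) (tailCoeff (N n) δ (c n)) with hT
  have hG2 (n : ℕ) : MemLp (G n) 2 P := memLp_gridSum hB _ _ (by simp)
  have hT2 (n : ℕ) : MemLp (T n) 2 P := memLp_gridSum hB _ _ (by simp)
  have hYm : AEStronglyMeasurable Y P := hY.mono (natSigma_le hB_meas δ)
  have hC : 0 ≤ C := by
    obtain ⟨ω, hω⟩ := hYC.exists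
    exact (abs_nonneg _).trans hω
  have hGs (n : ℕ) : ∫ ω, G n ω ^ 2 ∂P = ∑ k ∈ Finset.range (N n), c n k ^ 2 * (N n : ℝ)⁻¹ :=
    integral_gridSum_sq hB_meas hB _ _
  have hTs (n : ℕ) : ∫ ω, T n ω ^ 2 ∂P =
      ∑ k ∈ Finset.range (N n), tailCoeff (N n) δ (c n) k ^ 2 * (N n : ℝ)⁻¹ :=
    integral_gridSum_sq hB_meas hB _ _
  have hD (n : ℕ) : ∫ ω, (G n ω - T n ω) ^ 2 ∂P =
      ∑ k ∈ Finset.range (N n), headCoeff (N n) δ (c n) k ^ 2 * (N n : ℝ)⁻¹ := by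
    rw [← integral_gridSum_sq hB_meas hB]
    refine integral_congr_ae (ae_of_all _ fun ω => ?_)
    simp only [hG, hT, ← gridSum_sub, sub_tailCoeff]
  have hTlim : Tendsto (fun n => ∫ ω, T n ω ^ 2 ∂P) atTop (𝓝 L) := by
    simp_rw [hTs, sum_tailCoeff_sq]
    simpa using hL.sub hδ
  have hGlim : Tendsto (fun n => ∫ ω, G n ω ^ 2 ∂P) atTop (𝓝 L) := by
    simp_rw [hGs]
    exact hL
  have hfint (X : Ω → ℝ) (hX : AEStronglyMeasurable X P) : Integrable (fun ω => f (X ω)) P :=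
    Integrable.of_bound (hfm.comp_aemeasurable hX.aemeasurable).aestronglyMeasurable 1
      (ae_of_all _ fun ω => hf1 _)
  have hYf (X : Ω → ℝ) (hX : AEStronglyMeasurable X P) :
      Integrable (fun ω => Y ω * f (X ω)) P :=
    (hfint X hX).bdd_mul hYm hYC
  -- the head of the sum is negligible
  have hdiff : Tendsto (fun n => ∫ ω, Y ω * f (G n ω) ∂P - ∫ ω, Y ω * f (T n ω) ∂P) atTop
      (𝓝 0) := by
    have hbound (n : ℕ) : |∫ ω, Y ω * f (G n ω) ∂P - ∫ ω, Y ω * f (T n ω) ∂P| ≤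
        C * (K * (√(∫ ω, (G n ω - T n ω) ^ 2 ∂P) *
          √(2 * ∫ ω, G n ω ^ 2 ∂P + 2 * ∫ ω, T n ω ^ 2 ∂P))) := by
      rw [← integral_sub (hYf _ (hG2 n).1) (hYf _ (hT2 n).1)]
      calc |∫ ω, (Y ω * f (G n ω) - Y ω * f (T n ω)) ∂P|
          ≤ ∫ ω, C * |f (G n ω) - f (T n ω)| ∂P := by
            refine norm_integral_le_of_norm_le
              (f := fun ω => Y ω * f (G n ω) - Y ω * f (T n ω))
              (((hfint _ (hG2 n).1).sub (hfint _ (hT2 n).1)).abs.const_mul C) ?_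
            filter_upwards [hYC] with ω hω
            rw [← mul_sub, Real.norm_eq_abs, abs_mul]
            exact mul_le_mul_of_nonneg_right hω (abs_nonneg _)
        _ ≤ _ := by
            rw [integral_const_mul]
            refine mul_le_mul_of_nonneg_left ?_ hC
            refine (integral_abs_comp_sub_le hf hK (hG2 n) (hT2 n)).trans ?_
            gcongr
            rw [← integral_const_mul, ← integral_const_mul,
              ← integral_add ((hG2 n).integrable_sq.const_mul 2) ((hT2 n).integrable_sq.const_mul 2)]
            refine integral_mono_of_nonneg (ae_of_all _ fun _ => sq_nonneg _)
              (((hG2 n).integrable_sq.const_mul 2).add ((hT2 n).integrable_sq.const_mul 2))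
              (ae_of_all _ fun ω => ?_)
            nlinarith [sq_abs (G n ω), sq_abs (T n ω), sq_nonneg (|G n ω| - |T n ω|)]
    refine squeeze_zero_norm hbound ?_
    have h1 : Tendsto (fun n => √(∫ ω, (G n ω - T n ω) ^ 2 ∂P)) atTop (𝓝 0) := by
      simp_rw [hD]
      simpa [Function.comp_def] using (Real.continuous_sqrt.tendsto 0).comp hδ
    have h2 := (Real.continuous_sqrt.tendsto _).comp
      ((hGlim.const_mul 2).add (hTlim.const_mul 2))
    simpa using ((h1.mul h2).const_mul K).const_mul C
  -- the tail is independent of `Y`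
  have hind (n : ℕ) : ∫ ω, Y ω * f (T n ω) ∂P =
      (∫ ω, Y ω ∂P) * ∫ x, f x ∂(gaussianReal 0 (∑ k ∈ Finset.range (N n),
        tailCoeff (N n) δ (c n) k ^ 2 * (N n : ℝ)⁻¹).toNNReal) := by
    have hTm : Measurable[shiftSigma B δ] (T n) :=
      gridSum_measurable_shiftSigma fun k hk => if_pos hk
    refine (integral_mul_eq_of_natSigma_of_shiftSigma hB_meas hB hY (hfm.comp hTm)).trans ?_
    rw [← gridSum_map_eq hB_meas hB, integral_map (hT2 n).1.aemeasurable hfm.aestronglyMeasurable]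
    rfl
  have hmain : Tendsto (fun n => ∫ ω, Y ω * f (T n ω) ∂P) atTop
      (𝓝 ((∫ ω, Y ω ∂P) * ∫ x, f x ∂(gaussianReal 0 L))) := by
    simp_rw [hind]
    refine Tendsto.const_mul _ ?_
    rw [tendsto_iff_norm_sub_tendsto_zero]
    refine squeeze_zero (fun n => norm_nonneg _)
      (fun n => abs_integral_gaussianReal_sub_le hfm hf1 hf _ L) ?_
    have h1 : Tendsto (fun n => K * |(∑ k ∈ Finset.range (N n),
        tailCoeff (N n) δ (c n) k ^ 2 * (N n : ℝ)⁻¹) - L|) atTop (𝓝 0) := by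
      simp_rw [← hTs]
      simpa using ((hTlim.sub_const (L : ℝ)).abs).const_mul K
    refine h1.congr fun n => ?_
    rw [Real.coe_toNNReal _ (Finset.sum_nonneg fun k _ => by positivity)]
  simpa using hdiff.add hmain

/-- Mixing convergence of a function of the grid sums: the Gaussian limit is independent of every
bounded random variable. Approximating `Y` by its conditional expectations given the past of times
`δ_j ↑ 1` reduces to the independence step. -/
lemma tendsto_integral_mul_comp_gridSum (hB_meas : ∀ t, Measurable (B t))
    (hB : IsBrownianReal B P) {N : ℕ → ℕ} {c : ℕ → ℕ → ℝ} {L : ℝ≥0}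
    (hL : Tendsto (fun n => ∑ k ∈ Finset.range (N n), c n k ^ 2 * (N n : ℝ)⁻¹) atTop (𝓝 L))
    (hδ : ∀ δ : ℝ≥0, δ < 1 → Tendsto (fun n => ∑ k ∈ Finset.range (N n),
      headCoeff (N n) δ (c n) k ^ 2 * (N n : ℝ)⁻¹) atTop (𝓝 0))
    {f : ℝ → ℝ} {K : ℝ} (hK : 0 ≤ K) (hfm : Measurable f)
    (hf1 : ∀ x, |f x| ≤ 1) (hf : ∀ a b, |f a - f b| ≤ K * (|a - b| * (|a| + |b|)))
    {Y : Ω → ℝ} (hY : AEStronglyMeasurable Y P) {C : ℝ≥0} (hYC : ∀ᵐ ω ∂P, |Y ω| ≤ C) :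
    Tendsto (fun n => ∫ ω, Y ω * f (gridSum B (N n) (c n) ω) ∂P) atTop
      (𝓝 ((∫ ω, Y ω ∂P) * ∫ x, f x ∂(gaussianReal 0 L))) := by
  set δ : ℕ → ℝ≥0 := fun j => 1 - 1 / ((j : ℝ≥0) + 1) with hδ_def
  have hδ1 (j : ℕ) : δ j < 1 := tsub_lt_self one_pos (by positivity)
  have hδmono : Monotone δ := fun i j hij => by
    refine tsub_le_tsub_left (one_div_le_one_div_of_le (by positivity) ?_) 1
    gcongr
  have hδlim : Tendsto δ atTop (𝓝 1) := by
    have h : Tendsto (fun j : ℕ => 1 / ((j : ℝ≥0) + 1)) atTop (𝓝 0) :=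
      tendsto_one_div_add_atTop_nhds_zero_nat
    simpa only [tsub_zero] using (tendsto_const_nhds (x := (1 : ℝ≥0))).sub h
  let 𝒢 : Filtration ℕ mΩ := ⟨fun j => natSigma B (δ j), fun i j hij => natSigma_mono (hδmono hij),
    fun j => natSigma_le hB_meas _⟩
  have hYi : Integrable Y P := Integrable.of_bound hY C hYC
  set G : ℕ → Ω → ℝ := fun n => gridSum B (N n) (c n) with hG
  have h𝒢le : (⨆ j, 𝒢 j) ≤ mΩ := iSup_le fun j => 𝒢.le j
  have hGm (n : ℕ) : AEStronglyMeasurable[⨆ j, 𝒢 j] (fun ω => f (G n ω)) P := by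
    have h1 : AEStronglyMeasurable[⨆ j, 𝒢 j] (G n) P := by
      have h2 (k : ℕ) : ∃ g : Ω → ℝ, StronglyMeasurable[⨆ j, 𝒢 j] g ∧
          (k ≤ N n → B ((k : ℝ≥0) / N n) =ᵐ[P] g) := by
        by_cases hk : k ≤ N n
        · obtain ⟨g, hg, hgk⟩ := aestronglyMeasurable_iSup_natSigma hB hk hδ1 hδlim
          exact ⟨g, hg, fun _ => hgk⟩
        · exact ⟨0, stronglyMeasurable_zero, fun h => absurd h hk⟩
      choose b hbm hb using h2
      refine ⟨fun ω => ∑ k ∈ Finset.range (N n), c n k * (b (k + 1) ω - b k ω),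
        Finset.stronglyMeasurable_fun_sum _ fun k _ => ((hbm _).sub (hbm _)).const_mul _, ?_⟩
      have h3 : ∀ᵐ ω ∂P, ∀ k, k ≤ N n → B ((k : ℝ≥0) / N n) ω = b k ω := by
        rw [ae_all_iff]
        intro k
        by_cases hk : k ≤ N n
        · filter_upwards [hb k hk] with ω hω _
          exact hω
        · exact ae_of_all _ fun ω h => absurd h hk
      filter_upwards [h3] with ω hω
      refine Finset.sum_congr rfl fun k hk => ?_
      have hk' := Finset.mem_range.1 hk
      rw [gridInc, hω _ hk'.le, hω _ hk']
    obtain ⟨g, hg, hgG⟩ := h1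
    exact ⟨fun ω => f (g ω), (hfm.comp hg.measurable).stronglyMeasurable,
      hgG.mono fun ω hω => by simp only [hω]⟩
  have hfG (n : ℕ) : Integrable (fun ω => f (G n ω)) P :=
    Integrable.of_bound ((hGm n).mono h𝒢le) 1 (ae_of_all _ fun ω => hf1 _)
  set Yi : Ω → ℝ := P[Y | ⨆ j, 𝒢 j] with hYi_def
  -- conditioning on the past of time `1` does not change the integral
  have hcond (n : ℕ) : ∫ ω, Y ω * f (G n ω) ∂P = ∫ ω, Yi ω * f (G n ω) ∂P := by
    have hint : Integrable (Y * fun ω => f (G n ω)) P :=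
      hYi.mul_bdd (hfG n).1 (ae_of_all _ fun ω => hf1 _)
    have h1 := condExp_mul_of_aestronglyMeasurable_right (hGm n) hint hYi
    rw [← integral_condExp h𝒢le (f := fun ω => Y ω * f (G n ω))]
    exact integral_congr_ae h1
  have hL1 := tendsto_eLpNorm_condExp (μ := P) (ℱ := 𝒢) Y
  have hL1' : Tendsto (fun j => ∫ ω, |P[Y | 𝒢 j] ω - Yi ω| ∂P) atTop (𝓝 0) := by
    have h := (ENNReal.tendsto_toReal (by simp)).comp hL1
    refine h.congr fun j => ?_
    simp only [Function.comp]
    rw [eLpNorm_one_eq_lintegral_enorm, ← integral_norm_eq_lintegral_enorm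
      (integrable_condExp.sub integrable_condExp).1]
    rfl
  set m : ℝ := ∫ x, f x ∂(gaussianReal 0 L) with hm
  have hj (j : ℕ) : Tendsto (fun n => ∫ ω, P[Y | 𝒢 j] ω * f (G n ω) ∂P) atTop
      (𝓝 ((∫ ω, Y ω ∂P) * m)) := by
    have h := tendsto_integral_mul_comp_gridSum_of_natSigma hB_meas hB.toIsPreBrownianReal hL
      (hδ _ (hδ1 j)) hK hfm hf1 hf (Y := P[Y | 𝒢 j])
      stronglyMeasurable_condExp.aestronglyMeasurable (C := C)
      (ae_bdd_abs_condExp_of_ae_bdd_abs hYC)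
    rwa [integral_condExp (𝒢.le j)] at h
  rw [Metric.tendsto_atTop]
  intro ε hε
  obtain ⟨j, hjε⟩ := (hL1'.eventually (gt_mem_nhds (half_pos hε))).exists
  obtain ⟨n₀, hn₀⟩ := Metric.tendsto_atTop.1 (hj j) (ε / 2) (half_pos hε)
  refine ⟨n₀, fun n hn => ?_⟩
  have h1 : |∫ ω, Yi ω * f (G n ω) ∂P - ∫ ω, P[Y | 𝒢 j] ω * f (G n ω) ∂P| ≤
      ∫ ω, |P[Y | 𝒢 j] ω - Yi ω| ∂P := by
    rw [← integral_sub (integrable_condExp.mul_bdd (hfG n).1 (ae_of_all _ fun ω => hf1 _))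
      (integrable_condExp.mul_bdd (hfG n).1 (ae_of_all _ fun ω => hf1 _))]
    refine norm_integral_le_of_norm_le (f := fun ω => Yi ω * f (G n ω) - P[Y | 𝒢 j] ω * f (G n ω))
      (Integrable.abs (f := fun ω => P[Y | 𝒢 j] ω - Yi ω)
        (integrable_condExp.sub integrable_condExp)) (ae_of_all _ fun ω => ?_)
    rw [← sub_mul, Real.norm_eq_abs, abs_mul, abs_sub_comm (Yi ω)]
    exact mul_le_of_le_one_right (abs_nonneg _) (hf1 _)
  have h2 := hn₀ n hn
  rw [Real.dist_eq] at h2 ⊢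
  rw [hcond]
  calc _ ≤ _ := abs_sub_le _ (∫ ω, P[Y | 𝒢 j] ω * f (G n ω) ∂P) _
    _ < ε / 2 + ε / 2 := add_lt_add (h1.trans_lt hjε) h2
    _ = ε := add_halves ε

end Mixing

/-! ### The stable limit with a simple coefficient -/

section Extension

variable {Ω Ω' : Type*} [mΩ : MeasurableSpace Ω] [mΩ' : MeasurableSpace Ω'] {P : Measure Ω}
  [IsProbabilityMeasure P] {B : ℝ≥0 → Ω → ℝ} {P' : Measure Ω'} {π : Ω' → Ω} {Z : Ω' → ℝ}

/-- On the extension, functions of `Z` are independent of lifted functionals of `B`. -/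
lemma integral_lift_mul_comp (hB_meas : ∀ t, Measurable (B t)) (hπ : MeasurePreserving π P' P)
    (hZ_law : HasLaw Z (gaussianReal 0 1) P')
    (hZ_indep : IndepFun Z (fun ω' t => B t (π ω')) P')
    {Y : Ω → ℝ} (hY : Measurable[brownianSigma B P] Y) {f : ℝ → ℝ} (hf : Measurable f) :
    ∫ ω', Y (π ω') * f (Z ω') ∂P' = (∫ ω, Y ω ∂P) * ∫ z, f z ∂(gaussianReal 0 1) := by
  obtain ⟨g, hg, hYg⟩ := exists_measurable_ae_eq_of_eventuallyMeasurable hY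
  have hgΩ : Measurable g := hg.mono (iSup_le fun r => (hB_meas r).comap_le) le_rfl
  have hind : IndepFun (fun ω' => g (π ω')) (fun ω' => f (Z ω')) P' := by
    rw [IndepFun_iff_Indep] at hZ_indep ⊢
    refine (indep_of_indep_of_le_left (indep_of_indep_of_le_right hZ_indep ?_) ?_).symm
    · rw [← measurable_iff_comap_le]
      have h1 : (⨆ r : ℝ≥0, MeasurableSpace.comap (B r) inferInstance) =
          MeasurableSpace.comap (fun ω t => B t ω) MeasurableSpace.pi := by
        simp_rw [MeasurableSpace.pi, MeasurableSpace.comap_iSup, MeasurableSpace.comap_comp]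
        rfl
      have h2 : MeasurableSpace.comap (fun ω' t => B t (π ω')) MeasurableSpace.pi =
          MeasurableSpace.comap π (⨆ r : ℝ≥0, MeasurableSpace.comap (B r) inferInstance) := by
        rw [h1, MeasurableSpace.comap_comp]
        rfl
      rw [h2]
      exact hg.comp (comap_measurable π)
    · rw [← measurable_iff_comap_le]
      exact hf.comp (comap_measurable Z)
  have h1 : ∫ ω', Y (π ω') * f (Z ω') ∂P' = ∫ ω', g (π ω') * f (Z ω') ∂P' := by
    refine integral_congr_ae ?_
    filter_upwards [hπ.quasiMeasurePreserving.ae hYg] with ω' hω'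
    rw [hω']
  rw [h1, hind.integral_fun_mul_eq_mul_integral
    (hgΩ.comp hπ.measurable).aestronglyMeasurable
    (hf.comp_aemeasurable hZ_law.aemeasurable).aestronglyMeasurable,
    integral_congr_ae hYg, ← hπ.map_eq,
    integral_map hπ.measurable.aemeasurable hgΩ.aestronglyMeasurable, ← hZ_law.map_eq,
    integral_map hZ_law.aemeasurable hf.aestronglyMeasurable]

lemma aestronglyMeasurable_of_brownianSigma (hB_meas : ∀ t, Measurable (B t)) {Y : Ω → ℝ}
    (hY : Measurable[brownianSigma B P] Y) : AEStronglyMeasurable Y P := by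
  obtain ⟨g, hg, hYg⟩ := exists_measurable_ae_eq_of_eventuallyMeasurable hY
  exact ⟨g, (hg.mono (iSup_le fun r => (hB_meas r).comap_le) le_rfl).stronglyMeasurable, hYg⟩

/-- Stable limit of `ξ (G_n² - L)` for grid sums `G_n` and a simple `ξ` that is measurable with
respect to `B`: split along the finitely many values of `ξ` and use mixing on each piece. -/
lemma tendsto_integral_mul_comp_simpleFunc (hB_meas : ∀ t, Measurable (B t))
    (hB : IsBrownianReal B P) {N : ℕ → ℕ} {c : ℕ → ℕ → ℝ} {L : ℝ≥0}
    (hL : Tendsto (fun n => ∑ k ∈ Finset.range (N n), c n k ^ 2 * (N n : ℝ)⁻¹) atTop (𝓝 L))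
    (hδ : ∀ δ : ℝ≥0, δ < 1 → Tendsto (fun n => ∑ k ∈ Finset.range (N n),
      headCoeff (N n) δ (c n) k ^ 2 * (N n : ℝ)⁻¹) atTop (𝓝 0))
    {h : ℝ → ℝ} {K : ℝ} (hK : 0 ≤ K) (hh1 : ∀ x, |h x| ≤ 1) (hh : ∀ a b, |h a - h b| ≤ K * |a - b|)
    (hhm : Measurable h)
    {Y : Ω → ℝ} (hY : Measurable[brownianSigma B P] Y) {C : ℝ≥0} (hYC : ∀ ω, |Y ω| ≤ C)
    (hπ : MeasurePreserving π P' P) (hZ_law : HasLaw Z (gaussianReal 0 1) P')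
    (hZ_indep : IndepFun Z (fun ω' t => B t (π ω')) P')
    {δ : ℝ≥0} (ξ : @SimpleFunc Ω (natSigma B δ) ℝ) :
    Tendsto (fun n => ∫ ω, Y ω * h (ξ ω * (gridSum B (N n) (c n) ω ^ 2 - L)) ∂P) atTop
      (𝓝 (∫ ω', Y (π ω') * h (ξ (π ω') * (L * (Z ω' ^ 2 - 1))) ∂P')) := by
  have : IsProbabilityMeasure P' :=
    ⟨by simpa using hπ.measure_preimage MeasurableSet.univ.nullMeasurableSet⟩
  set S : Finset ℝ := @SimpleFunc.range _ _ (natSigma B δ) ξ with hS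
  have hmem (ω : Ω) : ξ ω ∈ S := @SimpleFunc.mem_range_self _ _ (natSigma B δ) ξ ω
  set Yx : ℝ → Ω → ℝ := fun x ω => (ξ ⁻¹' {x}).indicator Y ω with hYx
  have hset (x : ℝ) : MeasurableSet[natSigma B δ] (ξ ⁻¹' {x}) :=
    @SimpleFunc.measurableSet_fiber _ _ (natSigma B δ) ξ x
  have hset' (x : ℝ) : MeasurableSet[brownianSigma B P] (ξ ⁻¹' {x}) := by
    have hle : natSigma B δ ≤ ⨆ r : ℝ≥0, MeasurableSpace.comap (B r) inferInstance :=
      iSup_le fun r => iSup_le fun _ =>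
        le_iSup (fun r => MeasurableSpace.comap (B r) inferInstance) r
    exact (hle.trans le_eventuallyMeasurableSpace) _ (hset x)
  have hYxm (x : ℝ) : Measurable[brownianSigma B P] (Yx x) := hY.indicator (hset' x)
  have hYxC (x : ℝ) (ω : Ω) : |Yx x ω| ≤ C := by
    by_cases hω : ω ∈ ξ ⁻¹' {x}
    · simpa [hYx, hω] using hYC ω
    · simp [hYx, hω]
  have hsplit (ω : Ω) (y : ℝ) : Y ω * h (ξ ω * y) = ∑ x ∈ S, Yx x ω * h (x * y) := by
    rw [Finset.sum_eq_single_of_mem _ (hmem ω)]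
    · simp [hYx]
    · intro x _ hx
      have : ω ∉ ξ ⁻¹' {x} := fun h' => hx h'.symm
      simp [hYx, this]
  have hint (x : ℝ) (n : ℕ) :
      Integrable (fun ω => Yx x ω * h (x * (gridSum B (N n) (c n) ω ^ 2 - L))) P := by
    refine Integrable.mul_bdd (Integrable.of_bound (aestronglyMeasurable_of_brownianSigma hB_meas (hYxm x)) C
      (ae_of_all _ (hYxC x))) (Measurable.aestronglyMeasurable ?_) (ae_of_all _ fun ω => hh1 _)
    have := (gridSum_measurable_natSigma (B := B) (N n) (c n)).mono (natSigma_le hB_meas 1) le_rfl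
    exact hhm.comp (((this.pow_const 2).sub_const _).const_mul _)
  have hint' (x : ℝ) :
      Integrable (fun ω' => Yx x (π ω') * h (x * (L * (Z ω' ^ 2 - 1)))) P' := by
    refine Integrable.mul_bdd (Integrable.of_bound
      ((aestronglyMeasurable_of_brownianSigma hB_meas (hYxm x)).comp_measurePreserving hπ) C
      (ae_of_all _ fun ω' => hYxC x _)) ?_ (ae_of_all _ fun ω => hh1 _)
    exact (hhm.comp_aemeasurable
      (((hZ_law.aemeasurable.pow_const 2).sub_const _).const_mul _ |>.const_mul _)).aestronglyMeasurable
  simp_rw [hsplit]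
  rw [integral_finsetSum _ fun x _ => hint' x]
  have e (n : ℕ) : ∫ ω, ∑ x ∈ S, Yx x ω * h (x * (gridSum B (N n) (c n) ω ^ 2 - L)) ∂P =
      ∑ x ∈ S, ∫ ω, Yx x ω * h (x * (gridSum B (N n) (c n) ω ^ 2 - L)) ∂P :=
    integral_finsetSum _ fun x _ => hint x n
  simp_rw [e]
  refine tendsto_finsetSum _ fun x _ => ?_
  have hlim := tendsto_integral_mul_comp_gridSum hB_meas hB hL hδ
    (f := fun g => h (x * (g ^ 2 - L))) (K := K * |x|) (by positivity) (by fun_prop)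
    (fun g => hh1 _) (fun a b => by
      refine (hh _ _).trans (le_of_eq_of_le ?_ (mul_le_mul_of_nonneg_left
        (mul_le_mul_of_nonneg_left (abs_add_le a b) (abs_nonneg (a - b))) (by positivity)))
      rw [← abs_mul, mul_assoc, ← abs_mul]
      congr 2
      ring)
    (aestronglyMeasurable_of_brownianSigma hB_meas (hYxm x)) (ae_of_all _ (hYxC x))
  convert hlim using 2
  have h1 := integral_lift_mul_comp hB_meas hπ hZ_law hZ_indep (hYxm x)
    (f := fun z => h (x * (L * (z ^ 2 - 1)))) (by fun_prop)
  rw [h1]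
  congr 1
  have h2 := gaussianReal_map_const_mul (μ := 0) (v := 1) (√(L : ℝ))
  have h3 : NNReal.mk (√(L : ℝ) ^ 2) (sq_nonneg _) * 1 = L := by
    ext
    simp
  rw [h3, mul_zero] at h2
  rw [← h2, integral_map (by fun_prop) (Measurable.aestronglyMeasurable (by fun_prop))]
  refine integral_congr_ae (ae_of_all _ fun z => ?_)
  simp only
  rw [mul_pow, Real.sq_sqrt (NNReal.coe_nonneg L), mul_sub, mul_one]

end Extension

/-! ### Step functions on a grid -/

/-- The step function with value `c k` on the `k`-th grid cell. -/
noncomputable def stepFun (N : ℕ) (c : ℕ → ℝ) (t : ℝ) : ℝ :=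
  ∑ k ∈ Finset.range N, (gridCell N k).indicator (fun _ => (1 : ℝ)) t * c k

lemma measurable_stepFun (N : ℕ) (c : ℕ → ℝ) : Measurable (stepFun N c) :=
  Finset.measurable_fun_sum _ fun k _ =>
    (measurable_const.indicator (measurableSet_gridCell N k)).mul_const _

lemma stepFun_apply {N k : ℕ} {c : ℕ → ℝ} {t : ℝ} (hk : k < N) (ht : t ∈ gridCell N k) :
    stepFun N c t = c k := by
  rw [stepFun, Finset.sum_congr rfl fun i _ =>
    gridCell_indicator_mul (by omega : 0 < N) c ht]
  simp [hk]

lemma lintegral_enorm_stepFun_pow (N : ℕ) (hN : 0 < N) (c : ℕ → ℝ) (m : ℕ) :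
    ∫⁻ t, ‖stepFun N c t‖ₑ ^ m ∂unitTime = ∑ k ∈ Finset.range N, ‖c k‖ₑ ^ m * (N : ℝ≥0∞)⁻¹ := by
  have h : ∫⁻ t, ‖stepFun N c t‖ₑ ^ m ∂unitTime =
      ∫⁻ t, ∑ k ∈ Finset.range N, (gridCell N k).indicator (fun _ => ‖c k‖ₑ ^ m) t ∂unitTime := by
    refine lintegral_congr_ae ?_
    filter_upwards [ae_unitTime_mem_Ioc] with t ht
    obtain ⟨k, hk, htk⟩ := exists_mem_gridCell hN ht
    rw [stepFun_apply hk htk, Finset.sum_eq_single_of_mem k (Finset.mem_range.2 hk)]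
    · simp [htk]
    · intro j _ hj
      exact Set.indicator_of_notMem (fun h => hj (gridCell_unique hN h htk)) _
  rw [h, lintegral_finsetSum _ fun k _ => measurable_const.indicator (measurableSet_gridCell N k)]
  refine Finset.sum_congr rfl fun k hk => ?_
  rw [lintegral_indicator_const (measurableSet_gridCell N k), unitTime_gridCell (Finset.mem_range.1 hk)]

lemma ofReal_sum_pow_mul_inv (N : ℕ) (hN : 0 < N) (c : ℕ → ℝ) :
    ENNReal.ofReal (∑ k ∈ Finset.range N, c k ^ 2 * (N : ℝ)⁻¹) =
      ∑ k ∈ Finset.range N, ‖c k‖ₑ ^ 2 * (N : ℝ≥0∞)⁻¹ := by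
  rw [ENNReal.ofReal_sum_of_nonneg fun k _ => by positivity]
  refine Finset.sum_congr rfl fun k _ => ?_
  rw [ENNReal.ofReal_mul (sq_nonneg _), ENNReal.ofReal_inv_of_pos (by exact_mod_cast hN),
    ENNReal.ofReal_natCast, ← Real.enorm_of_nonneg (sq_nonneg (c k)), enorm_pow]

lemma eLpNorm_stepFun_sq (N : ℕ) (hN : 0 < N) (c : ℕ → ℝ) :
    eLpNorm (stepFun N c) 2 unitTime ^ 2 =
      ENNReal.ofReal (∑ k ∈ Finset.range N, c k ^ 2 * (N : ℝ)⁻¹) := by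
  rw [eLpNorm_two_sq, lintegral_enorm_stepFun_pow N hN c 2, ofReal_sum_pow_mul_inv N hN]

/-- Square-integrable functions on `[0,1]` are limits of step functions on arbitrarily fine uniform
grids; refining the grid for a fixed bound on the values makes the contribution of the diagonal
cells small. -/
lemma exists_stepFun_approx {f : ℝ → ℝ} (hf : MemLp f 2 unitTime) {ε : ℝ} (hε : 0 < ε) (n : ℕ) :
    ∃ (N : ℕ) (c : ℕ → ℝ), 0 < N ∧ n ≤ N ∧
      eLpNorm (fun t => f t - stepFun N c t) 2 unitTime ≤ ENNReal.ofReal ε ∧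
      ∑ k ∈ Finset.range N, c k ^ 4 * ((N : ℝ)⁻¹) ^ 2 ≤ ε := by
  obtain ⟨g, hg, -⟩ := hf.exists_boundedContinuous_eLpNorm_sub_le (by simp)
    (ε := ENNReal.ofReal (ε / 2)) (by simpa using hε)
  have huc : UniformContinuousOn g (Set.Icc 0 1) :=
    isCompact_Icc.uniformContinuousOn_of_continuous g.continuous.continuousOn
  obtain ⟨η, hη, hgη⟩ := Metric.uniformContinuousOn_iff.1 huc (ε / 2) (half_pos hε)
  obtain ⟨N₁, hN₁⟩ := exists_nat_gt (1 / η)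
  obtain ⟨N₂, hN₂⟩ := exists_nat_gt (‖g‖ ^ 4 / ε)
  set N := max (max N₁ N₂) (max n 1) with hN_def
  have hN : 0 < N := lt_of_lt_of_le one_pos ((le_max_right n 1).trans (le_max_right _ _))
  have hNR : (0 : ℝ) < N := by exact_mod_cast hN
  refine ⟨N, fun k => g (((k + 1 : ℕ) : ℝ) / N), hN, (le_max_left n 1).trans (le_max_right _ _),
    ?_, ?_⟩
  · have h1 : eLpNorm (fun t => g t - stepFun N (fun k => g (((k + 1 : ℕ) : ℝ) / N)) t) 2 unitTime ≤
        ENNReal.ofReal (ε / 2) := by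
      refine (eLpNorm_le_of_ae_bound (C := ε / 2) ?_).trans (by simp)
      filter_upwards [ae_unitTime_mem_Ioc] with t ht
      obtain ⟨k, hk, htk⟩ := exists_mem_gridCell hN ht
      rw [stepFun_apply hk htk, ← dist_eq_norm]
      have hk1 : ((k + 1 : ℕ) : ℝ) / N ≤ 1 := by
        rw [div_le_one hNR]
        exact_mod_cast hk
      refine (hgη t ⟨ht.1.le, ht.2⟩ _ ⟨by positivity, hk1⟩ ?_).le
      rw [dist_comm, Real.dist_eq, abs_of_nonneg (sub_nonneg.2 htk.2)]
      have h2 : ((k + 1 : ℕ) : ℝ) / N - t < 1 / N := by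
        have := htk.1
        push_cast
        rw [add_div]
        linarith
      refine h2.trans_le ?_
      rw [div_le_iff₀ hNR]
      have h3 : (N₁ : ℝ) ≤ N := by exact_mod_cast (le_max_left N₁ N₂).trans (le_max_left _ _)
      rw [div_lt_iff₀ hη] at hN₁
      nlinarith
    refine (eLpNorm_sub_le_add hf.1 g.continuous.aestronglyMeasurable
      (measurable_stepFun _ _).aestronglyMeasurable).trans ((add_le_add hg h1).trans ?_)
    rw [← ENNReal.ofReal_add (by positivity) (by positivity), add_halves]
  · have h4 (k : ℕ) : (g (((k + 1 : ℕ) : ℝ) / N)) ^ 4 ≤ ‖g‖ ^ 4 := by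
      rw [← Even.pow_abs (by decide : Even 4)]
      exact pow_le_pow_left₀ (abs_nonneg _) (g.norm_coe_le_norm _) 4
    calc ∑ k ∈ Finset.range N, (g (((k + 1 : ℕ) : ℝ) / N)) ^ 4 * ((N : ℝ)⁻¹) ^ 2
        ≤ ∑ k ∈ Finset.range N, ‖g‖ ^ 4 * ((N : ℝ)⁻¹) ^ 2 :=
          Finset.sum_le_sum fun k _ => mul_le_mul_of_nonneg_right (h4 k) (by positivity)
      _ = ‖g‖ ^ 4 / N := by
          rw [Finset.sum_const, Finset.card_range, nsmul_eq_mul]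
          field_simp
      _ ≤ ε := by
          rw [div_le_iff₀ hNR]
          rw [div_lt_iff₀ hε] at hN₂
          have h3 : (N₂ : ℝ) ≤ N := by exact_mod_cast (le_max_right N₁ N₂).trans (le_max_left _ _)
          nlinarith

/-- If `φ` is small on `[0, δ']`, then a step approximation of `φ` has small mass on the cells that
start before `δ < δ'`. -/
lemma eLpNorm_stepFun_headCoeff_le {N : ℕ} (hN : 0 < N) (c : ℕ → ℝ) {δ : ℝ≥0} {δ' : ℝ}
    (hNδ : (δ : ℝ) + 1 / N ≤ δ') {φ : ℝ → ℝ} (hφ : AEStronglyMeasurable φ unitTime) {ε : ℝ≥0}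
    (hε : ∀ t ∈ Set.Icc 0 δ', |φ t| ≤ ε) :
    eLpNorm (stepFun N (headCoeff N δ c)) 2 unitTime ≤
      eLpNorm (fun t => φ t - stepFun N c t) 2 unitTime + ε := by
  have hm : AEStronglyMeasurable (fun t => φ t - stepFun N c t) unitTime :=
    hφ.sub (measurable_stepFun N c).aestronglyMeasurable
  have h1 : eLpNorm (stepFun N (headCoeff N δ c)) 2 unitTime ≤
      eLpNorm (fun t => ‖φ t - stepFun N c t‖ + (ε : ℝ)) 2 unitTime := by
    refine eLpNorm_mono_ae ?_
    filter_upwards [ae_unitTime_mem_Ioc] with t ht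
    obtain ⟨k, hk, htk⟩ := exists_mem_gridCell hN ht
    rw [stepFun_apply hk htk, stepFun_apply hk htk, headCoeff,
      Real.norm_of_nonneg (by positivity : (0 : ℝ) ≤ ‖φ t - c k‖ + ε)]
    split_ifs with h
    · have h' : (k : ℝ) / N < δ := by exact_mod_cast h
      have htδ : t ≤ δ' := by
        have := htk.2
        push_cast at this
        rw [add_div] at this
        linarith
      have h2 := hε t ⟨ht.1.le, htδ⟩
      have h3 : |c k| ≤ |φ t - c k| + |φ t| := by
        have := abs_sub (φ t - c k) (φ t)
        rwa [sub_sub_cancel_left, abs_neg] at this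
      simp only [Real.norm_eq_abs]
      linarith
    · rw [norm_zero]
      positivity
  refine h1.trans ((eLpNorm_add_le hm.norm aestronglyMeasurable_const (by norm_num)).trans ?_)
  rw [eLpNorm_norm, eLpNorm_const' _ (by simp) (by simp)]
  simp

section Product

variable {Ω : Type*} [mΩ : MeasurableSpace Ω] {P : Measure Ω} [IsProbabilityMeasure P]

lemma eLpNorm_timesMeasure_of_times {g : ℝ → ℝ → ℝ} (hg : Measurable fun p : ℝ × ℝ => g p.1 p.2) :
    eLpNorm (fun p : ℝ × ℝ × Ω => g p.1 p.2.1) 2 (timesMeasure P) ^ 2 =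
      ∫⁻ t, ∫⁻ s, ‖g t s‖ₑ ^ 2 ∂unitTime ∂unitTime := by
  have hm : Measurable (fun p : ℝ × ℝ × Ω => g p.1 p.2.1) :=
    hg.comp (measurable_fst.prodMk (measurable_fst.comp measurable_snd))
  rw [eLpNorm_timesMeasure_sq hm.aestronglyMeasurable]
  refine lintegral_congr fun t => lintegral_congr fun s => ?_
  change eLpNorm (fun _ : Ω => g t s) 2 P ^ 2 = _
  rw [eLpNorm_const' _ (by simp) (by simp)]
  simp

lemma eLpNorm_timesMeasure_mul {f g : ℝ → ℝ} (hf : Measurable f) (hg : Measurable g) :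
    eLpNorm (fun p : ℝ × ℝ × Ω => f p.1 * g p.2.1) 2 (timesMeasure P) =
      eLpNorm f 2 unitTime * eLpNorm g 2 unitTime := by
  refine (ENNReal.pow_right_strictMono two_ne_zero).injective ?_
  rw [eLpNorm_timesMeasure_of_times (g := fun t s => f t * g s)
    ((hf.comp measurable_fst).mul (hg.comp measurable_snd)), mul_pow, eLpNorm_two_sq, eLpNorm_two_sq]
  simp_rw [enorm_mul, mul_pow]
  rw [← lintegral_mul_const _ (hf.enorm.pow_const 2)]
  refine lintegral_congr fun t => ?_
  rw [lintegral_const_mul _ (hg.enorm.pow_const 2)]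

/-- The squared values of a step function, placed on the diagonal cells. -/
noncomputable def diagFun (N : ℕ) (c : ℕ → ℝ) (t s : ℝ) : ℝ :=
  ∑ k ∈ Finset.range N, (gridCell N k).indicator (fun _ => (1 : ℝ)) t *
    ((gridCell N k).indicator (fun _ => (1 : ℝ)) s * c k ^ 2)

lemma measurable_diagFun (N : ℕ) (c : ℕ → ℝ) :
    Measurable fun p : ℝ × ℝ => diagFun N c p.1 p.2 :=
  Finset.measurable_fun_sum _ fun k _ =>
    ((measurable_const.indicator (measurableSet_gridCell N k)).comp measurable_fst).mul
      (((measurable_const.indicator (measurableSet_gridCell N k)).comp measurable_snd).mul_const _)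

lemma diagFun_apply {N k : ℕ} {c : ℕ → ℝ} {t s : ℝ} (hk : k < N) (ht : t ∈ gridCell N k) :
    diagFun N c t s = (gridCell N k).indicator (fun _ => (1 : ℝ)) s * c k ^ 2 := by
  rw [diagFun, Finset.sum_eq_single_of_mem k (Finset.mem_range.2 hk)]
  · simp [ht]
  · intro j _ hj
    rw [Set.indicator_of_notMem fun h => hj (gridCell_unique (by omega) h ht), zero_mul]

lemma eLpNorm_diagFun_sq {N : ℕ} (hN : 0 < N) (c : ℕ → ℝ) :
    eLpNorm (fun p : ℝ × ℝ × Ω => diagFun N c p.1 p.2.1) 2 (timesMeasure P) ^ 2 =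
      ENNReal.ofReal (∑ k ∈ Finset.range N, c k ^ 4 * ((N : ℝ)⁻¹) ^ 2) := by
  rw [eLpNorm_timesMeasure_of_times (measurable_diagFun N c)]
  have h : ∀ᵐ t ∂unitTime, ∫⁻ s, ‖diagFun N c t s‖ₑ ^ 2 ∂unitTime =
      ‖stepFun N c t‖ₑ ^ 4 * (N : ℝ≥0∞)⁻¹ := by
    filter_upwards [ae_unitTime_mem_Ioc] with t ht
    obtain ⟨k, hk, htk⟩ := exists_mem_gridCell hN ht
    have e : ∀ s, ‖diagFun N c t s‖ₑ ^ 2 =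
        (gridCell N k).indicator (fun _ => ‖c k‖ₑ ^ 4) s := fun s => by
      rw [diagFun_apply hk htk]
      by_cases hs : s ∈ gridCell N k
      · simp only [hs, Set.indicator_of_mem, one_mul, enorm_pow]
        ring
      · simp [hs]
    simp_rw [e]
    rw [lintegral_indicator_const (measurableSet_gridCell N k), unitTime_gridCell hk,
      stepFun_apply hk htk]
  rw [lintegral_congr_ae h, lintegral_mul_const _ ((measurable_stepFun N c).enorm.pow_const 4),
    lintegral_enorm_stepFun_pow N hN c 4, Finset.sum_mul,
    ENNReal.ofReal_sum_of_nonneg fun k _ => by positivity]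
  refine Finset.sum_congr rfl fun k _ => ?_
  rw [ENNReal.ofReal_mul (by positivity), ENNReal.ofReal_pow (p := (N : ℝ)⁻¹) (by positivity),
    ENNReal.ofReal_inv_of_pos (by exact_mod_cast hN), ENNReal.ofReal_natCast,
    ← Real.enorm_of_nonneg (by positivity : 0 ≤ c k ^ 4), enorm_pow]
  ring

end Product

/-! ### Elementary kernels with a random coefficient -/

section GridKernel

variable {Ω : Type*} [mΩ : MeasurableSpace Ω] {P : Measure Ω} [IsProbabilityMeasure P]
  {B : ℝ≥0 → Ω → ℝ}

/-- The elementary kernel `ξ ∑_{k<l} c_k c_l 1_{cell k}(s) 1_{cell l}(t)`. -/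
noncomputable def gridKernel (N : ℕ) (c : ℕ → ℝ) (ξ : Ω → ℝ) (s t : ℝ) (ω : Ω) : ℝ :=
  ∑ p ∈ gridPairs N, c p.1 * c p.2 * ((gridCell N p.1).indicator (fun _ => (1 : ℝ)) s *
    (gridCell N p.2).indicator (fun _ => (1 : ℝ)) t * ξ ω)

lemma measurable_gridKernel (N : ℕ) (c : ℕ → ℝ) {ξ : Ω → ℝ} (hξ : Measurable ξ) :
    Measurable fun p : ℝ × ℝ × Ω => gridKernel N c ξ p.2.1 p.1 p.2.2 :=
  Finset.measurable_fun_sum _ fun _ _ => Measurable.const_mul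
    ((((measurable_const.indicator (measurableSet_gridCell N _)).comp
      (measurable_fst.comp measurable_snd)).mul
        ((measurable_const.indicator (measurableSet_gridCell N _)).comp measurable_fst)).mul
          (hξ.comp (measurable_snd.comp measurable_snd))) _

lemma gridKernel_apply {N k l : ℕ} {c : ℕ → ℝ} {ξ : Ω → ℝ} {s t : ℝ} (hs : s ∈ gridCell N k)
    (ht : t ∈ gridCell N l) (hl : l < N) (ω : Ω) :
    gridKernel N c ξ s t ω = if k < l then c k * c l * ξ ω else 0 := by
  rw [← sum_gridPairs (by omega) hs ht hl fun p => c p.1 * c p.2 * ξ ω, gridKernel]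
  exact Finset.sum_congr rfl fun p _ => by ring

/-- The iterated integral of an elementary kernel is a quadratic functional of the increments. -/
lemma isIteratedItoIntegral_gridKernel (hB_meas : ∀ t, Measurable (B t))
    (hB : IsPreBrownianReal B P) {N : ℕ} {c : ℕ → ℝ} {δ : ℝ≥0} {ξ : Ω → ℝ}
    (hξ : AEStronglyMeasurable[natSigma B δ] ξ P) (h2 : MemLp ξ 2 P)
    (hc : ∀ k : ℕ, (k : ℝ≥0) / N < δ → c k = 0) :
    IsIteratedItoIntegral B P (gridKernel N c ξ) (fun ω => 1 / 2 * ξ ω *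
      (gridSum B N c ω ^ 2 - ∑ k ∈ Finset.range N, c k ^ 2 * gridInc B N k ω ^ 2)) := by
  have hterm (p : ℕ × ℕ) (hp : p ∈ gridPairs N) : IsIteratedItoIntegral B P
      (fun s t ω => c p.1 * c p.2 * ((gridCell N p.1).indicator (fun _ => (1 : ℝ)) s *
        (gridCell N p.2).indicator (fun _ => (1 : ℝ)) t * ξ ω))
      (fun ω => c p.1 * c p.2 * (ξ ω * gridInc B N p.1 ω * gridInc B N p.2 ω)) := by
    simp only [gridPairs, Finset.mem_filter, Finset.mem_product, Finset.mem_range] at hp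
    obtain ⟨⟨hp1, hp2⟩, hp3⟩ := hp
    rcases lt_or_ge ((p.1 : ℝ≥0) / N) δ with h | h
    · simpa [hc _ h] using isIteratedItoIntegral_zero (B := B) (P := P)
    · have h := isIteratedItoIntegral_rect hB_meas hB (grid_le N (Nat.le_succ p.1))
        (grid_le N hp3) (grid_le N (Nat.le_succ p.2)) (grid_le_one hp2)
        (hξ.mono (natSigma_mono h)) h2
      exact h.const_mul (c p.1 * c p.2)
  have h := isIteratedItoIntegral_sum hB_meas hB (gridPairs N) hterm
  refine (funext fun ω => ?_ : (fun ω => 1 / 2 * ξ ω *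
    (gridSum B N c ω ^ 2 - ∑ k ∈ Finset.range N, c k ^ 2 * gridInc B N k ω ^ 2)) = _) ▸ h
  have hs := sum_gridPairs_mul N fun k => c k * gridInc B N k ω
  have e : ∑ p ∈ gridPairs N, c p.1 * c p.2 * (ξ ω * gridInc B N p.1 ω * gridInc B N p.2 ω) =
      ξ ω * ∑ p ∈ gridPairs N, c p.1 * gridInc B N p.1 ω * (c p.2 * gridInc B N p.2 ω) := by
    rw [Finset.mul_sum]
    exact Finset.sum_congr rfl fun p _ => by ring
  rw [e, hs, gridSum]
  simp_rw [mul_pow]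
  ring

/-- Near the corner `(1,1)` the kernel `φ ⊗ φ` costs at most its norm times the size of the
coefficient there. -/
lemma eLpNorm_indicator_kernel_mul_le {w : ℝ → ℝ → Ω → ℝ}
    (hw : Measurable fun p : ℝ × ℝ × Ω => w p.2.1 p.1 p.2.2) {φ : ℝ → ℝ} (hφ : Measurable φ)
    {δ : ℝ} {M : ℝ≥0∞} (hM : ∀ s t, δ ≤ s → s ≤ t → t ≤ 1 → eLpNorm (w s t) 2 P ≤ M) :
    eLpNorm ({p : ℝ × ℝ × Ω | p.2.1 ≤ δ}ᶜ.indicator fun p => φ p.1 * φ p.2.1 * lowerTri w p) 2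
      (timesMeasure P) ≤ M * eLpNorm φ 2 unitTime ^ 2 := by
  set S : Set (ℝ × ℝ × Ω) := {p | p.2.1 ≤ δ} with hS
  have hSm : MeasurableSet S :=
    measurableSet_le (measurable_fst.comp measurable_snd) measurable_const
  set W : ℝ × ℝ × Ω → ℝ := fun p => φ p.1 * φ p.2.1 * lowerTri w p with hW
  have hWm : Measurable W := ((hφ.comp measurable_fst).mul
    (hφ.comp (measurable_fst.comp measurable_snd))).mul (measurable_lowerTri hw)
  refine (ENNReal.pow_le_pow_left_iff two_ne_zero).1 ?_
  rw [eLpNorm_timesMeasure_sq (hWm.indicator hSm.compl).aestronglyMeasurable, mul_pow,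
    sq (eLpNorm φ 2 unitTime), ← eLpNorm_timesMeasure_mul (P := P) hφ hφ,
    eLpNorm_timesMeasure_of_times (g := fun t s => φ t * φ s)
      ((hφ.comp measurable_fst).mul (hφ.comp measurable_snd))]
  have hmeas : Measurable fun p : ℝ × ℝ => ‖φ p.1 * φ p.2‖ₑ ^ 2 :=
    ((hφ.comp measurable_fst).mul (hφ.comp measurable_snd)).enorm.pow_const 2
  have hconst : M ^ 2 * ∫⁻ t, ∫⁻ s, ‖φ t * φ s‖ₑ ^ 2 ∂unitTime ∂unitTime =
      ∫⁻ t, ∫⁻ s, M ^ 2 * ‖φ t * φ s‖ₑ ^ 2 ∂unitTime ∂unitTime := by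
    rw [← lintegral_const_mul _ hmeas.lintegral_prod_right']
    refine lintegral_congr fun t => ?_
    exact (lintegral_const_mul _ (hmeas.comp measurable_prodMk_left)).symm
  rw [hconst]
  refine lintegral_mono_ae ?_
  filter_upwards [ae_unitTime_mem_Ioc] with t ht
  refine lintegral_mono fun s => ?_
  rw [← mul_pow, mul_comm M]
  refine pow_le_pow_left' ?_ 2
  by_cases hs : s ≤ δ
  · have : (fun ω => Sᶜ.indicator W (t, s, ω)) = fun _ => (0 : ℝ) := by
      ext ω
      exact Set.indicator_of_notMem (Set.notMem_compl_iff.2 hs : (t, s, ω) ∉ Sᶜ) W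
    simp [this]
  by_cases hst : s ≤ t
  · have : (fun ω => Sᶜ.indicator W (t, s, ω)) =
        (φ t * φ s) • w s t := by
      ext ω
      rw [Set.indicator_of_mem (show (t, s, ω) ∈ Sᶜ from hs)]
      simp [hW, lowerTri, hst]
    rw [this, eLpNorm_const_smul]
    exact mul_le_mul_right (hM s t (le_of_not_ge hs) hst ht.2) _
  · have : (fun ω => Sᶜ.indicator W (t, s, ω)) = fun _ => (0 : ℝ) := by
      ext ω
      rw [Set.indicator_of_mem (show (t, s, ω) ∈ Sᶜ from hs)]
      simp [hW, lowerTri, hst]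
    simp [this]

/-- The cost of replacing the kernel `φ(s) φ(t) u_{s,t}` by an elementary kernel with coefficient
`ξ`: near the diagonal corner `u` is close to `ξ`, away from it the kernel is small, and the rest is
the error of the step approximation. -/
lemma IsIteratedItoIntegral.eLpNorm_sub_gridKernel_le (hB_meas : ∀ t, Measurable (B t))
    (hB : IsPreBrownianReal B P) {u : ℝ → ℝ → Ω → ℝ}
    (hu : Measurable fun p : ℝ × ℝ × Ω => u p.2.1 p.1 p.2.2) {φ : ℝ → ℝ} (hφ : Measurable φ)
    {N : ℕ} (hN : 0 < N) {c : ℕ → ℝ} {ξ : Ω → ℝ} (hξ : Measurable ξ) {C : ℝ≥0}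
    (hC : ∀ ω, |ξ ω| ≤ C) {δ : ℝ} {ε : ℝ≥0}
    (hε : ∀ s t, 0 ≤ s → s ≤ δ → s ≤ t → t ≤ 1 → |φ s * φ t| ≤ ε) {M : ℝ≥0∞}
    (hM : ∀ s t, δ ≤ s → s ≤ t → t ≤ 1 → eLpNorm (fun ω => u s t ω - ξ ω) 2 P ≤ M)
    {F J : Ω → ℝ} (hF : IsIteratedItoIntegral B P (fun s t ω => φ s * φ t * u s t ω) F)
    (hJ : IsIteratedItoIntegral B P (gridKernel N c ξ) J) :
    eLpNorm (fun ω => F ω - J ω) 2 P ≤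
      ε * eLpNorm (lowerTri fun s t ω => u s t ω - ξ ω) 2 (timesMeasure P) +
      M * eLpNorm φ 2 unitTime ^ 2 +
      C * (eLpNorm (fun t => φ t - stepFun N c t) 2 unitTime *
          (eLpNorm φ 2 unitTime + eLpNorm (stepFun N c) 2 unitTime) +
        eLpNorm (fun p : ℝ × ℝ × Ω => diagFun N c p.1 p.2.1) 2 (timesMeasure P)) := by
  set ψ := stepFun N c with hψ_def
  have hψ : Measurable ψ := measurable_stepFun N c
  have hφs : Measurable fun p : ℝ × ℝ × Ω => φ p.2.1 :=
    hφ.comp (measurable_fst.comp measurable_snd)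
  have hφt : Measurable fun p : ℝ × ℝ × Ω => φ p.1 := hφ.comp measurable_fst
  have hξp : Measurable fun p : ℝ × ℝ × Ω => ξ p.2.2 :=
    hξ.comp (measurable_snd.comp measurable_snd)
  have hFm : Measurable fun p : ℝ × ℝ × Ω => φ p.2.1 * φ p.1 * u p.2.1 p.1 p.2.2 :=
    (hφs.mul hφt).mul hu
  have hmm : Measurable (lowerTri fun s t ω => φ s * φ t * u s t ω - gridKernel N c ξ s t ω) :=
    measurable_lowerTri (hFm.sub (measurable_gridKernel N c hξ))
  rw [(hF.sub hB_meas hB hJ).eLpNorm_eq hB_meas hB hmm.aestronglyMeasurable]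
  -- the three parts of the error
  set D : ℝ × ℝ × Ω → ℝ := lowerTri fun s t ω => u s t ω - ξ ω with hD
  have hDm : Measurable D := measurable_lowerTri (hu.sub hξp)
  set S : Set (ℝ × ℝ × Ω) := {p | p.2.1 ≤ δ} with hS
  have hSm : MeasurableSet S :=
    measurableSet_le (measurable_fst.comp measurable_snd) measurable_const
  set W : ℝ × ℝ × Ω → ℝ := fun p => φ p.1 * φ p.2.1 * D p with hW
  have hWm : Measurable W := (hφt.mul hφs).mul hDm
  set T₁ : ℝ × ℝ × Ω → ℝ := fun p => φ p.1 * (φ p.2.1 - ψ p.2.1) with hT₁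
  set T₂ : ℝ × ℝ × Ω → ℝ := fun p => (φ p.1 - ψ p.1) * ψ p.2.1 with hT₂
  set T₃ : ℝ × ℝ × Ω → ℝ := fun p => diagFun N c p.1 p.2.1 with hT₃
  have hψs : Measurable fun p : ℝ × ℝ × Ω => ψ p.2.1 :=
    hψ.comp (measurable_fst.comp measurable_snd)
  have hψt : Measurable fun p : ℝ × ℝ × Ω => ψ p.1 := hψ.comp measurable_fst
  have hT₁m : Measurable T₁ := hφt.mul (hφs.sub hψs)
  have hT₂m : Measurable T₂ := (hφt.sub hψt).mul hψs
  have hT₃m : Measurable T₃ :=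
    (measurable_diagFun N c).comp (measurable_fst.prodMk (measurable_fst.comp measurable_snd))
  have haet : ∀ᵐ p : ℝ × ℝ × Ω ∂(timesMeasure P), p.1 ∈ Set.Ioc (0 : ℝ) 1 :=
    Measure.quasiMeasurePreserving_fst.ae ae_unitTime_mem_Ioc
  have haes : ∀ᵐ p : ℝ × ℝ × Ω ∂(timesMeasure P), p.2.1 ∈ Set.Ioc (0 : ℝ) 1 :=
    Measure.quasiMeasurePreserving_snd.ae
      (Measure.quasiMeasurePreserving_fst.ae ae_unitTime_mem_Ioc)
  have hpt : ∀ᵐ p ∂(timesMeasure P),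
      ‖lowerTri (fun s t ω => φ s * φ t * u s t ω - gridKernel N c ξ s t ω) p‖ ≤
      ‖(‖S.indicator W p‖ + ‖Sᶜ.indicator W p‖) + C * ((‖T₁ p‖ + ‖T₂ p‖) + ‖T₃ p‖)‖ := by
    filter_upwards [haet, haes] with p ht hs
    obtain ⟨t, s, ω⟩ := p
    simp only at ht hs
    rw [Real.norm_of_nonneg (by positivity :
      0 ≤ (‖S.indicator W (t, s, ω)‖ + ‖Sᶜ.indicator W (t, s, ω)‖) +
        C * ((‖T₁ (t, s, ω)‖ + ‖T₂ (t, s, ω)‖) + ‖T₃ (t, s, ω)‖))]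
    have hWS : ‖S.indicator W (t, s, ω)‖ + ‖Sᶜ.indicator W (t, s, ω)‖ = ‖W (t, s, ω)‖ := by
      by_cases h : (t, s, ω) ∈ S
      · simp [h]
      · simp [h]
    rw [hWS]
    by_cases hst : s ≤ t
    swap
    · simp only [lowerTri, hst, if_false, norm_zero]
      positivity
    obtain ⟨k, hk, hsk⟩ := exists_mem_gridCell hN hs
    obtain ⟨l, hl, htl⟩ := exists_mem_gridCell hN ht
    simp only [lowerTri, hst, if_true]
    rw [gridKernel_apply hsk htl hl]
    have hψs' : ψ s = c k := stepFun_apply hk hsk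
    have hψt' : ψ t = c l := stepFun_apply hl htl
    have hW' : W (t, s, ω) = φ t * φ s * (u s t ω - ξ ω) := by
      simp [hW, hD, lowerTri, hst]
    have hT₁' : T₁ (t, s, ω) = φ t * (φ s - c k) := by simp [hT₁, hψs']
    have hT₂' : T₂ (t, s, ω) = (φ t - c l) * c k := by simp [hT₂, hψs', hψt']
    have hkl := gridCell_le_of_le hN hsk htl hst
    have e : φ s * φ t * u s t ω - (if k < l then c k * c l * ξ ω else 0) =
        W (t, s, ω) + ξ ω * ((T₁ (t, s, ω) + T₂ (t, s, ω)) + if k < l then 0 else c k * c l) := by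
      rw [hW', hT₁', hT₂']
      split_ifs <;> ring
    have hT₃' : ‖(if k < l then 0 else c k * c l : ℝ)‖ ≤ ‖T₃ (t, s, ω)‖ := by
      split_ifs with h
      · simp
      · have hkl' : k = l := by omega
        subst hkl'
        simp [hT₃, diagFun_apply hk htl, hsk, sq]
    rw [e]
    refine (norm_add_le _ _).trans (add_le_add le_rfl ?_)
    rw [norm_mul]
    refine mul_le_mul (hC ω) ?_ (norm_nonneg _) C.2
    refine (norm_add_le _ _).trans (add_le_add (norm_add_le _ _) hT₃')
  refine (eLpNorm_mono_ae hpt).trans ?_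
  have n1 : eLpNorm (S.indicator W) 2 (timesMeasure P) ≤
      ε * eLpNorm D 2 (timesMeasure P) := by
    have h := eLpNorm_le_nnreal_smul_eLpNorm_of_ae_le_mul (f := S.indicator W) (g := D) (c := ε)
      (μ := timesMeasure P) (by
        filter_upwards [haet, haes] with p ht hs
        obtain ⟨t, s, ω⟩ := p
        simp only at ht hs
        by_cases hp : (t, s, ω) ∈ S
        · rw [Set.indicator_of_mem hp]
          by_cases hst : s ≤ t
          · have := hε s t hs.1.le hp hst ht.2
            rw [← NNReal.coe_le_coe]
            push_cast
            simp only [hW, norm_mul]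
            rw [mul_comm (φ s), abs_mul] at this
            exact mul_le_mul_of_nonneg_right this (norm_nonneg _)
          · simp [hW, hD, lowerTri, hst]
        · simp [hp]) 2
    simpa [ENNReal.smul_def] using h
  have n2 : eLpNorm (Sᶜ.indicator W) 2 (timesMeasure P) ≤ M * eLpNorm φ 2 unitTime ^ 2 :=
    eLpNorm_indicator_kernel_mul_le (hu.sub hξp) hφ hM
  have n3 : eLpNorm T₁ 2 (timesMeasure P) =
      eLpNorm φ 2 unitTime * eLpNorm (fun t => φ t - ψ t) 2 unitTime :=
    eLpNorm_timesMeasure_mul (f := φ) (g := fun t => φ t - ψ t) hφ (hφ.sub hψ)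
  have n4 : eLpNorm T₂ 2 (timesMeasure P) =
      eLpNorm (fun t => φ t - ψ t) 2 unitTime * eLpNorm ψ 2 unitTime :=
    eLpNorm_timesMeasure_mul (f := fun t => φ t - ψ t) (g := ψ) (hφ.sub hψ) hψ
  have hSW := (hWm.indicator hSm).norm.aestronglyMeasurable (μ := timesMeasure P)
  have hScW := (hWm.indicator hSm.compl).norm.aestronglyMeasurable (μ := timesMeasure P)
  have h12 := (hT₁m.norm.add hT₂m.norm).aestronglyMeasurable (μ := timesMeasure P)
  have h3 := hT₃m.norm.aestronglyMeasurable (μ := timesMeasure P)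
  refine (eLpNorm_add_le (hSW.add hScW) ((h12.add h3).const_mul (C : ℝ)) (by norm_num)).trans
    (add_le_add ?_ ?_)
  · refine (eLpNorm_add_le hSW hScW (by norm_num)).trans ?_
    rw [eLpNorm_norm, eLpNorm_norm]
    exact add_le_add n1 n2
  · have e : (fun p => (C : ℝ) * ((‖T₁ p‖ + ‖T₂ p‖) + ‖T₃ p‖)) =
        (C : ℝ) • fun p => (‖T₁ p‖ + ‖T₂ p‖) + ‖T₃ p‖ := rfl
    refine (le_of_eq (congrArg (fun f => eLpNorm f 2 (timesMeasure P)) e)).trans ?_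
    rw [eLpNorm_const_smul]
    refine mul_le_mul' (le_of_eq (by rw [Real.enorm_of_nonneg (NNReal.coe_nonneg C),
      ENNReal.ofReal_coe_nnreal])) ?_
    refine (eLpNorm_add_le h12 h3 (by norm_num)).trans ?_
    rw [eLpNorm_norm]
    refine add_le_add ?_ le_rfl
    refine (eLpNorm_add_le hT₁m.norm.aestronglyMeasurable hT₂m.norm.aestronglyMeasurable
      (by norm_num)).trans ?_
    rw [eLpNorm_norm, eLpNorm_norm, n3, n4, mul_add, mul_comm (eLpNorm φ 2 unitTime)]

/-- The diagonal part of the quadratic functional is close to its mean. -/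
lemma eLpNorm_quadratic_sub_le (hB_meas : ∀ t, Measurable (B t)) (hB : IsPreBrownianReal B P)
    (N : ℕ) (c : ℕ → ℝ) (L : ℝ) {ξ : Ω → ℝ} {C : ℝ≥0} (hC : ∀ ω, |ξ ω| ≤ C) :
    eLpNorm (fun ω => 1 / 2 * ξ ω * (gridSum B N c ω ^ 2 -
        ∑ k ∈ Finset.range N, c k ^ 2 * gridInc B N k ω ^ 2) -
        1 / 2 * ξ ω * (gridSum B N c ω ^ 2 - L)) 2 P ≤
      C * (ENNReal.ofReal (√((∑ k ∈ Finset.range N, c k ^ 4 * ((N : ℝ)⁻¹) ^ 2) *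
          ∫ z, (z ^ 2 - 1) ^ 2 ∂(gaussianReal 0 1))) +
        ENNReal.ofReal |(∑ k ∈ Finset.range N, c k ^ 2 * (N : ℝ)⁻¹) - L|) := by
  set Q : Ω → ℝ := fun ω => ∑ k ∈ Finset.range N, c k ^ 2 * (gridInc B N k ω ^ 2 - (N : ℝ)⁻¹)
    with hQ
  set m : ℝ := (∑ k ∈ Finset.range N, c k ^ 2 * (N : ℝ)⁻¹) - L with hm
  have hQ2 : MemLp Q 2 P := memLp_finsetSum _ fun k _ => MemLp.const_mul
    ((memLp_two_sq_of_memLp_four (memLp_gridInc hB N k (by simp))).sub (memLp_const _)) _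
  have hQn : eLpNorm Q 2 P = ENNReal.ofReal (√((∑ k ∈ Finset.range N, c k ^ 4 * ((N : ℝ)⁻¹) ^ 2) *
          ∫ z, (z ^ 2 - 1) ^ 2 ∂(gaussianReal 0 1))) := by
    refine (ENNReal.pow_right_strictMono two_ne_zero).injective ?_
    have h := integral_diag_sq hB_meas hB N fun k => c k ^ 2
    simp_rw [← pow_mul] at h
    rw [eLpNorm_two_sq_eq_ofReal hQ2, ← ENNReal.ofReal_pow (Real.sqrt_nonneg _),
      Real.sq_sqrt, ← h]
    exact mul_nonneg (Finset.sum_nonneg fun k _ => by positivity)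
      (integral_nonneg fun z => sq_nonneg _)
  have hpt (ω : Ω) : 1 / 2 * ξ ω * (gridSum B N c ω ^ 2 -
        ∑ k ∈ Finset.range N, c k ^ 2 * gridInc B N k ω ^ 2) -
        1 / 2 * ξ ω * (gridSum B N c ω ^ 2 - L) = -(1 / 2) * ξ ω * (Q ω + m) := by
    simp only [hQ, hm, mul_sub, Finset.sum_sub_distrib]
    ring
  simp_rw [hpt]
  have h1 := eLpNorm_le_nnreal_smul_eLpNorm_of_ae_le_mul (p := 2) (μ := P)
    (f := fun ω => -(1 / 2) * ξ ω * (Q ω + m)) (g := fun ω => Q ω + m) (c := C)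
    (ae_of_all _ fun ω => by
      rw [← NNReal.coe_le_coe]
      push_cast
      rw [norm_mul]
      refine mul_le_mul_of_nonneg_right ?_ (norm_nonneg _)
      rw [norm_mul]
      have := hC ω
      have h2 : ‖(-(1 / 2) : ℝ)‖ = 1 / 2 := by norm_num
      rw [h2, Real.norm_eq_abs]
      linarith [abs_nonneg (ξ ω)])
  rw [ENNReal.smul_def, smul_eq_mul] at h1
  refine h1.trans (mul_le_mul_right ?_ _)
  refine (eLpNorm_add_le hQ2.1 aestronglyMeasurable_const (by norm_num)).trans ?_
  rw [hQn, eLpNorm_const' _ (by simp) (by simp)]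
  simp [Real.enorm_eq_ofReal_abs, hm]

end GridKernel

/-! ### Approximation of the kernels and of the coefficient -/

/-- Expectations of bounded Lipschitz functions depend continuously in `L¹` on their argument. -/
lemma enorm_integral_mul_comp_sub_le {α : Type*} [MeasurableSpace α] {μ : Measure α}
    [IsFiniteMeasure μ] {h : ℝ → ℝ} {K : ℝ≥0} (hhm : Measurable h) (hh1 : ∀ x, |h x| ≤ 1)
    (hh : ∀ a b, |h a - h b| ≤ K * |a - b|) {Y : α → ℝ} (hY : AEStronglyMeasurable Y μ) {C : ℝ≥0}
    (hYC : ∀ x, |Y x| ≤ C) {X X' : α → ℝ} (hX : AEStronglyMeasurable X μ)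
    (hX' : AEStronglyMeasurable X' μ) :
    ‖∫ x, Y x * h (X x) ∂μ - ∫ x, Y x * h (X' x) ∂μ‖ₑ ≤
      C * K * eLpNorm (fun x => X x - X' x) 1 μ := by
  have hi (X : α → ℝ) (hX : AEStronglyMeasurable X μ) : Integrable (fun x => Y x * h (X x)) μ :=
    Integrable.mul_bdd (Integrable.of_bound hY C (ae_of_all _ hYC))
      (hhm.comp_aemeasurable hX.aemeasurable).aestronglyMeasurable (ae_of_all _ fun _ => hh1 _)
  rw [← integral_sub (hi X hX) (hi X' hX'), eLpNorm_one_eq_lintegral_enorm,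
    ← ENNReal.coe_mul, ← lintegral_const_mul' _ _ ENNReal.coe_ne_top]
  refine (enorm_integral_le_lintegral_enorm _).trans (lintegral_mono fun x => ?_)
  simp only
  rw [← mul_sub, enorm_mul, ENNReal.coe_mul, mul_assoc]
  refine mul_le_mul' ?_ ?_
  · rw [Real.enorm_eq_ofReal_abs, ← ENNReal.ofReal_coe_nnreal]
    exact ENNReal.ofReal_le_ofReal (hYC x)
  · rw [Real.enorm_eq_ofReal_abs, Real.enorm_eq_ofReal_abs, ← ENNReal.ofReal_coe_nnreal,
      ← ENNReal.ofReal_mul (NNReal.coe_nonneg K)]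
    exact ENNReal.ofReal_le_ofReal (hh _ _)

lemma exists_mem_Ioc_of_ae_unitTime {p : ℝ → Prop} (h : ∀ᵐ t ∂unitTime, p t) {a b : ℝ}
    (ha : 0 ≤ a) (hab : a < b) (hb : b ≤ 1) : ∃ t ∈ Set.Ioc a b, p t := by
  by_contra! hcon
  have hsub : Set.Ioc a b ⊆ {t | ¬ p t} := fun t ht => hcon t ht
  have h0 : unitTime (Set.Ioc a b) = 0 := measure_mono_null hsub (ae_iff.1 h)
  have hsub' : Set.Ioc a b ⊆ Set.Icc 0 1 := fun t ht => ⟨ha.trans ht.1.le, ht.2.trans hb⟩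
  rw [unitTime, Measure.restrict_apply measurableSet_Ioc, Set.inter_eq_left.2 hsub',
    Real.volume_Ioc, ENNReal.ofReal_eq_zero] at h0
  linarith

lemma Filter.Tendsto.ennreal_sqrt {ι : Type*} {l : Filter ι} {x : ι → ℝ≥0∞} {a : ℝ≥0∞}
    (h : Tendsto (fun i => x i ^ 2) l (𝓝 a)) : Tendsto x l (𝓝 (a ^ (2⁻¹ : ℝ))) := by
  refine (((ENNReal.continuous_rpow_const (y := (2⁻¹ : ℝ))).tendsto _).comp h).congr fun i => ?_
  rw [Function.comp, ← ENNReal.rpow_natCast, ← ENNReal.rpow_mul]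
  norm_num

section Approximation

variable {φ : ℕ → ℝ → ℝ} {L : ℝ≥0} {N : ℕ → ℕ} {c : ℕ → ℕ → ℝ}

/-- Convergence of the squared norms passes to `L²`-close step functions. -/
lemma tendsto_sum_sq_of_stepFun_approx (hφm : ∀ n, Measurable (φ n))
    (hφL : Tendsto (fun n => eLpNorm (φ n) 2 unitTime ^ 2) atTop (𝓝 L)) (hN : ∀ n, 0 < N n)
    (ha : Tendsto (fun n => eLpNorm (fun t => φ n t - stepFun (N n) (c n) t) 2 unitTime) atTop
      (𝓝 0)) :
    Tendsto (fun n => ∑ k ∈ Finset.range (N n), c n k ^ 2 * (N n : ℝ)⁻¹) atTop (𝓝 L) := by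
  have hsqrt := hφL.ennreal_sqrt
  have hLtop : (L : ℝ≥0∞) ^ (2⁻¹ : ℝ) ≠ ∞ := ENNReal.rpow_ne_top_of_nonneg (by norm_num) (by simp)
  have hm (n : ℕ) : AEStronglyMeasurable (stepFun (N n) (c n)) unitTime :=
    (measurable_stepFun _ _).aestronglyMeasurable
  have hlow (n : ℕ) : eLpNorm (φ n) 2 unitTime -
      eLpNorm (fun t => φ n t - stepFun (N n) (c n) t) 2 unitTime ≤
      eLpNorm (stepFun (N n) (c n)) 2 unitTime := by
    rw [tsub_le_iff_left]
    have h := eLpNorm_add_le ((hφm n).aestronglyMeasurable.sub (hm n)) (hm n) (p := 2)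
      (μ := unitTime) (by norm_num)
    rwa [sub_add_cancel] at h
  have hupp (n : ℕ) : eLpNorm (stepFun (N n) (c n)) 2 unitTime ≤ eLpNorm (φ n) 2 unitTime +
      eLpNorm (fun t => φ n t - stepFun (N n) (c n) t) 2 unitTime := by
    have h := eLpNorm_sub_le (hφm n).aestronglyMeasurable
      ((hφm n).aestronglyMeasurable.sub (hm n)) (p := 2) (μ := unitTime) (by norm_num)
    rwa [sub_sub_cancel] at h
  have h1 : Tendsto (fun n => eLpNorm (stepFun (N n) (c n)) 2 unitTime) atTop
      (𝓝 ((L : ℝ≥0∞) ^ (2⁻¹ : ℝ))) := by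
    refine tendsto_of_tendsto_of_tendsto_of_le_of_le ?_ ?_ hlow hupp
    · simpa using ENNReal.Tendsto.sub hsqrt ha (Or.inl hLtop)
    · simpa using hsqrt.add ha
  have h2 : Tendsto (fun n => ENNReal.ofReal (∑ k ∈ Finset.range (N n), c n k ^ 2 * (N n : ℝ)⁻¹))
      atTop (𝓝 L) := by
    have h := ENNReal.Tendsto.pow (n := 2) h1
    rw [← ENNReal.rpow_natCast, ← ENNReal.rpow_mul] at h
    norm_num at h
    refine h.congr fun n => ?_
    exact eLpNorm_stepFun_sq _ (hN n) _
  have h3 := (ENNReal.tendsto_toReal ENNReal.coe_ne_top).comp h2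
  refine h3.congr fun n => ?_
  exact ENNReal.toReal_ofReal (Finset.sum_nonneg fun k _ => by positivity)

/-- If `φ_n → 0` uniformly on `[0, δ']` for every `δ' < 1`, step approximations on finer and finer
grids have asymptotically no mass on the cells that start before `δ < 1`. -/
lemma tendsto_eLpNorm_stepFun_headCoeff (hφm : ∀ n, Measurable (φ n))
    (hsmall : ∀ δ ∈ Set.Ico (0 : ℝ) 1, ∃ ε : ℕ → ℝ≥0, Tendsto ε atTop (𝓝 0) ∧
      ∀ n s t, 0 ≤ s → s ≤ δ → 0 ≤ t → t ≤ 1 → |φ n s * φ n t| ≤ ε n)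
    (hN : ∀ n, 0 < N n) (hNn : ∀ n, n ≤ N n)
    (ha : Tendsto (fun n => eLpNorm (fun t => φ n t - stepFun (N n) (c n) t) 2 unitTime) atTop
      (𝓝 0)) {δ : ℝ≥0} (hδ : δ < 1) :
    Tendsto (fun n => eLpNorm (stepFun (N n) (headCoeff (N n) δ (c n))) 2 unitTime) atTop
      (𝓝 0) := by
  have hδ1 : (δ : ℝ) < 1 := by exact_mod_cast hδ
  have hδ0 : (0 : ℝ) ≤ δ := δ.2
  obtain ⟨ε, hε, hφε⟩ := hsmall (((δ : ℝ) + 1) / 2) ⟨by linarith, by linarith⟩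
  have hlim : Tendsto (fun n => eLpNorm (fun t => φ n t - stepFun (N n) (c n) t) 2 unitTime +
      (NNReal.sqrt (ε n) : ℝ≥0∞)) atTop (𝓝 0) := by
    have h1 := (NNReal.continuous_sqrt.tendsto 0).comp hε
    rw [NNReal.sqrt_zero] at h1
    simpa using ha.add (ENNReal.tendsto_coe.2 h1)
  refine tendsto_of_tendsto_of_tendsto_of_le_of_le' tendsto_const_nhds hlim
    (Eventually.of_forall fun n => zero_le) ?_
  obtain ⟨n₀, hn₀⟩ := exists_nat_gt (2 / (1 - (δ : ℝ)))
  filter_upwards [eventually_ge_atTop n₀] with n hn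
  refine eLpNorm_stepFun_headCoeff_le (hN n) (c n) (δ' := ((δ : ℝ) + 1) / 2) ?_
    (hφm n).aestronglyMeasurable fun t ht => ?_
  · have hNR : (0 : ℝ) < N n := by exact_mod_cast hN n
    have h1 : (n₀ : ℝ) ≤ N n := by exact_mod_cast hn.trans (hNn n)
    rw [div_lt_iff₀ (by linarith)] at hn₀
    have h2 : 1 / (N n : ℝ) ≤ (1 - δ) / 2 := by
      rw [div_le_div_iff₀ hNR two_pos]
      nlinarith
    linarith
  · have h := hφε n t t ht.1 ht.2 ht.1 (ht.2.trans (by linarith))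
    rw [abs_mul, ← sq] at h
    push_cast
    exact Real.le_sqrt_of_sq_le h

lemma tendsto_sum_headCoeff_sq (hN : ∀ n, 0 < N n) {δ : ℝ≥0}
    (h : Tendsto (fun n => eLpNorm (stepFun (N n) (headCoeff (N n) δ (c n))) 2 unitTime) atTop
      (𝓝 0)) :
    Tendsto (fun n => ∑ k ∈ Finset.range (N n), headCoeff (N n) δ (c n) k ^ 2 * (N n : ℝ)⁻¹) atTop
      (𝓝 0) := by
  have h2 : Tendsto (fun n => ENNReal.ofReal
      (∑ k ∈ Finset.range (N n), headCoeff (N n) δ (c n) k ^ 2 * (N n : ℝ)⁻¹)) atTop (𝓝 0) := by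
    have h' := ENNReal.Tendsto.pow (n := 2) h
    rw [zero_pow two_ne_zero] at h'
    refine h'.congr fun n => ?_
    exact eLpNorm_stepFun_sq _ (hN n) _
  have h3 := (ENNReal.tendsto_toReal ENNReal.zero_ne_top).comp h2
  refine h3.congr fun n => ?_
  exact ENNReal.toReal_ofReal (Finset.sum_nonneg fun k _ => by positivity)

lemma stepFun_sub (M : ℕ) (c d : ℕ → ℝ) (t : ℝ) :
    stepFun M (fun k => c k - d k) t = stepFun M c t - stepFun M d t := by
  simp [stepFun, mul_sub, Finset.sum_sub_distrib]

end Approximation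

section Corner

variable {Ω : Type*} [mΩ : MeasurableSpace Ω] {P : Measure Ω} [IsProbabilityMeasure P]
  {B : ℝ≥0 → Ω → ℝ}

/-- A square-integrable adapted process that is `L²`-continuous at `(1,1)` has a square-integrable
value there, and is uniformly close, near that corner, to a simple random variable depending only
on the past of a time `δ < 1`. -/
lemma exists_simpleFunc_near_corner (hB_meas : ∀ t, Measurable (B t)) {u : ℝ → ℝ → Ω → ℝ}
    (hu2 : MemLp (lowerTri u) 2 (timesMeasure P))
    (hum : ∀ s t, 0 ≤ s → s ≤ t → t ≤ 1 → AEStronglyMeasurable[natSigma B s.toNNReal] (u s t) P)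
    (hcont : Tendsto (fun q : ℝ × ℝ => eLpNorm (fun ω => u q.1 q.2 ω - u 1 1 ω) 2 P)
      (𝓝[timeTriangle] (1, 1)) (𝓝 0)) {η : ℝ≥0∞} (hη : η ≠ 0) (hη' : η ≠ ∞) :
    MemLp (u 1 1) 2 P ∧ ∃ δ : ℝ≥0, δ < 1 ∧ ∃ ξ : @SimpleFunc Ω (natSigma B δ) ℝ,
      eLpNorm (fun ω => u 1 1 ω - ξ ω) 2 P ≤ 2 * η ∧
      ∀ s t, (δ : ℝ) ≤ s → s ≤ t → t ≤ 1 → eLpNorm (fun ω => u s t ω - ξ ω) 2 P ≤ 3 * η := by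
  have hm (s t : ℝ) (h0 : 0 ≤ s) (hst : s ≤ t) (ht : t ≤ 1) : AEStronglyMeasurable (u s t) P :=
    (hum s t h0 hst ht).mono (natSigma_le hB_meas _)
  obtain ⟨r, hr, hclose⟩ : ∃ r > 0, ∀ s t, 1 - r < s → 0 ≤ s → s ≤ t → t ≤ 1 →
      eLpNorm (fun ω => u s t ω - u 1 1 ω) 2 P ≤ η := by
    have h := hcont.eventually_le_const (pos_iff_ne_zero.2 hη)
    rw [eventually_nhdsWithin_iff, Metric.eventually_nhds_iff] at h
    obtain ⟨r, hr, h⟩ := h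
    refine ⟨r, hr, fun s t hs h0 hst ht => h (y := (s, t)) ?_ ⟨h0, hst, ht⟩⟩
    rw [Prod.dist_eq, Real.dist_eq, Real.dist_eq, max_lt_iff, abs_lt, abs_lt]
    exact ⟨⟨by linarith, by linarith⟩, ⟨by linarith, by linarith⟩⟩
  -- a typical point of the triangle near the corner
  set a : ℝ := max 0 (1 - r / 2) with ha
  have ha1 : a < 1 := max_lt one_pos (by linarith)
  have har : 1 - r < a := lt_of_lt_of_le (by linarith) (le_max_right _ _)
  have ha0 : 0 ≤ a := le_max_left _ _
  have hb1 : (a + 1) / 2 < 1 := by linarith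
  obtain ⟨t, ht, ht'⟩ := exists_mem_Ioc_of_ae_unitTime (ae_memLp_section₂ hu2)
    (ha0.trans (by linarith : a ≤ (a + 1) / 2)) hb1 le_rfl
  obtain ⟨s, hs, hs'⟩ := exists_mem_Ioc_of_ae_unitTime ht' ha0 (by linarith : a < (a + 1) / 2)
    hb1.le
  have hst : s ≤ t := hs.2.trans ht.1.le
  have hs0 : 0 ≤ s := ha0.trans hs.1.le
  have hust : MemLp (u s t) 2 P := by
    have e : (fun ω => lowerTri u (t, s, ω)) = u s t := by
      ext ω
      simp [lowerTri, hst]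
    rwa [e] at hs'
  have hnear := hclose s t (har.trans hs.1) hs0 hst ht.2
  have h11 : AEStronglyMeasurable (u 1 1) P := hm 1 1 zero_le_one le_rfl le_rfl
  have hu11 : MemLp (u 1 1) 2 P := by
    have hd : MemLp (fun ω => u s t ω - u 1 1 ω) 2 P :=
      ⟨hust.1.sub h11, hnear.trans_lt hη'.lt_top⟩
    refine (hust.sub hd).ae_eq (ae_of_all _ fun ω => ?_)
    simp
  refine ⟨hu11, s.toNNReal, ?_, ?_⟩
  · rw [← NNReal.coe_lt_coe, Real.coe_toNNReal s hs0]
    exact hs.2.trans_lt hb1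
  obtain ⟨ξ, hξ⟩ := exists_simpleFunc_eLpNorm_sub_le P (natSigma_le hB_meas s.toNNReal)
    (hum s t hs0 hst ht.2) hust hη
  have hξm : AEStronglyMeasurable (fun ω => ξ ω) P :=
    (((@SimpleFunc.stronglyMeasurable _ _ (_) _ ξ).mono
      (natSigma_le hB_meas s.toNNReal)).aestronglyMeasurable)
  have h11ξ : eLpNorm (fun ω => u 1 1 ω - ξ ω) 2 P ≤ 2 * η := by
    rw [two_mul]
    refine (eLpNorm_sub_le_add h11 hust.1 hξm).trans (add_le_add ?_ hξ)
    rw [eLpNorm_fun_sub_comm]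
    exact hnear
  refine ⟨ξ, h11ξ, fun s' t' hs' hst' ht' => ?_⟩
  rw [Real.coe_toNNReal s hs0] at hs'
  have hs0' := hs0.trans hs'
  have h3 : (3 : ℝ≥0∞) * η = η + 2 * η := by ring
  rw [h3]
  exact (eLpNorm_sub_le_add (hm s' t' hs0' hst' ht') h11 hξm).trans
    (add_le_add (hclose s' t' ((har.trans hs.1).trans_le hs') hs0' hst' ht') h11ξ)

end Corner

/-! ### The limit theorem for Lipschitz test functions -/

section Limit

variable {Ω Ω' : Type*} [mΩ : MeasurableSpace Ω] [mΩ' : MeasurableSpace Ω'] {P : Measure Ω}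
  [IsProbabilityMeasure P] {B : ℝ≥0 → Ω → ℝ} {P' : Measure Ω'} {π : Ω' → Ω} {Z : Ω' → ℝ}

lemma headCoeff_tailCoeff_sq_le (N : ℕ) (δ δ' : ℝ≥0) (c : ℕ → ℝ) (k : ℕ) :
    headCoeff N δ' (tailCoeff N δ c) k ^ 2 ≤ headCoeff N δ' c k ^ 2 := by
  unfold headCoeff tailCoeff
  split_ifs <;> simp [sq_nonneg]

lemma tailCoeff_pow_four_le (N : ℕ) (δ : ℝ≥0) (c : ℕ → ℝ) (k : ℕ) :
    tailCoeff N δ c k ^ 4 ≤ c k ^ 4 := by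
  unfold tailCoeff
  split_ifs
  · simp only [ne_eq, OfNat.ofNat_ne_zero, not_false_eq_true, zero_pow]
    positivity
  · exact le_rfl

lemma memLp_sq_sub_one_gaussianReal : MemLp (fun z : ℝ => z ^ 2 - 1) 2 (gaussianReal 0 1) :=
  (memLp_two_sq_of_memLp_four (f := id) (memLp_id_gaussianReal 4)).sub (memLp_const _)

/-- The limit on the extension depends continuously on its random coefficient. -/
lemma eLpNorm_lift_mul_sub_le (hπ : MeasurePreserving π P' P)
    (hZ_law : HasLaw Z (gaussianReal 0 1) P') (L : ℝ≥0) {ξ ζ : Ω → ℝ}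
    (hξ : AEStronglyMeasurable ξ P) (hζ : AEStronglyMeasurable ζ P) :
    eLpNorm (fun ω' => 1 / 2 * (ξ (π ω') * (L * (Z ω' ^ 2 - 1))) -
      1 / 2 * (ζ (π ω') * (L * (Z ω' ^ 2 - 1)))) 1 P' ≤
      L * eLpNorm (fun z : ℝ => z ^ 2 - 1) 2 (gaussianReal 0 1) *
        eLpNorm (fun ω => ζ ω - ξ ω) 2 P := by
  have hgm : AEStronglyMeasurable (fun z : ℝ => z ^ 2 - 1) (gaussianReal 0 1) :=
    memLp_sq_sub_one_gaussianReal.1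
  have hg : eLpNorm (fun ω' => Z ω' ^ 2 - 1) 2 P' =
      eLpNorm (fun z : ℝ => z ^ 2 - 1) 2 (gaussianReal 0 1) := by
    rw [← hZ_law.map_eq, eLpNorm_map_measure (hZ_law.map_eq ▸ hgm) hZ_law.aemeasurable]
    rfl
  have hd : eLpNorm (fun ω' => ζ (π ω') - ξ (π ω')) 2 P' = eLpNorm (fun ω => ζ ω - ξ ω) 2 P :=
    eLpNorm_comp_measurePreserving (g := fun ω => ζ ω - ξ ω) (hζ.sub hξ) hπ
  have hZm : AEStronglyMeasurable (fun ω' => Z ω' ^ 2 - 1) P' :=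
    ((hZ_law.aemeasurable.pow_const 2).sub_const _).aestronglyMeasurable
  have hdm : AEStronglyMeasurable (fun ω' => ζ (π ω') - ξ (π ω')) P' :=
    AEStronglyMeasurable.comp_measurePreserving (g := fun ω => ζ ω - ξ ω) (hζ.sub hξ) hπ
  have h1 := eLpNorm_smul_le_mul_eLpNorm (p := 2) (q := 2) (r := 1) hdm hZm
  have e : (fun ω' => 1 / 2 * (ξ (π ω') * (L * (Z ω' ^ 2 - 1))) -
      1 / 2 * (ζ (π ω') * (L * (Z ω' ^ 2 - 1)))) = (-(1 / 2) * (L : ℝ)) •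
      ((fun ω' => Z ω' ^ 2 - 1) • fun ω' => ζ (π ω') - ξ (π ω')) := by
    ext ω'
    simp only [Pi.smul_apply, Pi.mul_apply, smul_eq_mul]
    ring
  rw [e, eLpNorm_const_smul, mul_assoc, ← hg, ← hd]
  refine mul_le_mul' ?_ h1
  rw [enorm_mul, Real.enorm_of_nonneg (NNReal.coe_nonneg L), ENNReal.ofReal_coe_nnreal]
  refine mul_le_of_le_one_left' ?_
  rw [Real.enorm_eq_ofReal_abs]
  refine ENNReal.ofReal_le_one.2 ?_
  norm_num

/-- The stable limit theorem, tested against bounded Lipschitz functions, for kernels and processes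
that are measurable on the whole time domain. -/
theorem tendsto_integral_mul_comp_iteratedIto (hB_meas : ∀ t, Measurable (B t))
    (hB : IsBrownianReal B P) {u : ℝ → ℝ → Ω → ℝ}
    (hu : Measurable fun p : ℝ × ℝ × Ω => u p.2.1 p.1 p.2.2)
    (hu2 : MemLp (lowerTri u) 2 (timesMeasure P))
    (hum : ∀ s t, 0 ≤ s → s ≤ t → t ≤ 1 → AEStronglyMeasurable[natSigma B s.toNNReal] (u s t) P)
    (hcont : Tendsto (fun q : ℝ × ℝ => eLpNorm (fun ω => u q.1 q.2 ω - u 1 1 ω) 2 P)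
      (𝓝[timeTriangle] (1, 1)) (𝓝 0))
    {φ : ℕ → ℝ → ℝ} (hφm : ∀ n, Measurable (φ n)) (hφ2 : ∀ n, MemLp (φ n) 2 unitTime) {L : ℝ≥0}
    (hφL : Tendsto (fun n => eLpNorm (φ n) 2 unitTime ^ 2) atTop (𝓝 L))
    (hsmall : ∀ δ ∈ Set.Ico (0 : ℝ) 1, ∃ ε : ℕ → ℝ≥0, Tendsto ε atTop (𝓝 0) ∧
      ∀ n s t, 0 ≤ s → s ≤ δ → 0 ≤ t → t ≤ 1 → |φ n s * φ n t| ≤ ε n)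
    {F : ℕ → Ω → ℝ}
    (hF : ∀ n, IsIteratedItoIntegral B P (fun s t ω => φ n s * φ n t * u s t ω) (F n))
    (hπ : MeasurePreserving π P' P) (hZ_law : HasLaw Z (gaussianReal 0 1) P')
    (hZ_indep : IndepFun Z (fun ω' t => B t (π ω')) P')
    {h : ℝ → ℝ} {K : ℝ≥0} (hhm : Measurable h) (hh1 : ∀ x, |h x| ≤ 1)
    (hh : ∀ a b, |h a - h b| ≤ K * |a - b|)
    {Y : Ω → ℝ} (hY : Measurable[brownianSigma B P] Y) {C : ℝ≥0} (hYC : ∀ ω, |Y ω| ≤ C) :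
    Tendsto (fun n => ∫ ω, Y ω * h (F n ω) ∂P) atTop
      (𝓝 (∫ ω', Y (π ω') * h (1 / 2 * (u 1 1 (π ω') * (L * (Z ω' ^ 2 - 1)))) ∂P')) := by
  have hB' := hB.toIsPreBrownianReal
  have hP' : IsProbabilityMeasure P' :=
    ⟨by simpa using hπ.measure_preimage MeasurableSet.univ.nullMeasurableSet⟩
  have hYm : AEStronglyMeasurable Y P := aestronglyMeasurable_of_brownianSigma hB_meas hY
  -- step approximations of the kernels
  choose N c hN hNn hclose hdiag using fun n : ℕ =>
    exists_stepFun_approx (hφ2 n) (ε := 1 / ((n : ℝ) + 1)) (by positivity) n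
  have hinv : Tendsto (fun n : ℕ => 1 / ((n : ℝ) + 1)) atTop (𝓝 0) :=
    tendsto_one_div_add_atTop_nhds_zero_nat
  have ha : Tendsto (fun n => eLpNorm (fun t => φ n t - stepFun (N n) (c n) t) 2 unitTime) atTop
      (𝓝 0) := by
    refine tendsto_of_tendsto_of_tendsto_of_le_of_le tendsto_const_nhds ?_ (fun _ => zero_le) hclose
    simpa using ENNReal.tendsto_ofReal hinv
  have hsum := tendsto_sum_sq_of_stepFun_approx hφm hφL hN ha
  have hhead' {δ : ℝ≥0} (hδ : δ < 1) :=
    tendsto_eLpNorm_stepFun_headCoeff hφm hsmall hN hNn ha hδ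
  have hhead {δ : ℝ≥0} (hδ : δ < 1) := tendsto_sum_headCoeff_sq hN (hhead' hδ)
  set κ : ℝ≥0∞ := eLpNorm (fun z : ℝ => z ^ 2 - 1) 2 (gaussianReal 0 1) with hκ
  have hκtop : κ ≠ ∞ := memLp_sq_sub_one_gaussianReal.2.ne
  set A : ℝ≥0∞ := C * K * (3 * L) + C * K * (L * κ * 2) with hA
  have hAtop : A ≠ ∞ := by
    simp only [hA]
    finiteness
  rw [tendsto_iff_edist_tendsto_0, ENNReal.tendsto_nhds_zero]
  intro ε hε
  obtain ⟨η, hη0, hη⟩ : ∃ η : ℝ≥0, 0 < η ∧ A * η < ε := by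
    obtain ⟨η, hη0, hη⟩ := ENNReal.exists_nnreal_pos_mul_lt hAtop hε.ne'
    exact ⟨η, hη0, by rwa [mul_comm]⟩
  obtain ⟨hu11, δ, hδ, ξ, hξ11, hξu⟩ := exists_simpleFunc_near_corner hB_meas hu2 hum hcont
    (η := η) (by simpa using hη0.ne') (by simp)
  have hδ1 : (δ : ℝ) < 1 := by exact_mod_cast hδ
  have hξs : StronglyMeasurable[natSigma B δ] (fun ω => ξ ω) :=
    @SimpleFunc.stronglyMeasurable _ _ (natSigma B δ) _ ξ
  have hξm : Measurable (fun ω => ξ ω) := (hξs.mono (natSigma_le hB_meas δ)).measurable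
  obtain ⟨Cξ, hCξ⟩ : ∃ Cξ : ℝ≥0, ∀ ω, |ξ ω| ≤ Cξ := by
    obtain ⟨r, hr⟩ := @SimpleFunc.exists_forall_norm_le _ _ (natSigma B δ) _ ξ
    exact ⟨r.toNNReal, fun ω => (hr ω).trans (Real.le_coe_toNNReal r)⟩
  have hξ2 : MemLp (fun ω => ξ ω) 2 P :=
    MemLp.of_bound hξm.aestronglyMeasurable Cξ (ae_of_all _ hCξ)
  -- the elementary approximations with coefficient `ξ`, supported after time `δ`
  set d : ℕ → ℕ → ℝ := fun n => tailCoeff (N n) δ (c n) with hd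
  have hdsum : Tendsto (fun n => ∑ k ∈ Finset.range (N n), d n k ^ 2 * (N n : ℝ)⁻¹) atTop
      (𝓝 L) := by
    simp_rw [hd, sum_tailCoeff_sq]
    simpa using hsum.sub (hhead hδ)
  have hdhead (δ' : ℝ≥0) (hδ' : δ' < 1) : Tendsto (fun n => ∑ k ∈ Finset.range (N n),
      headCoeff (N n) δ' (d n) k ^ 2 * (N n : ℝ)⁻¹) atTop (𝓝 0) :=
    tendsto_of_tendsto_of_tendsto_of_le_of_le tendsto_const_nhds (hhead hδ')
      (fun n => Finset.sum_nonneg fun k _ => by positivity)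
      (fun n => Finset.sum_le_sum fun k _ => mul_le_mul_of_nonneg_right
        (headCoeff_tailCoeff_sq_le _ _ _ _ _) (by positivity))
  have hd4 (n : ℕ) : ∑ k ∈ Finset.range (N n), d n k ^ 4 * ((N n : ℝ)⁻¹) ^ 2 ≤
      1 / ((n : ℝ) + 1) :=
    (Finset.sum_le_sum fun k _ => mul_le_mul_of_nonneg_right
      (tailCoeff_pow_four_le _ _ _ _) (by positivity)).trans (hdiag n)
  have hd4lim : Tendsto (fun n => ∑ k ∈ Finset.range (N n), d n k ^ 4 * ((N n : ℝ)⁻¹) ^ 2) atTop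
      (𝓝 0) :=
    tendsto_of_tendsto_of_tendsto_of_le_of_le tendsto_const_nhds hinv
      (fun n => Finset.sum_nonneg fun k _ => by positivity) hd4
  have hda : Tendsto (fun n => eLpNorm (fun t => φ n t - stepFun (N n) (d n) t) 2 unitTime) atTop
      (𝓝 0) := by
    refine tendsto_of_tendsto_of_tendsto_of_le_of_le tendsto_const_nhds
      (by simpa using ha.add (hhead' hδ)) (fun _ => zero_le) fun n => ?_
    refine (eLpNorm_sub_le_add (hφm n).aestronglyMeasurable
      (measurable_stepFun (N n) (c n)).aestronglyMeasurable
      (measurable_stepFun _ _).aestronglyMeasurable).trans (add_le_add le_rfl (le_of_eq ?_))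
    simp_rw [← stepFun_sub, hd, sub_tailCoeff]
  have hdiagn : Tendsto (fun n => eLpNorm (fun p : ℝ × ℝ × Ω => diagFun (N n) (d n) p.1 p.2.1) 2
      (timesMeasure P)) atTop (𝓝 0) := by
    have h1 := ENNReal.tendsto_ofReal hd4lim
    simp_rw [← eLpNorm_diagFun_sq (P := P) (hN _)] at h1
    have h2 := h1.ennreal_sqrt
    rwa [ENNReal.ofReal_zero, ENNReal.zero_rpow_of_pos (by norm_num)] at h2
  obtain ⟨θ, hθ, hφθ⟩ := hsmall δ ⟨δ.2, hδ1⟩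
  have hφn := hφL.ennreal_sqrt
  have hLtop : (L : ℝ≥0∞) ^ (2⁻¹ : ℝ) ≠ ∞ := ENNReal.rpow_ne_top_of_nonneg (by norm_num) (by simp)
  have hψn (n : ℕ) : eLpNorm (stepFun (N n) (d n)) 2 unitTime ≤ eLpNorm (φ n) 2 unitTime +
      eLpNorm (fun t => φ n t - stepFun (N n) (d n) t) 2 unitTime := by
    have h1 := eLpNorm_sub_le (hφm n).aestronglyMeasurable ((hφm n).aestronglyMeasurable.sub
      (measurable_stepFun (N n) (d n)).aestronglyMeasurable) (p := 2) (μ := unitTime) (by norm_num)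
    rwa [sub_sub_cancel] at h1
  have hDtop : eLpNorm (lowerTri fun s t ω => u s t ω - ξ ω) 2 (timesMeasure P) ≠ ∞ := by
    have e : lowerTri (fun s t ω => u s t ω - ξ ω) =
        fun p => lowerTri u p - lowerTri (fun _ _ ω => ξ ω) p := funext fun p => lowerTri_sub _ _ p
    rw [e]
    have hb : MemLp (lowerTri fun _ _ ω => ξ ω) 2 (timesMeasure P) := by
      refine MemLp.of_bound (measurable_lowerTri
        (hξm.comp (measurable_snd.comp measurable_snd))).aestronglyMeasurable Cξ
        (ae_of_all _ fun p => ?_)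
      unfold lowerTri
      split_ifs
      · exact hCξ _
      · simp
    exact (hu2.sub hb).2.ne
  set J : ℕ → Ω → ℝ := fun n ω => 1 / 2 * ξ ω * (gridSum B (N n) (d n) ω ^ 2 -
    ∑ k ∈ Finset.range (N n), d n k ^ 2 * gridInc B (N n) k ω ^ 2) with hJdef
  have hJ (n : ℕ) : IsIteratedItoIntegral B P (gridKernel (N n) (d n) fun ω => ξ ω) (J n) :=
    isIteratedItoIntegral_gridKernel hB_meas hB' (hξs.aestronglyMeasurable) hξ2
      fun k hk => if_pos hk
  set Q : ℕ → Ω → ℝ := fun n ω => 1 / 2 * ξ ω * (gridSum B (N n) (d n) ω ^ 2 - L) with hQdef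
  have hG (n : ℕ) : Measurable (gridSum B (N n) (d n)) :=
    (gridSum_measurable_natSigma (B := B) (N n) (d n)).mono (natSigma_le hB_meas 1) le_rfl
  have hQm (n : ℕ) : AEStronglyMeasurable (Q n) P :=
    ((hξm.const_mul _).mul (((hG n).pow_const 2).sub_const _)).aestronglyMeasurable
  have hFm (n : ℕ) : AEStronglyMeasurable (F n) P := by
    obtain ⟨_, _, h2⟩ := hF n
    exact h2.2.1.1
  have hJm (n : ℕ) : AEStronglyMeasurable (J n) P := by
    obtain ⟨_, _, h2⟩ := hJ n
    exact h2.2.1.1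
  -- the distance between the integrals and their approximations
  set E : ℕ → ℝ≥0∞ := fun n =>
    (θ n * eLpNorm (lowerTri fun s t ω => u s t ω - ξ ω) 2 (timesMeasure P) +
      3 * η * eLpNorm (φ n) 2 unitTime ^ 2 +
      Cξ * (eLpNorm (fun t => φ n t - stepFun (N n) (d n) t) 2 unitTime *
          (eLpNorm (φ n) 2 unitTime + (eLpNorm (φ n) 2 unitTime +
            eLpNorm (fun t => φ n t - stepFun (N n) (d n) t) 2 unitTime)) +
        eLpNorm (fun p : ℝ × ℝ × Ω => diagFun (N n) (d n) p.1 p.2.1) 2 (timesMeasure P))) +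
    Cξ * (ENNReal.ofReal (√((∑ k ∈ Finset.range (N n), d n k ^ 4 * ((N n : ℝ)⁻¹) ^ 2) *
          ∫ z, (z ^ 2 - 1) ^ 2 ∂(gaussianReal 0 1))) +
        ENNReal.ofReal |(∑ k ∈ Finset.range (N n), d n k ^ 2 * (N n : ℝ)⁻¹) - L|) with hE
  have hFQ (n : ℕ) : eLpNorm (fun ω => F n ω - Q n ω) 2 P ≤ E n := by
    refine (eLpNorm_sub_le_add (hFm n) (hJm n) (hQm n)).trans (add_le_add ?_ ?_)
    · refine (IsIteratedItoIntegral.eLpNorm_sub_gridKernel_le hB_meas hB' hu (hφm n) (hN n) hξm hCξ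
        (fun s t h0 hs hst ht => hφθ n s t h0 hs (h0.trans hst) ht) hξu (hF n) (hJ n)).trans ?_
      gcongr
      exact hψn n
    · exact eLpNorm_quadratic_sub_le hB_meas hB' _ _ L hCξ
  have hElim : Tendsto E atTop (𝓝 (3 * (η : ℝ≥0∞) * L)) := by
    have t1 : Tendsto (fun n => (θ n : ℝ≥0∞) * eLpNorm (lowerTri fun s t ω => u s t ω - ξ ω) 2
        (timesMeasure P)) atTop (𝓝 0) := by
      simpa using ENNReal.Tendsto.mul_const (ENNReal.tendsto_coe.2 hθ) (Or.inr hDtop)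
    have t2 : Tendsto (fun n => 3 * (η : ℝ≥0∞) * eLpNorm (φ n) 2 unitTime ^ 2) atTop
        (𝓝 (3 * (η : ℝ≥0∞) * L)) := ENNReal.Tendsto.const_mul hφL (Or.inr (by finiteness))
    have t3 : Tendsto (fun n => (Cξ : ℝ≥0∞) *
        (eLpNorm (fun t => φ n t - stepFun (N n) (d n) t) 2 unitTime *
          (eLpNorm (φ n) 2 unitTime + (eLpNorm (φ n) 2 unitTime +
            eLpNorm (fun t => φ n t - stepFun (N n) (d n) t) 2 unitTime)) +
        eLpNorm (fun p : ℝ × ℝ × Ω => diagFun (N n) (d n) p.1 p.2.1) 2 (timesMeasure P))) atTop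
        (𝓝 0) := by
      have h1 := ENNReal.Tendsto.mul hda (Or.inr (by finiteness)) (hφn.add (hφn.add hda))
        (Or.inr (by simp))
      have h2 := ENNReal.Tendsto.const_mul (a := (Cξ : ℝ≥0∞)) (h1.add hdiagn) (Or.inr (by simp))
      simpa using h2
    have t4 : Tendsto (fun n => (Cξ : ℝ≥0∞) *
        (ENNReal.ofReal (√((∑ k ∈ Finset.range (N n), d n k ^ 4 * ((N n : ℝ)⁻¹) ^ 2) *
          ∫ z, (z ^ 2 - 1) ^ 2 ∂(gaussianReal 0 1))) +
        ENNReal.ofReal |(∑ k ∈ Finset.range (N n), d n k ^ 2 * (N n : ℝ)⁻¹) - L|)) atTop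
        (𝓝 0) := by
      have h1 := ENNReal.tendsto_ofReal ((Real.continuous_sqrt.tendsto _).comp
        (hd4lim.mul_const (∫ z, (z ^ 2 - 1) ^ 2 ∂(gaussianReal 0 1))))
      have h2 := ENNReal.tendsto_ofReal (hdsum.sub_const (L : ℝ)).abs
      have h3 := ENNReal.Tendsto.const_mul (a := (Cξ : ℝ≥0∞)) (h1.add h2) (Or.inr (by simp))
      simpa [Function.comp_def] using h3
    have h1 := ((t1.add t2).add t3).add t4
    rwa [zero_add, add_zero, add_zero] at h1
  -- mixing for the approximations
  have hmix : Tendsto (fun n => ∫ ω, Y ω * h (Q n ω) ∂P) atTop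
      (𝓝 (∫ ω', Y (π ω') * h (1 / 2 * (ξ (π ω') * (L * (Z ω' ^ 2 - 1)))) ∂P')) := by
    have h1 := tendsto_integral_mul_comp_simpleFunc hB_meas hB hdsum hdhead
      (h := fun x => h (1 / 2 * x)) (K := K) K.2 (fun x => hh1 _) (fun a b => by
        refine (hh _ _).trans (mul_le_mul_of_nonneg_left ?_ K.2)
        rw [← mul_sub, abs_mul]
        refine mul_le_of_le_one_left (abs_nonneg _) ?_
        norm_num) (hhm.comp (measurable_const.mul measurable_id)) hY hYC hπ hZ_law hZ_indep ξ
    refine h1.congr fun n => integral_congr_ae (ae_of_all _ fun ω => ?_)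
    simp only [hQdef, mul_assoc]
  have hmix' := tendsto_iff_edist_tendsto_0.1 hmix
  have hlast : edist (∫ ω', Y (π ω') * h (1 / 2 * (ξ (π ω') * (L * (Z ω' ^ 2 - 1)))) ∂P')
      (∫ ω', Y (π ω') * h (1 / 2 * (u 1 1 (π ω') * (L * (Z ω' ^ 2 - 1)))) ∂P') ≤
      C * K * (L * κ * (2 * η)) := by
    have hZm := ((hZ_law.aemeasurable.pow_const 2).sub_const 1).const_mul (L : ℝ)
    have hlift (ζ : Ω → ℝ) (hζ : AEStronglyMeasurable ζ P) : AEStronglyMeasurable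
        (fun ω' => 1 / 2 * (ζ (π ω') * (L * (Z ω' ^ 2 - 1)))) P' :=
      ((hζ.comp_measurePreserving hπ).mul hZm.aestronglyMeasurable).const_mul _
    rw [edist_eq_enorm_sub]
    refine (enorm_integral_mul_comp_sub_le hhm hh1 hh (hYm.comp_measurePreserving hπ)
      (fun ω' => hYC _) (hlift _ hξm.aestronglyMeasurable) (hlift _ hu11.1)).trans ?_
    refine mul_le_mul_right ((eLpNorm_lift_mul_sub_le hπ hZ_law L hξm.aestronglyMeasurable
      hu11.1).trans ?_) _
    exact mul_le_mul_right hξ11 _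
  have hbound (n : ℕ) : edist (∫ ω, Y ω * h (F n ω) ∂P)
      (∫ ω', Y (π ω') * h (1 / 2 * (u 1 1 (π ω') * (L * (Z ω' ^ 2 - 1)))) ∂P') ≤
      C * K * E n + edist (∫ ω, Y ω * h (Q n ω) ∂P)
        (∫ ω', Y (π ω') * h (1 / 2 * (ξ (π ω') * (L * (Z ω' ^ 2 - 1)))) ∂P') +
        C * K * (L * κ * (2 * η)) := by
    refine (edist_triangle4 _ (∫ ω, Y ω * h (Q n ω) ∂P)
      (∫ ω', Y (π ω') * h (1 / 2 * (ξ (π ω') * (L * (Z ω' ^ 2 - 1)))) ∂P') _).trans ?_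
    refine add_le_add (add_le_add ?_ le_rfl) hlast
    rw [edist_eq_enorm_sub]
    refine (enorm_integral_mul_comp_sub_le hhm hh1 hh hYm hYC (hFm n) (hQm n)).trans ?_
    refine mul_le_mul_right (le_trans ?_ (hFQ n)) _
    exact eLpNorm_le_eLpNorm_of_exponent_le (by norm_num) ((hFm n).sub (hQm n))
  have hlim : Tendsto (fun n => (C : ℝ≥0∞) * K * E n + edist (∫ ω, Y ω * h (Q n ω) ∂P)
        (∫ ω', Y (π ω') * h (1 / 2 * (ξ (π ω') * (L * (Z ω' ^ 2 - 1)))) ∂P') +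
        C * K * (L * κ * (2 * η))) atTop (𝓝 (A * η)) := by
    have h1 := ((ENNReal.Tendsto.const_mul (a := (C : ℝ≥0∞) * K) hElim
      (Or.inr (by finiteness))).add hmix').add_const (C * K * (L * κ * (2 * η)) : ℝ≥0∞)
    convert h1 using 2
    rw [hA]
    ring
  filter_upwards [hlim.eventually_lt_const hη] with n hn
  exact (hbound n).trans hn.le

end Limit

/-! ### Restriction to the time triangle -/

section Truncation

open scoped Classical in
/-- The process `u`, replaced by `0` off the triangle `0 ≤ s ≤ t ≤ 1`. -/
noncomputable def truncTriangle {Ω : Type*} (u : ℝ → ℝ → Ω → ℝ) (s t : ℝ) (ω : Ω) : ℝ :=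
  if (s, t) ∈ timeTriangle then u s t ω else 0

lemma truncTriangle_of_mem {Ω : Type*} {u : ℝ → ℝ → Ω → ℝ} {s t : ℝ} (h : (s, t) ∈ timeTriangle) :
    truncTriangle u s t = u s t :=
  funext fun _ => if_pos h

lemma measurableSet_timeTriangle : MeasurableSet timeTriangle :=
  (measurableSet_le measurable_const measurable_fst).inter
    ((measurableSet_le measurable_fst measurable_snd).inter
      (measurableSet_le measurable_snd measurable_const))

variable {Ω : Type*} [mΩ : MeasurableSpace Ω] {P : Measure Ω} [IsProbabilityMeasure P]

lemma measurable_truncTriangle {u : ℝ → ℝ → Ω → ℝ}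
    (hu : Measurable (fun p : timeTriangle × Ω => u p.1.1.1 p.1.1.2 p.2)) :
    Measurable fun p : ℝ × ℝ × Ω => truncTriangle u p.2.1 p.1 p.2.2 := by
  have hst : Measurable fun p : ℝ × ℝ × Ω => (p.2.1, p.1) :=
    (measurable_fst.comp measurable_snd).prodMk measurable_fst
  refine measurable_of_restrict_of_restrict_compl
    (s := (fun p : ℝ × ℝ × Ω => (p.2.1, p.1)) ⁻¹' timeTriangle)
    (hst measurableSet_timeTriangle) ?_ ?_
  · have hmap : Measurable fun p : (fun p : ℝ × ℝ × Ω => (p.2.1, p.1)) ⁻¹' timeTriangle =>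
        ((⟨(p.1.2.1, p.1.1), p.2⟩ : timeTriangle), p.1.2.2) :=
      (Measurable.subtype_mk (hst.comp measurable_subtype_coe)).prodMk
        (measurable_snd.comp (measurable_snd.comp measurable_subtype_coe))
    convert hu.comp hmap using 1
    ext p
    exact congrFun (truncTriangle_of_mem p.2) _
  · convert (measurable_const : Measurable fun _ => (0 : ℝ)) using 1
    ext p
    exact if_neg p.2

lemma memLp_lowerTri_truncTriangle {u : ℝ → ℝ → Ω → ℝ}
    (hu : Measurable (fun p : timeTriangle × Ω => u p.1.1.1 p.1.1.2 p.2))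
    (hu_sq : ∫⁻ t in Set.Icc (0 : ℝ) 1, ∫⁻ s in Set.Icc (0 : ℝ) t,
      ∫⁻ ω, ENNReal.ofReal (u s t ω ^ 2) ∂P < ∞) :
    MemLp (lowerTri (truncTriangle u)) 2 (timesMeasure P) := by
  have hm := measurable_lowerTri (measurable_truncTriangle hu)
  refine ⟨hm.aestronglyMeasurable, ?_⟩
  have h : eLpNorm (lowerTri (truncTriangle u)) 2 (timesMeasure P) ^ 2 < ∞ := by
    rw [eLpNorm_timesMeasure_sq hm.aestronglyMeasurable]
    refine lt_of_le_of_lt (lintegral_mono fun t => ?_) hu_sq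
    refine le_trans (lintegral_mono fun s => ?_) ((setLIntegral_le_lintegral (Set.Icc (0 : ℝ) 1)
      ((Set.Icc (0 : ℝ) t).indicator fun s => ∫⁻ ω, ENNReal.ofReal (u s t ω ^ 2) ∂P)).trans
      (lintegral_indicator measurableSet_Icc _).le)
    simp only
    rw [eLpNorm_two_sq]
    by_cases hst : (s, t) ∈ timeTriangle
    · rw [Set.indicator_of_mem (show s ∈ Set.Icc 0 t from ⟨hst.1, hst.2.1⟩)]
      refine lintegral_mono fun ω => ?_
      simp only [lowerTri, hst.2.1, if_true, truncTriangle_of_mem hst]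
      rw [← enorm_pow, Real.enorm_of_nonneg (sq_nonneg _)]
    · have e : ∀ ω, lowerTri (truncTriangle u) (t, s, ω) = 0 := fun ω => by
        simp [lowerTri, truncTriangle, hst]
      simp [e]
  by_contra hcon
  rw [not_lt, top_le_iff] at hcon
  simp [hcon] at h

end Truncation

section Kernel

lemma measurable_indicator_Icc {f : ℝ → ℝ} (hf : Measurable fun t : Set.Icc (0 : ℝ) 1 => f t) :
    Measurable ((Set.Icc (0 : ℝ) 1).indicator f) := by
  refine measurable_of_restrict_of_restrict_compl (s := Set.Icc (0 : ℝ) 1) measurableSet_Icc ?_ ?_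
  · convert hf using 1
    ext t
    exact Set.indicator_of_mem t.2 f
  · convert (measurable_const : Measurable fun _ => (0 : ℝ)) using 1
    ext t
    exact Set.indicator_of_notMem t.2 f

lemma norm_indicator_Icc_le {f : ℝ → ℝ} (h0 : ∀ t ∈ Set.Icc (0 : ℝ) 1, 0 ≤ f t) {C : ℝ}
    (hC : ∀ t ∈ Set.Icc (0 : ℝ) 1, f t ≤ C) (t : ℝ) : ‖(Set.Icc (0 : ℝ) 1).indicator f t‖ ≤ C := by
  have hC0 : 0 ≤ C := (h0 0 (by simp)).trans (hC 0 (by simp))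
  by_cases ht : t ∈ Set.Icc (0 : ℝ) 1
  · rw [Set.indicator_of_mem ht, Real.norm_of_nonneg (h0 t ht)]
    exact hC t ht
  · simpa [ht] using hC0

lemma eLpNorm_indicator_Icc_sq {f : ℝ → ℝ} (hf : MemLp ((Set.Icc (0 : ℝ) 1).indicator f) 2 unitTime) :
    eLpNorm ((Set.Icc (0 : ℝ) 1).indicator f) 2 unitTime ^ 2 =
      ENNReal.ofReal (∫ t in (0 : ℝ)..1, f t ^ 2) := by
  rw [eLpNorm_two_sq_eq_ofReal hf, intervalIntegral.integral_of_le zero_le_one,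
    ← integral_Icc_eq_integral_Ioc]
  congr 1
  refine setIntegral_congr_fun measurableSet_Icc fun t ht => ?_
  simp only [Set.indicator_of_mem ht]

end Kernel

/-- Real and imaginary part of an expectation against a unitary character. -/
lemma integral_mul_exp_I {α : Type*} [MeasurableSpace α] {μ : Measure α} [IsFiniteMeasure μ]
    {Y X : α → ℝ} (hY : AEStronglyMeasurable Y μ) {C : ℝ} (hYC : ∀ x, |Y x| ≤ C)
    (hX : AEStronglyMeasurable X μ) (l : ℝ) :
    ∫ x, (Y x : ℂ) * Complex.exp (Complex.I * ((l * X x : ℝ) : ℂ)) ∂μ =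
      ((∫ x, Y x * Real.cos (l * X x) ∂μ : ℝ) : ℂ) +
        ((∫ x, Y x * Real.sin (l * X x) ∂μ : ℝ) : ℂ) * Complex.I := by
  have hYi : Integrable Y μ := Integrable.of_bound hY C (ae_of_all _ hYC)
  have hc : Integrable (fun x => Y x * Real.cos (l * X x)) μ :=
    hYi.mul_bdd (Real.continuous_cos.comp_aestronglyMeasurable (hX.const_mul l))
      (ae_of_all _ fun _ => Real.abs_cos_le_one _)
  have hs : Integrable (fun x => Y x * Real.sin (l * X x)) μ :=
    hYi.mul_bdd (Real.continuous_sin.comp_aestronglyMeasurable (hX.const_mul l))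
      (ae_of_all _ fun _ => Real.abs_sin_le_one _)
  rw [← integral_complex_ofReal, ← integral_complex_ofReal, ← integral_mul_const,
    ← integral_add hc.ofReal (hs.ofReal.mul_const _)]
  refine integral_congr_ae (ae_of_all _ fun x => ?_)
  simp only
  rw [mul_comm Complex.I, Complex.exp_mul_I]
  push_cast
  ring

theorem theorem2 {Ω Ω' : Type*} [MeasurableSpace Ω] [MeasurableSpace Ω']
    (P : Measure Ω) [IsProbabilityMeasure P]
    -- a standard Brownian motion
    (B : ℝ≥0 → Ω → ℝ) (hB_meas : ∀ t, Measurable (B t)) (hB : IsBrownianReal B P)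
    -- the two-parameter process `u_{s,t}`, `0 ≤ s ≤ t ≤ 1`
    (u : ℝ → ℝ → Ω → ℝ)
    (hu_meas : Measurable (fun p : timeTriangle × Ω => u p.1.1.1 p.1.1.2 p.2))
    (hu_adapted : ∀ s t : ℝ≥0, s ≤ t → t ≤ 1 →
      Measurable[brownianFiltration B P s] (u s t))
    (hu_sq : ∫⁻ t in Set.Icc (0 : ℝ) 1, ∫⁻ s in Set.Icc (0 : ℝ) t,
      ∫⁻ ω, ENNReal.ofReal (u s t ω ^ 2) ∂P < ∞)
    (hu_cont : Tendsto (fun q : ℝ × ℝ => eLpNorm (fun ω => u q.1 q.2 ω - u 1 1 ω) 2 P)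
      (𝓝[timeTriangle] (1, 1)) (𝓝 0))
    -- the kernels
    (φ : ℕ → ℝ → ℝ)
    (hφ_meas : ∀ n, Measurable (fun t : Set.Icc (0 : ℝ) 1 => φ n t))
    (hφ_nonneg : ∀ n, ∀ t ∈ Set.Icc (0 : ℝ) 1, 0 ≤ φ n t)
    (hφ_bdd : ∀ n, ∃ C : ℝ, ∀ t ∈ Set.Icc (0 : ℝ) 1, φ n t ≤ C)
    (L : ℝ) (h1 : KernelConcentrates φ L) (h3 : KernelSupProductVanishes φ)
    -- an extension of the probability space carrying `Z ~ N(0,1)` independent of `B`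
    (P' : Measure Ω') (π : Ω' → Ω) (hπ : MeasurePreserving π P' P)
    (Z : Ω' → ℝ) (hZ_law : HasLaw Z (gaussianReal 0 1) P')
    (hZ_indep : IndepFun Z (fun ω' t => B t (π ω')) P') :
    -- the iterated integrals exist, and (any versions of them) converge stably
    (∀ n, ∃ J : Ω → ℝ,
      IsIteratedItoIntegral B P (fun s t ω => φ n s * φ n t * u s t ω) J) ∧
    ∀ F : ℕ → Ω → ℝ,
      (∀ n, IsIteratedItoIntegral B P (fun s t ω => φ n s * φ n t * u s t ω) (F n)) →
      ConvergesStably P P' π (brownianSigma B P) F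
        (fun ω' => 1 / 2 * L * u 1 1 (π ω') * (Z ω' ^ 2 - 1)) := by
  have hB' := hB.toIsPreBrownianReal
  have : IsProbabilityMeasure P' :=
    ⟨by simpa using hπ.measure_preimage MeasurableSet.univ.nullMeasurableSet⟩
  -- only the values of the kernels on `[0,1]` and of `u` on the triangle matter
  set ψ : ℕ → ℝ → ℝ := fun n => (Set.Icc (0 : ℝ) 1).indicator (φ n) with hψ
  set w := truncTriangle u with hw
  have hψm (n : ℕ) : Measurable (ψ n) := measurable_indicator_Icc (hφ_meas n)
  have hψ_apply (n : ℕ) {t : ℝ} (ht : t ∈ Set.Icc (0 : ℝ) 1) : ψ n t = φ n t :=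
    Set.indicator_of_mem ht _
  have hkernel (n : ℕ) (s t : ℝ) (h : (s, t) ∈ timeTriangle) (ω : Ω) :
      φ n s * φ n t * u s t ω = ψ n s * ψ n t * w s t ω := by
    rw [hψ_apply n ⟨h.1, h.2.1.trans h.2.2⟩, hψ_apply n ⟨h.1.trans h.2.1, h.2.2⟩, hw,
      truncTriangle_of_mem h]
  choose C hC using hφ_bdd
  have hψC (n : ℕ) (t : ℝ) : ‖ψ n t‖ ≤ C n := norm_indicator_Icc_le (hφ_nonneg n) (hC n) t
  have hψ2 (n : ℕ) : MemLp (ψ n) 2 unitTime :=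
    MemLp.of_bound (hψm n).aestronglyMeasurable (C n) (ae_of_all _ (hψC n))
  have hwm := measurable_truncTriangle hu_meas
  have hw2 : MemLp (lowerTri w) 2 (timesMeasure P) := memLp_lowerTri_truncTriangle hu_meas hu_sq
  have hadap (s t : ℝ) (hs : 0 ≤ s) (hst : s ≤ t) (ht : t ≤ 1) :
      AEStronglyMeasurable[natSigma B s.toNNReal] (w s t) P := by
    rw [hw, truncTriangle_of_mem ⟨hs, hst, ht⟩]
    have h := hu_adapted s.toNNReal t.toNNReal (Real.toNNReal_le_toNNReal hst)
      (Real.toNNReal_le_one.2 ht)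
    rw [Real.coe_toNNReal s hs, Real.coe_toNNReal t (hs.trans hst)] at h
    exact aestronglyMeasurable_of_brownianFiltration h
  have h11 : w 1 1 = u 1 1 := truncTriangle_of_mem ⟨zero_le_one, le_rfl, le_rfl⟩
  refine ⟨fun n => ?_, fun F hF => ?_⟩
  · have hmem : MemLp (lowerTri fun s t ω => ψ n s * ψ n t * w s t ω) 2 (timesMeasure P) := by
      have hm : Measurable fun p : ℝ × ℝ × Ω => ψ n p.2.1 * ψ n p.1 * w p.2.1 p.1 p.2.2 :=
        (((hψm n).comp (measurable_fst.comp measurable_snd)).mul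
          ((hψm n).comp measurable_fst)).mul hwm
      refine MemLp.of_le_mul (c := C n * C n) hw2 (measurable_lowerTri hm).aestronglyMeasurable
        (ae_of_all _ fun p => ?_)
      by_cases hp : p.2.1 ≤ p.1
      · simp only [lowerTri, hp, if_true, norm_mul]
        exact mul_le_mul_of_nonneg_right (mul_le_mul (hψC n _) (hψC n _) (norm_nonneg _)
          ((norm_nonneg _).trans (hψC n 0))) (norm_nonneg _)
      · simp [lowerTri, hp]
    obtain ⟨J, hJ⟩ := exists_isIteratedItoIntegral hB_meas hB' hmem
      fun s t hs hst ht => (hadap s t hs hst ht).const_mul (ψ n s * ψ n t)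
    exact ⟨J, hJ.congr fun s t h ω => (hkernel n s t h ω).symm⟩
  · intro Y hY hYb l
    obtain ⟨D, hD⟩ := hYb
    have hF' (n : ℕ) : IsIteratedItoIntegral B P (fun s t ω => ψ n s * ψ n t * w s t ω) (F n) :=
      (hF n).congr (hkernel n)
    have hcont : Tendsto (fun q : ℝ × ℝ => eLpNorm (fun ω => w q.1 q.2 ω - w 1 1 ω) 2 P)
        (𝓝[timeTriangle] (1, 1)) (𝓝 0) := by
      refine hu_cont.congr' ?_
      filter_upwards [self_mem_nhdsWithin] with q hq
      rw [h11, hw, truncTriangle_of_mem hq]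
    obtain ⟨hL0, -, -, -, -, -, hLlim⟩ := h1
    have hψL : Tendsto (fun n => eLpNorm (ψ n) 2 unitTime ^ 2) atTop (𝓝 (L.toNNReal : ℝ≥0∞)) := by
      refine (ENNReal.tendsto_ofReal hLlim).congr fun n => ?_
      exact (eLpNorm_indicator_Icc_sq (hψ2 n)).symm
    have hsmall (δ : ℝ) (hδ : δ ∈ Set.Ico (0 : ℝ) 1) : ∃ ε : ℕ → ℝ≥0, Tendsto ε atTop (𝓝 0) ∧
        ∀ n s t, 0 ≤ s → s ≤ δ → 0 ≤ t → t ≤ 1 → |ψ n s * ψ n t| ≤ ε n := by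
      refine ⟨fun n => ((⨆ t : Set.Icc (0 : ℝ) δ, φ n t) *
        (⨆ t : Set.Icc (0 : ℝ) 1, φ n t)).toNNReal, ?_, fun n s t hs hsδ ht ht1 => ?_⟩
      · have h := (continuous_real_toNNReal.tendsto 0).comp (h3 δ hδ)
        rwa [Real.toNNReal_zero] at h
      · have hs1 : s ∈ Set.Icc (0 : ℝ) 1 := ⟨hs, hsδ.trans hδ.2.le⟩
        have b1 : φ n s ≤ ⨆ t : Set.Icc (0 : ℝ) δ, φ n t :=
          le_ciSup (f := fun t : Set.Icc (0 : ℝ) δ => φ n t)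
            ⟨C n, by rintro _ ⟨x, rfl⟩; exact hC n x ⟨x.2.1, x.2.2.trans hδ.2.le⟩⟩ ⟨s, hs, hsδ⟩
        have b2 : φ n t ≤ ⨆ t : Set.Icc (0 : ℝ) 1, φ n t :=
          le_ciSup (f := fun t : Set.Icc (0 : ℝ) 1 => φ n t)
            ⟨C n, by rintro _ ⟨x, rfl⟩; exact hC n x x.2⟩ ⟨t, ht, ht1⟩
        have n1 := hφ_nonneg n s hs1
        have n2 := hφ_nonneg n t ⟨ht, ht1⟩
        rw [hψ_apply n hs1, hψ_apply n ⟨ht, ht1⟩, abs_of_nonneg (mul_nonneg n1 n2)]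
        exact (mul_le_mul b1 b2 n2 (n1.trans b1)).trans (Real.le_coe_toNNReal _)
    have hDn (ω : Ω) : |Y ω| ≤ D.toNNReal := (hD ω).trans (Real.le_coe_toNNReal D)
    have key (h : ℝ → ℝ) (hhm : Measurable h) (hh1 : ∀ x, |h x| ≤ 1)
        (hh : ∀ a b, |h a - h b| ≤ |a - b|) :
        Tendsto (fun n => ∫ ω, Y ω * h (l * F n ω) ∂P) atTop (𝓝 (∫ ω', Y (π ω') *
          h (l * (1 / 2 * L * u 1 1 (π ω') * (Z ω' ^ 2 - 1))) ∂P')) := by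
      have hlim := tendsto_integral_mul_comp_iteratedIto hB_meas hB hwm hw2 hadap hcont hψm hψ2 hψL
        hsmall hF' hπ hZ_law hZ_indep (h := fun x => h (l * x)) (K := ‖l‖₊)
        (hhm.comp (measurable_const.mul measurable_id)) (fun x => hh1 _) (fun a b => by
          refine (hh _ _).trans (le_of_eq ?_)
          rw [← mul_sub, abs_mul, coe_nnnorm, Real.norm_eq_abs]) hY hDn
      convert hlim using 6 with ω'
      rw [← h11, Real.coe_toNNReal L hL0.le]
      ring
    have hFm (n : ℕ) : AEStronglyMeasurable (F n) P := by
      obtain ⟨_, _, h2⟩ := hF n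
      exact h2.2.1.1
    have hYm : AEStronglyMeasurable Y P := aestronglyMeasurable_of_brownianSigma hB_meas hY
    have h11m : AEStronglyMeasurable (u 1 1) P :=
      h11 ▸ (hadap 1 1 zero_le_one le_rfl le_rfl).mono (natSigma_le hB_meas _)
    have hGm : AEStronglyMeasurable (fun ω' => 1 / 2 * L * u 1 1 (π ω') * (Z ω' ^ 2 - 1)) P' :=
      ((h11m.comp_measurePreserving hπ).const_mul _).mul
        ((hZ_law.aemeasurable.pow_const 2).sub_const 1).aestronglyMeasurable
    rw [integral_mul_exp_I (Y := fun ω' => Y (π ω')) (hYm.comp_measurePreserving hπ)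
      (fun ω' => hD _) hGm]
    simp_rw [integral_mul_exp_I hYm hD (hFm _)]
    refine Tendsto.add ?_ (Tendsto.mul_const _ ?_)
    · exact (Complex.continuous_ofReal.tendsto _).comp
        (key Real.cos Real.measurable_cos Real.abs_cos_le_one Real.abs_cos_sub_cos_le)
    · exact (Complex.continuous_ofReal.tendsto _).comp
        (key Real.sin Real.measurable_sin Real.abs_sin_le_one Real.abs_sin_sub_sin_le)
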